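/- Let $n\ge 0$, $r\ge 2$ be integers, $T,\varepsilon_0>0$, and let $D\subset\mathbb R^n$ be compact. Let $g$ be of class $C^r$ on (a neighbourhood of) $D\times\mathbb R\times[0,\varepsilon_0]$ and $T$-periodic in $t$; precisely, $g:U\times\mathbb R\times J\to\mathbb R^n$ is $C^r$ with $g(x,t+T,\varepsilon)=g(x,t,\varepsilon)$, where $U\supset D$ and $J\supset[0,\varepsilon_0]$ are open. Consider $$\dot x=\varepsilon g(x,t,\varepsilon)\quad(1),\qquad \dot y^0=\varepsilon\langle g\rangle(y^0)\quad(2),\qquad \langle g\rangle(x)=\frac1T\int_0^T g(x,t,0)\,dt .$$ 1. (Change of variables.) There are an open set $V$ with $D\subset V\subset U$, a number $\varepsilon_1\in(0,\varepsilon_0]$, a $C^r$ function $w:V\times\mathbb R\to\mathbb R^n$, $T$-periodic in $t$, and a $C^{r-1}$ function $g_1:V\times\mathbb R\times[0,\varepsilon_1]\to\mathbb R^n$, $T$-periodic in $t$, such that for every $\varepsilon\in[0,\varepsilon_1]$ the map $(y,t)\mapsto(y+\varepsilon w(y,t),t)$ is a $C^r$ diffeomorphism from $V\times\mathbb R$ onto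 an open set that contains $D\times\mathbb R$ and is contained in $U\times\mathbb R$, and a function $y(t)$ with values in $V$, on any interval, satisfies $$\dot y=\varepsilon\langle g\rangle(y)+\varepsilon^2 g_1(y,t,\varepsilon)$$ if and only if $x(t)=y(t)+\varepsilon w(y(t),t)$ satisfies (1). 2. (Approximation.) For all $C_0,L>0$ there are $C>0$ and $\varepsilon_1\in(0,\varepsilon_0]$ such that for all $\varepsilon\in(0,\varepsilon_1]$ and $0\le\tau\le L/\varepsilon$: if $y^0:[0,\tau]\to D$ solves (2) and $\|x_0-y^0(0)\|\le C_0\varepsilon$, then (1) has a solution $x:[0,\tau]\to U$ with $x(0)=x_0$, and each such solution satisfies $\|x(t)-y^0(t)\|\le C\varepsilon$ for all $t\in[0,\tau]$. 3. (Periodic orbits.) Let $y^\star\in D$ with $\langle g\rangle(y^\star)=0$, and suppose that $A=\partial_y\langle g\rangle(y^\star)$ does not have the eigenvalue $0$. Then there are $C>0$ and $\varepsilon_1\in(0,\varepsilon_0]$ such that for each $\varepsilon\in(0,\varepsilon_1]$ equation (1) has a $T$-periodic solution $\gamma_\varepsilon:\mathbb R\to U$ with $\|\gamma_\varepsilon(t)-y^\star\|\le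 C\varepsilon$ for all $t$. If in addition no complex eigenvalue of $A$ has real part $0$, then for all sufficiently small $\varepsilon>0$ the solution $\gamma_\varepsilon$ of (1) has the same type of stability as the equilibrium $y^\star$ of (2), that is: - no characteristic (Floquet) multiplier of $\gamma_\varepsilon$ over the period $T$ lies on the unit circle, and, counted with algebraic multiplicity, the numbers of multipliers inside and outside the unit circle are equal to the numbers of eigenvalues of $A$ with negative and positive real part, respectively; - $\gamma_\varepsilon$ is stable (in the sense of Lyapunov, for $t\ge0$) if and only if $y^\star$ is; $\gamma_\varepsilon$ is asymptotically stable (a sink) if and only if $y^\star$ is; $\gamma_\varepsilon$ is asymptotically stable in reversed time (a source) if and only if $y^\star$ is. -/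

import Mathlib

open Set Filter Topology

/-- `x` solves the differential equation `x' = F (x, t)` on the time set `I` (an interval), with
values in the phase space `U`. At end points of `I` the derivative is one-sided. -/
def IsSolutionOn {n : ℕ} (F : EuclideanSpace ℝ (Fin n) → ℝ → EuclideanSpace ℝ (Fin n))
    (U : Set (EuclideanSpace ℝ (Fin n))) (x : ℝ → EuclideanSpace ℝ (Fin n)) (I : Set ℝ) : Prop :=
  ∀ t ∈ I, x t ∈ U ∧ HasDerivWithinAt x (F (x t) t) I t

/-- The average `⟨g⟩(x) = (1/T) ∫₀ᵀ g(x, t, 0) dt`. -/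
noncomputable def average {n : ℕ} (T : ℝ)
    (g : EuclideanSpace ℝ (Fin n) → ℝ → ℝ → EuclideanSpace ℝ (Fin n))
    (x : EuclideanSpace ℝ (Fin n)) : EuclideanSpace ℝ (Fin n) :=
  T⁻¹ • ∫ t in (0 : ℝ)..T, g x t 0

/-- The right-hand side `ε g(x, t, ε)` of the original system. -/
noncomputable def originalField {n : ℕ}
    (g : EuclideanSpace ℝ (Fin n) → ℝ → ℝ → EuclideanSpace ℝ (Fin n)) (ε : ℝ) :
    EuclideanSpace ℝ (Fin n) → ℝ → EuclideanSpace ℝ (Fin n) :=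
  fun x t => ε • g x t ε

/-- The right-hand side `ε ⟨g⟩(y)` of the averaged system (it does not depend on time). -/
noncomputable def averagedField {n : ℕ} (T : ℝ)
    (g : EuclideanSpace ℝ (Fin n) → ℝ → ℝ → EuclideanSpace ℝ (Fin n)) (ε : ℝ) :
    EuclideanSpace ℝ (Fin n) → ℝ → EuclideanSpace ℝ (Fin n) :=
  fun y _ => ε • average T g y

/-- The right-hand side `ε ⟨g⟩(y) + ε² g₁(y, t, ε)` of the transformed system. -/
noncomputable def transformedField {n : ℕ} (T : ℝ)
    (g g₁ : EuclideanSpace ℝ (Fin n) → ℝ → ℝ → EuclideanSpace ℝ (Fin n)) (ε : ℝ) :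
    EuclideanSpace ℝ (Fin n) → ℝ → EuclideanSpace ℝ (Fin n) :=
  fun y t => ε • average T g y + ε ^ 2 • g₁ y t ε

/-- For the fixed value `ε`, the map `(y, t) ↦ (y + ε w(y, t), t)` is a `C^r` change of
coordinates: a `C^r` diffeomorphism from `V × ℝ` onto an open set which contains `D × ℝ` and is
contained in `U × ℝ`. -/
def IsChangeOfCoordinates {n : ℕ} (r : ℕ) (D U V : Set (EuclideanSpace ℝ (Fin n)))
    (w : EuclideanSpace ℝ (Fin n) → ℝ → EuclideanSpace ℝ (Fin n)) (ε : ℝ) : Prop :=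
  ∃ e : OpenPartialHomeomorph (EuclideanSpace ℝ (Fin n) × ℝ) (EuclideanSpace ℝ (Fin n) × ℝ),
    e.source = V ×ˢ univ ∧
    (∀ p ∈ e.source, e p = (p.1 + ε • w p.1 p.2, p.2)) ∧
    D ×ˢ univ ⊆ e.target ∧ e.target ⊆ U ×ˢ univ ∧
    ContDiffOn ℝ r e e.source ∧ ContDiffOn ℝ r e.symm e.target

/-- The reference solution `γ` of `x' = F (x, t)` is (Lyapunov) stable. The fields for which this
is used are locally Lipschitz in `x`, so that the solution `x` starting at `x₀` is unique. -/
def IsStableSolution {n : ℕ} (F : EuclideanSpace ℝ (Fin n) → ℝ → EuclideanSpace ℝ (Fin n))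
    (U : Set (EuclideanSpace ℝ (Fin n))) (γ : ℝ → EuclideanSpace ℝ (Fin n)) : Prop :=
  ∀ δ > 0, ∃ η > 0, ∀ x₀, ‖x₀ - γ 0‖ ≤ η →
    ∃ x, IsSolutionOn F U x (Ici 0) ∧ x 0 = x₀ ∧ ∀ t ≥ 0, ‖x t - γ t‖ ≤ δ

/-- `γ` is asymptotically stable: it is stable and attracts all solutions from a neighbourhood. -/
def IsSinkSolution {n : ℕ} (F : EuclideanSpace ℝ (Fin n) → ℝ → EuclideanSpace ℝ (Fin n))
    (U : Set (EuclideanSpace ℝ (Fin n))) (γ : ℝ → EuclideanSpace ℝ (Fin n)) : Prop :=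
  IsStableSolution F U γ ∧ ∃ η > 0, ∀ x₀, ‖x₀ - γ 0‖ ≤ η →
    ∃ x, IsSolutionOn F U x (Ici 0) ∧ x 0 = x₀ ∧ Tendsto (fun t => x t - γ t) atTop (𝓝 0)

/-- `γ` is a source: after reversal of time, `t ↦ γ (-t)` is asymptotically stable. -/
def IsSourceSolution {n : ℕ} (F : EuclideanSpace ℝ (Fin n) → ℝ → EuclideanSpace ℝ (Fin n))
    (U : Set (EuclideanSpace ℝ (Fin n))) (γ : ℝ → EuclideanSpace ℝ (Fin n)) : Prop :=
  IsSinkSolution (fun x t => -F x (-t)) U (fun t => γ (-t))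

/-- The complex eigenvalues of a real linear map, with algebraic multiplicity. -/
noncomputable def complexEigenvalues {n : ℕ}
    (A : EuclideanSpace ℝ (Fin n) →L[ℝ] EuclideanSpace ℝ (Fin n)) : Multiset ℂ :=
  (LinearMap.charpoly (A : EuclideanSpace ℝ (Fin n) →ₗ[ℝ] EuclideanSpace ℝ (Fin n))).aroots ℂ

/-- `M` is the monodromy map over the period `T` of the linearization
`ξ' = ∂ₓF(γ(t), t) ξ` along `γ`. Its eigenvalues are the characteristic multipliers of `γ`. -/
def IsMonodromy {n : ℕ} (F : EuclideanSpace ℝ (Fin n) → ℝ → EuclideanSpace ℝ (Fin n))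
    (γ : ℝ → EuclideanSpace ℝ (Fin n)) (T : ℝ)
    (M : EuclideanSpace ℝ (Fin n) →L[ℝ] EuclideanSpace ℝ (Fin n)) : Prop :=
  ∃ X : ℝ → (EuclideanSpace ℝ (Fin n) →L[ℝ] EuclideanSpace ℝ (Fin n)),
    X 0 = ContinuousLinearMap.id ℝ (EuclideanSpace ℝ (Fin n)) ∧
    (∀ t, HasDerivAt X ((fderiv ℝ (fun x => F x t) (γ t)).comp (X t)) t) ∧ X T = M

open Classical in
/-- The `T`-periodic solution `γ` of `x' = F (x, t)` has no characteristic multiplier on the unit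
circle, and as many multipliers inside (outside) the unit circle as the Jacobian of the
autonomous field `f` at its equilibrium `y` has eigenvalues of negative (positive) real part. -/
def SameLinearType {n : ℕ} (T : ℝ)
    (F : EuclideanSpace ℝ (Fin n) → ℝ → EuclideanSpace ℝ (Fin n))
    (γ : ℝ → EuclideanSpace ℝ (Fin n))
    (f : EuclideanSpace ℝ (Fin n) → EuclideanSpace ℝ (Fin n))
    (y : EuclideanSpace ℝ (Fin n)) : Prop :=
  ∃ M, IsMonodromy F γ T M ∧
    (∀ μ ∈ complexEigenvalues M, ‖μ‖ ≠ 1) ∧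
    (complexEigenvalues M).countP (fun μ => ‖μ‖ < 1) =
      (complexEigenvalues (fderiv ℝ f y)).countP (fun μ => μ.re < 0) ∧
    (complexEigenvalues M).countP (fun μ => 1 < ‖μ‖) =
      (complexEigenvalues (fderiv ℝ f y)).countP (fun μ => 0 < μ.re)

/-- The `T`-periodic solution `γ` of `x' = F (x, t)` has the same type of stability as the
hyperbolic equilibrium `y` of `y' = f y`: the linearizations have the same type, and `γ` is
stable, a sink, or a source if and only if `y` is. -/
def SameStabilityType {n : ℕ} (U : Set (EuclideanSpace ℝ (Fin n))) (T : ℝ)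
    (F : EuclideanSpace ℝ (Fin n) → ℝ → EuclideanSpace ℝ (Fin n))
    (γ : ℝ → EuclideanSpace ℝ (Fin n))
    (f : EuclideanSpace ℝ (Fin n) → EuclideanSpace ℝ (Fin n))
    (y : EuclideanSpace ℝ (Fin n)) : Prop :=
  SameLinearType T F γ f y ∧
  (IsStableSolution F U γ ↔ IsStableSolution (fun x _ => f x) U (fun _ => y)) ∧
  (IsSinkSolution F U γ ↔ IsSinkSolution (fun x _ => f x) U (fun _ => y)) ∧
  (IsSourceSolution F U γ ↔ IsSourceSolution (fun x _ => f x) U (fun _ => y))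

/-!
The proof rests on the near-identity transformation with the primitive
`w(x, t) = ∫₀ᵗ (g(x, s, 0) - ⟨g⟩(x)) ds` of the oscillating part of the field, which is periodic in
`t` because the integrand has mean zero. All analysis is done for fields which are defined for all
`(x, t, ε)` and vanish for large `(x, ε)`; a smooth cutoff reduces the given field to this case
near any compact set (`IsLocalField.exists_isRegularField`). Such fields, their averages and `w`
have bounded and Lipschitz continuous derivatives, uniformly in time; these bounds are collected in
`IsAveragingData`.

*Change of variables.* For small `ε` the map `(y, t) ↦ (y + ε w(y, t), t)` differs from the identity
by a contraction, hence is a global `Cʳ` diffeomorphism. Writing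
`g(y + ε w, t, ε) - g(y, t, 0)` as `ε` times an integral of derivatives gives an explicit formula
for the remainder `g₁`, which shows that it is of class `C^(r-1)` up to `ε = 0`
(`transformedRemainder`).

*Approximation.* If `x' = ε g(x, t, ε)`, then `z = x - ε w(x, t)` satisfies
`z' = ε (⟨g⟩(x) + O(ε))` (`IsAveragingData.hasDerivWithinAt_reduced`). This form of the
transformation needs no inversion. Grönwall's inequality then compares `z` with the averaged
equation on times of order `1 / ε`.

*Periodic orbits.* The function `(x(T) - x(0)) / (εT)` of the initial value is approximated by the
derivative `A` of the average, with an error that is small in the Lipschitz sense on a ball of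
radius independent of `ε`; so it has a zero within `O(ε)` of the equilibrium
(`IsAveragingData.exists_periodic`). In the same way the monodromy operator of a solution near the
equilibrium is `1 + εTA + O(ε²)`. As the list of eigenvalues depends continuously on the operator,
and `1 + s z` lies inside or outside the unit circle for small `s > 0` according to the sign of
`Re z`, the multipliers are located (`exists_forall_sameSpectralType`).

*Stability.* If all eigenvalues of `A` have negative real part, the Lyapunov equation has a positive
definite solution; applied to the difference of two solutions in the coordinates `z`, it shows
exponential attraction. If some eigenvalue has positive real part, the Lyapunov equation of `A - σ`
with a suitable `σ > 0` gives a quadratic form which grows exponentially along differences of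
solutions, so that no nearby solution is stable. Hence stability and asymptotic stability are both
equivalent to all eigenvalues of `A` having negative real part. The averaged equation is the
special case of a field `g` which does not depend on `t` and `ε`, and sources are treated by
reversing time.
-/

/-! ### Complex eigenvalues of real operators -/

/-- The complex matrix of a real operator in the standard basis. -/
noncomputable def complexMatrix {n : ℕ} :
    (EuclideanSpace ℝ (Fin n) →L[ℝ] EuclideanSpace ℝ (Fin n)) →ₐ[ℝ] Matrix (Fin n) (Fin n) ℂ :=
  (Algebra.ofId ℝ ℂ).mapMatrix.comp
    ((Matrix.toEuclideanCLM (n := Fin n) (𝕜 := ℝ)).symm : _ ≃⋆ₐ[ℝ] _).toAlgEquiv.toAlgHom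

section LinearAlgebra

open Matrix Polynomial

variable {n : ℕ}

local notation "𝔼" => EuclideanSpace ℝ (Fin n)

theorem complexMatrix_apply (A : 𝔼 →L[ℝ] 𝔼) :
    complexMatrix A = ((Matrix.toEuclideanCLM (n := Fin n) (𝕜 := ℝ)).symm A).map (algebraMap ℝ ℂ) :=
  rfl

theorem exists_matrix (A : 𝔼 →L[ℝ] 𝔼) :
    ∃ M : Matrix (Fin n) (Fin n) ℝ, Matrix.toEuclideanCLM (n := Fin n) (𝕜 := ℝ) M = A :=
  ⟨_, StarAlgEquiv.apply_symm_apply _ A⟩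

theorem charpoly_toEuclideanCLM (M : Matrix (Fin n) (Fin n) ℝ) :
    LinearMap.charpoly ((Matrix.toEuclideanCLM (n := Fin n) (𝕜 := ℝ) M : 𝔼 →L[ℝ] 𝔼) : 𝔼 →ₗ[ℝ] 𝔼)
      = M.charpoly := by
  rw [Matrix.coe_toEuclideanCLM_eq_toEuclideanLin,
    ← LinearMap.charpoly_toMatrix _ (EuclideanSpace.basisFun (Fin n) ℝ).toBasis]
  congr 1
  exact LinearMap.toMatrix_toLin _ _ M

theorem complexEigenvalues_eq_roots (A : 𝔼 →L[ℝ] 𝔼) :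
    complexEigenvalues A = (complexMatrix A).charpoly.roots := by
  obtain ⟨M, rfl⟩ := exists_matrix A
  rw [complexEigenvalues, charpoly_toEuclideanCLM, complexMatrix_apply,
    StarAlgEquiv.symm_apply_apply, Matrix.charpoly_map, aroots]

theorem card_complexEigenvalues (A : 𝔼 →L[ℝ] 𝔼) : (complexEigenvalues A).card = n := by
  rw [complexEigenvalues_eq_roots, IsAlgClosed.card_roots_eq_natDegree, charpoly_natDegree_eq_dim,
    Fintype.card_fin]

theorem charpoly_complexMatrix (A : 𝔼 →L[ℝ] 𝔼) :
    (complexMatrix A).charpoly = ((complexEigenvalues A).map fun a => X - C a).prod := by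
  rw [complexEigenvalues_eq_roots]
  exact (IsAlgClosed.splits _).eq_prod_roots_of_monic (charpoly_monic _)

theorem det_sub_complexMatrix (A : 𝔼 →L[ℝ] 𝔼) (z : ℂ) :
    (Matrix.scalar (Fin n) z - complexMatrix A).det =
      ((complexEigenvalues A).map fun a => z - a).prod := by
  rw [← eval_charpoly, charpoly_complexMatrix, eval_multiset_prod, Multiset.map_map]
  simp

theorem complexEigenvalues_eq_of_det {A : 𝔼 →L[ℝ] 𝔼} {s : Multiset ℂ}
    (h : ∀ z, (Matrix.scalar (Fin n) z - complexMatrix A).det = (s.map fun a => z - a).prod) :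
    complexEigenvalues A = s := by
  have : (complexMatrix A).charpoly = (s.map fun a => X - C a).prod := by
    refine Polynomial.funext fun z => ?_
    rw [eval_charpoly, h, eval_multiset_prod, Multiset.map_map]
    simp
  rw [complexEigenvalues_eq_roots, this, roots_multiset_prod_X_sub_C]

/-- Affine functions map the eigenvalues, with multiplicity. -/
theorem complexEigenvalues_affine (a : ℝ) {c : ℝ} (hc : c ≠ 0) (B : 𝔼 →L[ℝ] 𝔼) :
    complexEigenvalues (a • (1 : 𝔼 →L[ℝ] 𝔼) + c • B) =
      (complexEigenvalues B).map fun μ => (a : ℂ) + c * μ := by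
  have hc' : (c : ℂ) ≠ 0 := by exact_mod_cast hc
  refine complexEigenvalues_eq_of_det fun z => ?_
  have h1 : Matrix.scalar (Fin n) z - complexMatrix (a • (1 : 𝔼 →L[ℝ] 𝔼) + c • B) =
      (c : ℂ) • (Matrix.scalar (Fin n) ((z - a) / c) - complexMatrix B) := by
    rw [map_add, map_smul, map_smul, map_one]
    ext i j
    by_cases hij : i = j
    · subst hij
      simp
      field_simp
      ring
    · simp [hij]
  rw [h1, det_smul, det_sub_complexMatrix, Multiset.map_map]
  have h2 : (c : ℂ) ^ Fintype.card (Fin n) =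
      ((complexEigenvalues B).map fun _ => (c : ℂ)).prod := by
    rw [Multiset.map_const', Multiset.prod_replicate, card_complexEigenvalues, Fintype.card_fin]
  rw [h2, ← Multiset.prod_map_mul]
  congr 1
  refine Multiset.map_congr rfl fun μ _ => ?_
  simp
  field_simp
  ring

theorem complexEigenvalues_smul {c : ℝ} (hc : c ≠ 0) (B : 𝔼 →L[ℝ] 𝔼) :
    complexEigenvalues (c • B) = (complexEigenvalues B).map fun μ => (c : ℂ) * μ := by
  have h := complexEigenvalues_affine 0 hc B
  rw [show (0 : ℝ) • (1 : 𝔼 →L[ℝ] 𝔼) + c • B = c • B by ext; simp] at h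
  simpa using h

theorem complexEigenvalues_neg (B : 𝔼 →L[ℝ] 𝔼) :
    complexEigenvalues (-B) = (complexEigenvalues B).map fun μ => -μ := by
  have h := complexEigenvalues_smul (c := -1) (by norm_num) B
  rw [show (-1 : ℝ) • B = -B by ext; simp] at h
  simpa using h

theorem mem_complexEigenvalues {A : 𝔼 →L[ℝ] 𝔼} {μ : ℂ} :
    μ ∈ complexEigenvalues A ↔ (Matrix.scalar (Fin n) μ - complexMatrix A).det = 0 := by
  rw [det_sub_complexMatrix, Multiset.prod_eq_zero_iff]
  simp [sub_eq_zero]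

theorem mem_complexEigenvalues_iff_spectrum {A : 𝔼 →L[ℝ] 𝔼} {μ : ℂ} :
    μ ∈ complexEigenvalues A ↔ μ ∈ spectrum ℂ (complexMatrix A) := by
  rw [mem_complexEigenvalues, spectrum.mem_iff, Matrix.isUnit_iff_isUnit_det, isUnit_iff_ne_zero,
    not_not]
  rfl

/-- A complex eigenvalue `α + iβ` of a real operator has an eigenvector `a + ib`. -/
theorem exists_eigenvector {A : 𝔼 →L[ℝ] 𝔼} {μ : ℂ} (hμ : μ ∈ complexEigenvalues A) :
    ∃ a b : 𝔼, (a ≠ 0 ∨ b ≠ 0) ∧ A a = μ.re • a - μ.im • b ∧ A b = μ.im • a + μ.re • b := by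
  obtain ⟨M, rfl⟩ := exists_matrix A
  obtain ⟨v, hv, hMv⟩ := Matrix.exists_mulVec_eq_zero_iff.2 (mem_complexEigenvalues.1 hμ)
  rw [sub_mulVec, sub_eq_zero, complexMatrix_apply, StarAlgEquiv.symm_apply_apply] at hMv
  have hi : ∀ i, μ * v i = ∑ j, (M i j : ℂ) * v j := by
    intro i
    have := congrFun hMv i
    simpa [mulVec, dotProduct, Matrix.diagonal_apply] using this
  refine ⟨WithLp.toLp 2 fun i => (v i).re, WithLp.toLp 2 fun i => (v i).im, ?_, ?_, ?_⟩
  · by_contra! h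
    refine hv (funext fun i => Complex.ext ?_ ?_)
    · simpa using congrArg (fun u : 𝔼 => u i) h.1
    · simpa using congrArg (fun u : 𝔼 => u i) h.2
  · ext i
    have := congrArg Complex.re (hi i)
    simp only [Complex.mul_re, Complex.re_sum, Complex.ofReal_re, Complex.ofReal_im, zero_mul,
      sub_zero] at this
    simp [mulVec, dotProduct, ← this]
  · ext i
    have := congrArg Complex.im (hi i)
    simp only [Complex.mul_im, Complex.im_sum, Complex.ofReal_re, Complex.ofReal_im, zero_mul,
      add_zero] at this
    simp [mulVec, dotProduct, ← this]
    ring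

end LinearAlgebra

/-! ### The Lyapunov equation and powers of operators -/

section Spectral

open Matrix Polynomial
open scoped RealInnerProductSpace

variable {n : ℕ}

local notation "𝔼" => EuclideanSpace ℝ (Fin n)

/-- `P A = B P` implies `P p(A) = p(B) P` for polynomials `p`. -/
theorem mul_aeval_of_semiconjBy {R : Type*} [Ring R] [Algebra ℝ R] {P A B : R}
    (h : SemiconjBy P A B) (p : ℝ[X]) : P * aeval A p = aeval B p * P := by
  induction p using Polynomial.induction_on with
  | C a => simp [Algebra.commutes]
  | add p q hp hq => simp [mul_add, add_mul, hp, hq]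
  | monomial k a ih =>
    have := (h.pow_right (k + 1)).eq
    simp only [map_mul, aeval_C, map_pow, aeval_X]
    rw [← mul_assoc, ← Algebra.commutes, mul_assoc, this, mul_assoc]

theorem mem_complexEigenvalues_toEuclideanCLM {M : Matrix (Fin n) (Fin n) ℝ} {μ : ℂ} :
    μ ∈ complexEigenvalues (Matrix.toEuclideanCLM (n := Fin n) (𝕜 := ℝ) M) ↔
      aeval μ M.charpoly = 0 := by
  rw [complexEigenvalues, charpoly_toEuclideanCLM, mem_aroots]
  exact and_iff_right (charpoly_monic M).ne_zero

/-- The Lyapunov operator `P ↦ Mᵀ P + P M` is injective if no two eigenvalues of `M` add up to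
zero: a solution of `Mᵀ P = P (-M)` satisfies `0 = p(Mᵀ) P = P p(-M)` for the characteristic
polynomial `p` of `M`, and `p(-M)` is invertible. -/
theorem eq_zero_of_lyapunov {M : Matrix (Fin n) (Fin n) ℝ}
    (h : ∀ μ ∈ complexEigenvalues (Matrix.toEuclideanCLM (n := Fin n) (𝕜 := ℝ) M),
      ∀ ν ∈ complexEigenvalues (Matrix.toEuclideanCLM (n := Fin n) (𝕜 := ℝ) M), μ + ν ≠ 0)
    {P : Matrix (Fin n) (Fin n) ℝ} (hP : Mᵀ * P + P * M = 0) : P = 0 := by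
  have hcop : IsCoprime M.charpoly (-M).charpoly := by
    rw [Polynomial.isCoprime_iff_aeval_ne_zero_of_isAlgClosed (k := ℝ) ℂ]
    intro a
    by_contra! hc
    have h1 := mem_complexEigenvalues_toEuclideanCLM.2 hc.1
    have h2 := mem_complexEigenvalues_toEuclideanCLM.2 hc.2
    rw [map_neg, complexEigenvalues_neg, Multiset.mem_map] at h2
    obtain ⟨ν, hν, hνa⟩ := h2
    exact h a h1 ν hν (by rw [← hνa]; ring)
  obtain ⟨a, b, hab⟩ := hcop
  have hunit : aeval (-M) M.charpoly * aeval (-M) a = 1 := by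
    have := congrArg (aeval (-M)) hab
    rw [map_add, map_mul, map_mul, aeval_self_charpoly, mul_zero, add_zero, map_one] at this
    rwa [← map_mul, mul_comm, map_mul]
  have hsemi : SemiconjBy P (-M) Mᵀ := by
    rw [SemiconjBy, mul_neg, eq_comm, ← add_eq_zero_iff_eq_neg, hP]
  have h0 := mul_aeval_of_semiconjBy hsemi M.charpoly
  rw [← charpoly_transpose, aeval_self_charpoly, zero_mul, charpoly_transpose] at h0
  calc P = P * (aeval (-M) M.charpoly * aeval (-M) a) := by rw [hunit, mul_one]
    _ = 0 := by rw [← mul_assoc, h0, zero_mul]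

/-- Solvability of the Lyapunov equation `Aᵀ P + P A = q`. -/
theorem exists_lyapunov {A : 𝔼 →L[ℝ] 𝔼}
    (h : ∀ μ ∈ complexEigenvalues A, ∀ ν ∈ complexEigenvalues A, μ + ν ≠ 0) (q : ℝ) :
    ∃ P : 𝔼 →L[ℝ] 𝔼, (∀ u v, ⟪P u, v⟫ = ⟪u, P v⟫) ∧ ∀ u, 2 * ⟪P u, A u⟫ = q * ‖u‖ ^ 2 := by
  obtain ⟨M, rfl⟩ := exists_matrix A
  let L : Matrix (Fin n) (Fin n) ℝ →ₗ[ℝ] Matrix (Fin n) (Fin n) ℝ :=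
    LinearMap.mulLeft ℝ Mᵀ + LinearMap.mulRight ℝ M
  have hL : ∀ P, L P = Mᵀ * P + P * M := fun P => rfl
  have hinj : Function.Injective L := by
    rw [injective_iff_map_eq_zero]
    exact fun P hP => eq_zero_of_lyapunov h hP
  obtain ⟨P, hP⟩ := LinearMap.injective_iff_surjective.1 hinj (Matrix.scalar (Fin n) q)
  have hsymm : Pᵀ = P := by
    refine hinj ?_
    rw [hP, hL, ← transpose_transpose M, ← transpose_mul, ← transpose_mul, ← transpose_add,
      transpose_transpose, add_comm, ← hL, hP]
    simp
  have hinner : ∀ (N : Matrix (Fin n) (Fin n) ℝ) (u v : 𝔼),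
      ⟪Matrix.toEuclideanCLM (n := Fin n) (𝕜 := ℝ) N u, v⟫ =
        ⟪u, Matrix.toEuclideanCLM (n := Fin n) (𝕜 := ℝ) Nᵀ v⟫ := by
    intro N u v
    rw [real_inner_comm, inner_toEuclideanCLM, inner_toEuclideanCLM, dotProduct_mulVec,
      ← mulVec_transpose, dotProduct_comm]
  refine ⟨Matrix.toEuclideanCLM (n := Fin n) (𝕜 := ℝ) P, fun u v => by rw [hinner, hsymm],
    fun u => ?_⟩
  have h1 : ⟪Matrix.toEuclideanCLM (n := Fin n) (𝕜 := ℝ) P u,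
      Matrix.toEuclideanCLM (n := Fin n) (𝕜 := ℝ) M u⟫ =
      ⟪u, Matrix.toEuclideanCLM (n := Fin n) (𝕜 := ℝ) (P * M) u⟫ := by
    rw [hinner, hsymm, map_mul]
    rfl
  have h2 : ⟪Matrix.toEuclideanCLM (n := Fin n) (𝕜 := ℝ) P u,
      Matrix.toEuclideanCLM (n := Fin n) (𝕜 := ℝ) M u⟫ =
      ⟪u, Matrix.toEuclideanCLM (n := Fin n) (𝕜 := ℝ) (Mᵀ * P) u⟫ := by
    rw [real_inner_comm, hinner, map_mul]
    rfl
  rw [two_mul]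
  nth_rw 1 [h2]
  rw [h1, ← inner_add_right, ← _root_.add_apply, ← map_add, ← hL, hP,
    ← real_inner_self_eq_norm_sq, ← inner_smul_right]
  congr 1
  ext i
  simp [Matrix.mulVec_diagonal]

section Gelfand

attribute [local instance] Matrix.linftyOpNormedRing Matrix.linftyOpNormedAlgebra

/-- By Gelfand's formula, the powers of a complex matrix with spectrum in the open unit disc tend to
zero. -/
theorem Matrix.tendsto_pow_of_spectrum_lt_one (M : Matrix (Fin n) (Fin n) ℂ)
    (h : ∀ μ ∈ spectrum ℂ M, ‖μ‖ < 1) : Tendsto (fun k => M ^ k) atTop (𝓝 0) := by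
  rcases subsingleton_or_nontrivial (Matrix (Fin n) (Fin n) ℂ) with hs | hs
  · rw [show (fun k => M ^ k) = fun _ => 0 from funext fun k => Subsingleton.elim _ _]
    exact tendsto_const_nhds
  have hr : spectralRadius ℂ M < (1 : NNReal) :=
    spectrum.spectralRadius_lt_of_forall_lt M fun μ hμ => by
      simpa [← NNReal.coe_lt_coe] using h μ hμ
  obtain ⟨r, hr1, hr2⟩ := ENNReal.lt_iff_exists_nnreal_btwn.1 hr
  have hev :=
    (spectrum.pow_nnnorm_pow_one_div_tendsto_nhds_spectralRadius M).eventually_lt_const hr1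
  have hlt : (r : ℝ) < 1 := by exact_mod_cast hr2
  refine squeeze_zero_norm' ?_ (tendsto_pow_atTop_nhds_zero_of_lt_one r.coe_nonneg hlt)
  filter_upwards [hev, eventually_gt_atTop 0] with k hk hk0
  have hk' : (0 : ℝ) < k := by exact_mod_cast hk0
  have h1 := ENNReal.rpow_lt_rpow hk hk'
  rw [← ENNReal.rpow_mul, one_div_mul_cancel hk'.ne', ENNReal.rpow_one, ENNReal.rpow_natCast] at h1
  have h2 : ‖M ^ k‖₊ < r ^ k := by exact_mod_cast h1
  exact_mod_cast h2.le

end Gelfand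

/-- The powers of an operator with all eigenvalues in the open unit disc tend to zero. -/
theorem tendsto_pow_of_eigenvalues_lt_one {B : 𝔼 →L[ℝ] 𝔼}
    (h : ∀ μ ∈ complexEigenvalues B, ‖μ‖ < 1) : Tendsto (fun k => B ^ k) atTop (𝓝 0) := by
  have h1 := Matrix.tendsto_pow_of_spectrum_lt_one (complexMatrix B) fun μ hμ =>
    h μ (mem_complexEigenvalues_iff_spectrum.2 hμ)
  obtain ⟨M, rfl⟩ := exists_matrix B
  have h2 : Tendsto (fun k => M ^ k) atTop (𝓝 0) := by
    refine tendsto_pi_nhds.2 fun i => tendsto_pi_nhds.2 fun j => ?_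
    have hc : Continuous fun N : Matrix (Fin n) (Fin n) ℂ => (N i j).re := by fun_prop
    have h3 := (hc.tendsto 0).comp h1
    have h4 : ∀ k, complexMatrix (Matrix.toEuclideanCLM (n := Fin n) (𝕜 := ℝ) M) ^ k =
        (M ^ k).map (algebraMap ℝ ℂ) := fun k => by
      rw [← map_pow, ← map_pow, complexMatrix_apply, StarAlgEquiv.symm_apply_apply]
    refine h3.congr fun k => ?_
    rw [Function.comp_apply, h4]
    simp
  have hc : Continuous (Matrix.toEuclideanCLM (n := Fin n) (𝕜 := ℝ)) :=
    LinearMap.continuous_of_finiteDimensional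
      (Matrix.toEuclideanCLM (n := Fin n) (𝕜 := ℝ)).toAlgEquiv.toLinearMap
  have h4 := (hc.tendsto 0).comp h2
  rw [map_zero] at h4
  exact h4.congr fun k => map_pow _ _ _

/-- Distance of `1 + s z` to the origin in terms of the real part of `z`. -/
theorem norm_one_add_mul_sq (s : ℝ) (z : ℂ) :
    ‖1 + s * z‖ ^ 2 = 1 + s * (2 * z.re + s * ‖z‖ ^ 2) := by
  rw [← Complex.normSq_eq_norm_sq, ← Complex.normSq_eq_norm_sq, Complex.normSq_apply,
    Complex.normSq_apply]
  simp
  ring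

theorem norm_one_add_mul_lt_one {s : ℝ} (hs : 0 < s) {z : ℂ} :
    ‖1 + s * z‖ < 1 ↔ 2 * z.re + s * ‖z‖ ^ 2 < 0 := by
  rw [← sq_lt_one_iff₀ (norm_nonneg _), norm_one_add_mul_sq]
  constructor
  · intro h; by_contra! hc; nlinarith [mul_nonneg hs.le hc]
  · intro h; nlinarith [mul_pos hs (neg_pos.2 h)]

theorem one_lt_norm_one_add_mul {s : ℝ} (hs : 0 < s) {z : ℂ} :
    1 < ‖1 + s * z‖ ↔ 0 < 2 * z.re + s * ‖z‖ ^ 2 := by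
  rw [← one_lt_sq_iff₀ (norm_nonneg _), norm_one_add_mul_sq]
  constructor
  · intro h; by_contra! hc; nlinarith [mul_nonneg hs.le (neg_nonneg.2 hc)]
  · intro h; nlinarith [mul_pos hs h]

end Spectral

/-! ### Quadratic forms adapted to the spectrum, and operators near the identity -/

section Lyapunov

open scoped RealInnerProductSpace

variable {n : ℕ}

local notation "𝔼" => EuclideanSpace ℝ (Fin n)

/-- If all eigenvalues of `A` have negative real part, then `-‖u‖²` is the derivative along
`u' = A u` of a positive definite quadratic form. Positivity follows from the Euler scheme
`B = 1 + hA`: the form does not increase under `B`, and `Bᵏ → 0` for small `h`. -/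
theorem exists_lyapunov_of_re_neg {A : 𝔼 →L[ℝ] 𝔼} (h : ∀ μ ∈ complexEigenvalues A, μ.re < 0) :
    ∃ P : 𝔼 →L[ℝ] 𝔼, (∀ u v, ⟪P u, v⟫ = ⟪u, P v⟫) ∧ (∀ u, 2 * ⟪P u, A u⟫ = -‖u‖ ^ 2) ∧
      ∃ c > 0, ∀ u, c * ‖u‖ ^ 2 ≤ ⟪P u, u⟫ := by
  obtain ⟨P, hsymm, hP⟩ := exists_lyapunov (A := A) (fun μ hμ ν hν h0 => by
    have := congrArg Complex.re h0
    simp only [Complex.add_re, Complex.zero_re] at this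
    linarith [h μ hμ, h ν hν]) (-1)
  refine ⟨P, hsymm, fun u => by rw [hP]; ring, ?_⟩
  have hev : ∀ᶠ s in 𝓝[>] (0 : ℝ), s * (‖P‖ * ‖A‖ ^ 2) ≤ 1 / 2 ∧
      ∀ μ ∈ (complexEigenvalues A).toFinset, 2 * μ.re + s * ‖μ‖ ^ 2 < 0 := by
    refine (Eventually.and ?_ ?_).filter_mono nhdsWithin_le_nhds
    · have : Tendsto (fun s : ℝ => s * (‖P‖ * ‖A‖ ^ 2)) (𝓝 0) (𝓝 (0 * (‖P‖ * ‖A‖ ^ 2))) :=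
        tendsto_id.mul_const _
      rw [zero_mul] at this
      exact this.eventually_le_const (by norm_num)
    · rw [Finset.eventually_all]
      intro μ hμ
      have : Tendsto (fun s : ℝ => 2 * μ.re + s * ‖μ‖ ^ 2) (𝓝 0) (𝓝 (2 * μ.re + 0 * ‖μ‖ ^ 2)) :=
        (tendsto_id.mul_const _).const_add _
      refine this.eventually_lt_const ?_
      linarith [h μ (Multiset.mem_toFinset.1 hμ)]
  obtain ⟨s, ⟨hs1, hs2⟩, hs0⟩ := (hev.and self_mem_nhdsWithin).exists
  have hs0 : 0 < s := hs0
  let B : 𝔼 →L[ℝ] 𝔼 := (1 : ℝ) • (1 : 𝔼 →L[ℝ] 𝔼) + s • A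
  have hBapp : ∀ u, B u = u + s • A u := fun u => by simp [B]
  have hB : Tendsto (fun k => B ^ k) atTop (𝓝 0) := by
    refine tendsto_pow_of_eigenvalues_lt_one fun μ hμ => ?_
    rw [complexEigenvalues_affine 1 hs0.ne', Multiset.mem_map] at hμ
    obtain ⟨ν, hν, rfl⟩ := hμ
    simpa using (norm_one_add_mul_lt_one hs0).2 (hs2 ν (Multiset.mem_toFinset.2 hν))
  have hstep : ∀ u, ⟪P (B u), B u⟫ + s / 2 * ‖u‖ ^ 2 ≤ ⟪P u, u⟫ := by
    intro u
    have h1 : ⟪P (B u), B u⟫ = ⟪P u, u⟫ + s * (2 * ⟪P u, A u⟫) + s ^ 2 * ⟪P (A u), A u⟫ := by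
      rw [hBapp, map_add, map_smul, inner_add_left, inner_add_right, inner_add_right,
        inner_smul_left, inner_smul_right, inner_smul_left, inner_smul_right, hsymm (A u) u,
        real_inner_comm (P u) (A u)]
      simp
      ring
    have h2 : ⟪P (A u), A u⟫ ≤ ‖P‖ * ‖A‖ ^ 2 * ‖u‖ ^ 2 := by
      calc ⟪P (A u), A u⟫ ≤ ‖P (A u)‖ * ‖A u‖ := real_inner_le_norm _ _
        _ ≤ (‖P‖ * (‖A‖ * ‖u‖)) * (‖A‖ * ‖u‖) := by
          gcongr
          · exact (P.le_opNorm _).trans (by gcongr; exact A.le_opNorm u)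
          · exact A.le_opNorm u
        _ = _ := by ring
    rw [h1, hP]
    have h3 : s ^ 2 * ⟪P (A u), A u⟫ ≤ s * (1 / 2) * ‖u‖ ^ 2 := by
      calc s ^ 2 * ⟪P (A u), A u⟫ ≤ s ^ 2 * (‖P‖ * ‖A‖ ^ 2 * ‖u‖ ^ 2) := by gcongr
        _ = s * (s * (‖P‖ * ‖A‖ ^ 2)) * ‖u‖ ^ 2 := by ring
        _ ≤ _ := by gcongr
    linarith
  have hiter : ∀ k u, ⟪P ((B ^ k) u), (B ^ k) u⟫ ≤ ⟪P u, u⟫ := by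
    intro k
    induction k with
    | zero => simp
    | succ k ih =>
      intro u
      have := hstep ((B ^ k) u)
      rw [pow_succ', mul_apply_eq_comp]
      nlinarith [ih u, sq_nonneg ‖(B ^ k) u‖]
  have hnonneg : ∀ u, 0 ≤ ⟪P u, u⟫ := by
    intro u
    have h1 : Tendsto (fun k => (B ^ k) u) atTop (𝓝 0) := by
      have h0 := ((ContinuousLinearMap.apply ℝ 𝔼 u).continuous.tendsto 0).comp hB
      rwa [map_zero] at h0
    have h2 : Tendsto (fun k => ⟪P ((B ^ k) u), (B ^ k) u⟫) atTop (𝓝 ⟪P 0, (0 : 𝔼)⟫) :=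
      ((P.continuous.tendsto 0).comp h1).inner h1
    rw [inner_zero_right] at h2
    exact le_of_tendsto' h2 fun k => hiter k u
  exact ⟨s / 2, by positivity, fun u => by linarith [hstep u, hnonneg (B u)]⟩

/-- If `A` has an eigenvalue with positive real part, then there is a quadratic form `V` which is
positive somewhere and whose derivative along `u' = A u` is `2σ V + ‖u‖²` with `σ > 0`. It solves
the Lyapunov equation of `A - σ`, where `σ` avoids the finitely many resonant values. -/
theorem exists_chetaev_of_re_pos {A : 𝔼 →L[ℝ] 𝔼} (h : ∃ μ ∈ complexEigenvalues A, 0 < μ.re) :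
    ∃ P : 𝔼 →L[ℝ] 𝔼, (∀ u v, ⟪P u, v⟫ = ⟪u, P v⟫) ∧ (∃ u, 0 < ⟪P u, u⟫) ∧
      ∃ σ > 0, ∀ u, 2 * ⟪P u, A u⟫ = 2 * σ * ⟪P u, u⟫ + ‖u‖ ^ 2 := by
  obtain ⟨μ, hμ, hpos⟩ := h
  let S : Set ℝ := (fun p : ℂ × ℂ => (p.1.re + p.2.re) / 2) ''
    ((complexEigenvalues A).toFinset ×ˢ (complexEigenvalues A).toFinset : Finset (ℂ × ℂ))
  have hS : S.Finite := (Finset.finite_toSet _).image _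
  obtain ⟨σ, ⟨hσ0, hσμ⟩, hσS⟩ := ((Ioo_infinite hpos).sdiff hS).nonempty
  let B : 𝔼 →L[ℝ] 𝔼 := (-σ) • (1 : 𝔼 →L[ℝ] 𝔼) + (1 : ℝ) • A
  have hBapp : ∀ u, B u = A u - σ • u := fun u => by simp [B]; abel
  obtain ⟨P, hsymm, hP⟩ := exists_lyapunov (A := B) (by
    intro a ha b hb h0
    rw [complexEigenvalues_affine _ one_ne_zero, Multiset.mem_map] at ha hb
    obtain ⟨a, ha, rfl⟩ := ha
    obtain ⟨b, hb, rfl⟩ := hb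
    refine hσS ⟨(a, b), by simp [ha, hb], ?_⟩
    have := congrArg Complex.re h0
    simp at this
    simp only
    linarith) 1
  have hP' : ∀ u, 2 * ⟪P u, A u⟫ = 2 * σ * ⟪P u, u⟫ + ‖u‖ ^ 2 := by
    intro u
    have := hP u
    rw [hBapp, inner_sub_right, inner_smul_right] at this
    linarith
  refine ⟨P, hsymm, ?_, σ, hσ0, hP'⟩
  obtain ⟨a, b, hab, ha, hb⟩ := exists_eigenvector hμ
  have key : 2 * (μ.re - σ) * (⟪P a, a⟫ + ⟪P b, b⟫) = ‖a‖ ^ 2 + ‖b‖ ^ 2 := by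
    have h1 := hP' a
    have h2 := hP' b
    rw [ha, inner_sub_right, inner_smul_right, inner_smul_right] at h1
    rw [hb, inner_add_right, inner_smul_right, inner_smul_right, hsymm b a,
      real_inner_comm (P a) b] at h2
    linarith
  have hsum : 0 < ‖a‖ ^ 2 + ‖b‖ ^ 2 := by
    rcases hab with h | h
    · have := norm_pos_iff.2 h; positivity
    · have := norm_pos_iff.2 h; positivity
  by_contra! hneg
  nlinarith [hneg a, hneg b]

open Classical in
/-- The operator `M` has no eigenvalue on the unit circle, and, counted with multiplicity, as many
inside and outside the unit circle as `A` has to the left and to the right of the imaginary axis. -/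
def SameSpectralType (M A : 𝔼 →L[ℝ] 𝔼) : Prop :=
  (∀ μ ∈ complexEigenvalues M, ‖μ‖ ≠ 1) ∧
    (complexEigenvalues M).countP (fun μ => ‖μ‖ < 1) =
      (complexEigenvalues A).countP (fun μ => μ.re < 0) ∧
    (complexEigenvalues M).countP (fun μ => 1 < ‖μ‖) =
      (complexEigenvalues A).countP (fun μ => 0 < μ.re)

/-- The eigenvalues, listed with multiplicity. -/
theorem exists_eigenvalue_list (A : 𝔼 →L[ℝ] 𝔼) :
    ∃ l : Fin n → ℂ, complexEigenvalues A = Finset.univ.val.map l := by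
  have key : ∀ m : Multiset ℂ, m.card = n → ∃ l : Fin n → ℂ, m = Finset.univ.val.map l := by
    rintro ⟨L⟩ h
    have h : L.length = n := h
    subst h
    exact ⟨L.get, by rw [Fin.univ_val_map, List.ofFn_get]; rfl⟩
  exact key _ (card_complexEigenvalues A)

/-- The eigenvalues are bounded by the norm, since `‖A a‖² + ‖A b‖² = ‖μ‖² (‖a‖² + ‖b‖²)` for an
eigenvector `a + ib`. -/
theorem norm_le_of_mem_complexEigenvalues (A : 𝔼 →L[ℝ] 𝔼) {μ : ℂ}
    (h : μ ∈ complexEigenvalues A) : ‖μ‖ ≤ ‖A‖ := by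
  obtain ⟨a, b, hab, ha, hb⟩ := exists_eigenvector h
  have hsum : 0 < ‖a‖ ^ 2 + ‖b‖ ^ 2 := by
    rcases hab with h | h
    · have := norm_pos_iff.2 h; positivity
    · have := norm_pos_iff.2 h; positivity
  have h1 : ‖A a‖ ^ 2 + ‖A b‖ ^ 2 = ‖μ‖ ^ 2 * (‖a‖ ^ 2 + ‖b‖ ^ 2) := by
    rw [ha, hb, norm_sub_sq_real, norm_add_sq_real, ← Complex.normSq_eq_norm_sq,
      Complex.normSq_apply, inner_smul_left, inner_smul_right, inner_smul_left, inner_smul_right]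
    simp only [norm_smul, Real.norm_eq_abs, mul_pow, sq_abs, conj_trivial]
    ring
  have h2 : ‖A a‖ ^ 2 + ‖A b‖ ^ 2 ≤ ‖A‖ ^ 2 * (‖a‖ ^ 2 + ‖b‖ ^ 2) := by
    rw [mul_add, ← mul_pow, ← mul_pow]
    gcongr <;> exact A.le_opNorm _
  rw [h1] at h2
  exact le_of_sq_le_sq (le_of_mul_le_mul_right h2 hsum) (norm_nonneg _)

theorem continuous_complexMatrix :
    Continuous (complexMatrix : (𝔼 →L[ℝ] 𝔼) → Matrix (Fin n) (Fin n) ℂ) :=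
  LinearMap.continuous_of_finiteDimensional
    (complexMatrix : (𝔼 →L[ℝ] 𝔼) →ₐ[ℝ] Matrix (Fin n) (Fin n) ℂ).toLinearMap

/-- Limits of lists of eigenvalues are lists of eigenvalues. -/
theorem eigenvalue_list_of_tendsto {A : 𝔼 →L[ℝ] 𝔼} {B : ℕ → 𝔼 →L[ℝ] 𝔼}
    (hB : Tendsto B atTop (𝓝 A)) {l : ℕ → Fin n → ℂ}
    (hl : ∀ k, complexEigenvalues (B k) = Finset.univ.val.map (l k)) {m : Fin n → ℂ}
    (hm : Tendsto l atTop (𝓝 m)) : complexEigenvalues A = Finset.univ.val.map m := by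
  refine complexEigenvalues_eq_of_det fun z => ?_
  have hprod : ∀ f : Fin n → ℂ, ((Finset.univ.val.map f).map fun a => z - a).prod =
      ∏ i, (z - f i) := fun f => by rw [Multiset.map_map]; rfl
  have h1 : Tendsto (fun k => (Matrix.scalar (Fin n) z - complexMatrix (B k)).det) atTop
      (𝓝 (Matrix.scalar (Fin n) z - complexMatrix A).det) := by
    have hc : Continuous fun C : 𝔼 →L[ℝ] 𝔼 => (Matrix.scalar (Fin n) z - complexMatrix C).det :=
      (continuous_const.sub continuous_complexMatrix).matrix_det
    exact (hc.tendsto A).comp hB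
  have h2 : Tendsto (fun k => ∏ i, (z - l k i)) atTop (𝓝 (∏ i, (z - m i))) :=
    tendsto_finsetProd _ fun i _ => (tendsto_pi_nhds.1 hm i).const_sub z
  rw [hprod]
  refine tendsto_nhds_unique h1 (h2.congr fun k => ?_)
  rw [det_sub_complexMatrix, hl, hprod]

/-- Sequential form of the location of the eigenvalues of `1 + sB` for `B` near a hyperbolic `A`.
Lists of eigenvalues of the `B k` are bounded, so a subsequence converges to the list of eigenvalues
of `A`. -/
theorem frequently_sameSpectralType {A : 𝔼 →L[ℝ] 𝔼}
    (hA : ∀ μ ∈ complexEigenvalues A, μ.re ≠ 0) {B : ℕ → 𝔼 →L[ℝ] 𝔼}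
    (hB : Tendsto B atTop (𝓝 A)) {s : ℕ → ℝ} (hs : ∀ k, 0 < s k) (hs0 : Tendsto s atTop (𝓝 0)) :
    ∃ k, SameSpectralType ((1 : ℝ) • (1 : 𝔼 →L[ℝ] 𝔼) + s k • B k) A := by
  choose l hl using fun k => exists_eigenvalue_list (B k)
  obtain ⟨R, hR⟩ := hB.norm.bddAbove_range
  have hmem : ∀ k, l k ∈ Metric.closedBall (0 : Fin n → ℂ) (max R 0) := by
    intro k
    rw [mem_closedBall_zero_iff, pi_norm_le_iff_of_nonneg (le_max_right _ _)]
    intro i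
    refine (norm_le_of_mem_complexEigenvalues (B k) ?_).trans
      ((hR (mem_range_self k)).trans (le_max_left _ _))
    rw [hl]
    exact Multiset.mem_map_of_mem _ (Finset.mem_univ_val i)
  obtain ⟨m, -, φ, hφ, hm⟩ := tendsto_subseq_of_bounded Metric.isBounded_closedBall hmem
  have hAm := eigenvalue_list_of_tendsto (hB.comp hφ.tendsto_atTop) (fun k => hl (φ k)) hm
  have hlim : ∀ i, Tendsto (fun k => 2 * (l (φ k) i).re + s (φ k) * ‖l (φ k) i‖ ^ 2) atTop
      (𝓝 (2 * (m i).re)) := by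
    intro i
    have hi : Tendsto (fun k => l (φ k) i) atTop (𝓝 (m i)) := tendsto_pi_nhds.1 hm i
    have h1 := ((Complex.continuous_re.tendsto _).comp hi).const_mul 2
    have h2 := (hs0.comp hφ.tendsto_atTop).mul (hi.norm.pow 2)
    simpa using h1.add h2
  have hev : ∀ᶠ k in atTop, ∀ i,
      (‖1 + (s (φ k) : ℂ) * l (φ k) i‖ < 1 ∧ (m i).re < 0) ∨
      (1 < ‖1 + (s (φ k) : ℂ) * l (φ k) i‖ ∧ 0 < (m i).re) := by
    rw [eventually_all]
    intro i
    have hne : (m i).re ≠ 0 := hA _ (by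
      rw [hAm]; exact Multiset.mem_map_of_mem _ (Finset.mem_univ_val i))
    rcases hne.lt_or_gt with h | h
    · filter_upwards [(hlim i).eventually_lt_const (by linarith : 2 * (m i).re < 0)] with k hk
      exact Or.inl ⟨(norm_one_add_mul_lt_one (hs _)).2 hk, h⟩
    · filter_upwards [(hlim i).eventually_const_lt (by linarith : 0 < 2 * (m i).re)] with k hk
      exact Or.inr ⟨(one_lt_norm_one_add_mul (hs _)).2 hk, h⟩
  obtain ⟨k, hk⟩ := hev.exists
  refine ⟨φ k, ?_⟩
  have hM : complexEigenvalues ((1 : ℝ) • (1 : 𝔼 →L[ℝ] 𝔼) + s (φ k) • B (φ k)) =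
      Finset.univ.val.map fun i => 1 + (s (φ k) : ℂ) * l (φ k) i := by
    rw [complexEigenvalues_affine 1 (hs _).ne', hl, Multiset.map_map]
    simp
  rw [SameSpectralType, hM, hAm]
  refine ⟨?_, ?_, ?_⟩
  · intro μ hμ
    obtain ⟨i, -, rfl⟩ := Multiset.mem_map.1 hμ
    rcases hk i with h | h
    · exact h.1.ne
    · exact h.1.ne'
  · rw [Multiset.countP_map, Multiset.countP_map]
    congr 1
    refine Multiset.filter_congr fun i _ => ?_
    rcases hk i with h | h
    · exact iff_of_true h.1 h.2
    · exact iff_of_false h.1.not_gt h.2.not_gt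
  · rw [Multiset.countP_map, Multiset.countP_map]
    congr 1
    refine Multiset.filter_congr fun i _ => ?_
    rcases hk i with h | h
    · exact iff_of_false h.1.not_gt h.2.not_gt
    · exact iff_of_true h.1 h.2

/-- For a hyperbolic `A`, the operators `1 + sB` with small `s > 0` and `‖B - A‖ ≤ cs` have as
many eigenvalues inside and outside the unit circle as `A` has to the left and to the right of the
imaginary axis. -/
theorem exists_forall_sameSpectralType {A : 𝔼 →L[ℝ] 𝔼}
    (hA : ∀ μ ∈ complexEigenvalues A, μ.re ≠ 0) (c : ℝ) :
    ∃ s₀ > 0, ∀ s ∈ Ioc 0 s₀, ∀ B : 𝔼 →L[ℝ] 𝔼, ‖B - A‖ ≤ c * s →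
      SameSpectralType ((1 : ℝ) • (1 : 𝔼 →L[ℝ] 𝔼) + s • B) A := by
  by_contra! hcon
  choose s hs B hB hnot using fun k : ℕ => hcon (1 / ((k : ℝ) + 1)) (by positivity)
  have hs0 : Tendsto s atTop (𝓝 0) :=
    squeeze_zero (fun k => (hs k).1.le) (fun k => (hs k).2) tendsto_one_div_add_atTop_nhds_zero_nat
  have hBA : Tendsto B atTop (𝓝 A) := by
    rw [tendsto_iff_norm_sub_tendsto_zero]
    exact squeeze_zero (fun k => norm_nonneg _) hB (by simpa using hs0.const_mul c)
  obtain ⟨k, hk⟩ := frequently_sameSpectralType hA hBA (fun k => (hs k).1) hs0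
  exact hnot k hk

end Lyapunov

/-! ### Global solutions of differential equations -/

section GlobalSolutions

variable {F : Type*} [NormedAddCommGroup F] [NormedSpace ℝ F]

/-- The a priori bound for solutions of a differential equation of linear growth. -/
theorem norm_sub_le_of_linear_growth {α : ℝ → F} {α' : ℝ → F} {x₀ : F} {K C N : ℝ}
    (hK : 0 ≤ K) (hC : 0 ≤ C) (h0 : α 0 = x₀)
    (hα : ∀ t ∈ Icc 0 N, HasDerivWithinAt α (α' t) (Icc 0 N) t)
    (hb : ∀ t ∈ Icc 0 N, ‖α' t‖ ≤ K * ‖α t - x₀‖ + C) :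
    ∀ t ∈ Icc 0 N, ‖α t - x₀‖ ≤ gronwallBound 0 K C N := by
  intro t ht
  have h := norm_le_gronwallBound_of_norm_deriv_right_le (f := fun t => α t - x₀) (f' := α')
    (δ := 0) (K := K) (ε := C) (a := 0) (b := N)
    (fun s hs => ((hα s hs).sub_const x₀).continuousWithinAt)
    (fun s hs => (((hα s (Ico_subset_Icc_self hs)).sub_const x₀).mono_of_mem_nhdsWithin
      (Icc_mem_nhdsGE_of_mem hs))) (by simp [h0])
    (fun s hs => hb s (Ico_subset_Icc_self hs)) t ht
  exact h.trans (gronwallBound_mono le_rfl hC hK (by simpa using ht.2))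

variable [FiniteDimensional ℝ F]

/-- Solutions of a globally Lipschitz equation exist on every bounded interval: cut off the space
variable outside the ball given by the a priori bound, and apply the Picard-Lindelöf theorem to
the bounded field obtained in this way. -/
theorem exists_solution_Ioo {v : ℝ → F → F} {K : NNReal} (hv : ∀ t, LipschitzWith K (v t))
    (hc : ∀ x, Continuous fun t => v t x) (x₀ : F) {N : ℝ} (hN : 0 < N) :
    ∃ α : ℝ → F, α 0 = x₀ ∧ ∀ t ∈ Ioo (-N) N, HasDerivAt α (v t (α t)) t := by
  obtain ⟨C, hC⟩ := isCompact_Icc.exists_bound_of_continuousOn (s := Icc (-N) N)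
    (hc x₀).continuousOn
  have hC0 : 0 ≤ C := (norm_nonneg _).trans (hC 0 (by simp [hN.le]))
  set R : ℝ := gronwallBound 0 K C N + 1 with hR
  have hR0 : 0 < R := by
    have := gronwallBound_mono le_rfl hC0 K.coe_nonneg hN.le
    rw [gronwallBound_x0] at this
    linarith
  let ψ : ContDiffBump x₀ := ⟨R, R + 1, hR0, by linarith⟩
  let ρ : F → F := fun x => ψ x • (x - x₀)
  obtain ⟨K₀, hK₀⟩ : ∃ K₀, LipschitzWith K₀ ρ :=
    ContDiff.lipschitzWith_of_hasCompactSupport (𝕂 := ℝ) (n := 1) (ψ.hasCompactSupport.smul_right)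
      (ψ.contDiff.smul (contDiff_id.sub contDiff_const)) one_ne_zero
  have hρ1 : ∀ x, ‖ρ x‖ ≤ ‖x - x₀‖ := fun x => by
    rw [norm_smul, Real.norm_of_nonneg ψ.nonneg]
    exact mul_le_of_le_one_left (norm_nonneg _) ψ.le_one
  have hρ2 : ∀ x, ‖ρ x‖ ≤ R + 1 := fun x => by
    by_cases hx : x ∈ Metric.ball x₀ (R + 1)
    · rw [mem_ball_iff_norm] at hx
      exact (hρ1 x).trans hx.le
    · have : ψ x = 0 := ψ.zero_of_le_dist (by simpa using hx)
      simp only [ρ, this, zero_smul, norm_zero]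
      linarith
  have hρ3 : ∀ x, ‖x - x₀‖ ≤ R → ρ x = x - x₀ := fun x hx => by
    simp only [ρ]
    rw [ψ.one_of_mem_closedBall (by rwa [mem_closedBall_iff_norm]), one_smul]
  let u : ℝ → F → F := fun t x => v t (x₀ + ρ x)
  have hub : ∀ t ∈ Icc (-N) N, ∀ x, ‖u t x‖ ≤ K * ‖ρ x‖ + C := fun t ht x => by
    have h1 := (hv t).dist_le_mul (x₀ + ρ x) x₀
    rw [dist_eq_norm, dist_eq_norm, add_sub_cancel_left] at h1
    calc ‖u t x‖ = ‖(v t (x₀ + ρ x) - v t x₀) + v t x₀‖ := by simp [u]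
      _ ≤ _ := (norm_add_le _ _).trans (add_le_add h1 (hC t ht))
  have hu : ∀ t, LipschitzWith (K * K₀) (u t) := fun t => by
    have h1 : LipschitzWith K₀ fun x => x₀ + ρ x := fun x y => by
      simpa [edist_add_left] using hK₀ x y
    exact (hv t).comp h1
  let L : NNReal := ⟨K * (R + 1) + C, by positivity⟩
  have hPL : IsPicardLindelof u (tmin := -N) (tmax := N) ⟨0, by simp [hN.le]⟩ x₀
      (L * ⟨N, hN.le⟩) 0 L (K * K₀) := by
    refine ⟨fun t _ => (hu t).lipschitzOnWith, fun x _ => (hc _).continuousOn,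
      fun t ht x _ => ?_, ?_⟩
    · exact (hub t ht x).trans (by
        change _ ≤ (K : ℝ) * (R + 1) + C
        gcongr
        exact hρ2 x)
    · simp only [sub_zero, zero_sub, neg_neg, max_self, NNReal.coe_zero]
      exact le_rfl
  obtain ⟨α, h0, hα⟩ := hPL.exists_eq_forall_mem_Icc_hasDerivWithinAt₀
  simp only at h0
  have hgrow : ∀ t ∈ Icc (-N) N, ‖u t (α t)‖ ≤ K * ‖α t - x₀‖ + C := fun t ht =>
    (hub t ht _).trans (by gcongr; exact hρ1 _)
  -- the growth bound keeps `α` in the ball on which the cutoff is trivial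
  have hpos := norm_sub_le_of_linear_growth (α := α) (α' := fun t => u t (α t)) (N := N)
    K.coe_nonneg hC0 h0
    (fun t ht => (hα t ⟨by linarith [ht.1], ht.2⟩).mono (Icc_subset_Icc (by linarith) le_rfl))
    (fun t ht => hgrow t ⟨by linarith [ht.1], ht.2⟩)
  have hneg := norm_sub_le_of_linear_growth (α := fun t => α (-t))
    (α' := fun t => -u (-t) (α (-t))) (x₀ := x₀) (N := N) K.coe_nonneg hC0 (by simpa using h0)
    (fun t ht => by
      have h1 := (hα (-t) ⟨by linarith [ht.2], by linarith [ht.1]⟩).scomp t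
        (t' := Icc (-N) N) (s := Icc 0 N) (hasDerivAt_neg t).hasDerivWithinAt
        (fun s hs => ⟨by linarith [hs.2], by linarith [hs.1]⟩)
      simpa [Function.comp_def] using h1)
    (fun t ht => by
      rw [norm_neg]
      exact hgrow (-t) ⟨by linarith [ht.2], by linarith [ht.1]⟩)
  have hball : ∀ t ∈ Icc (-N) N, ‖α t - x₀‖ ≤ R := by
    intro t ht
    rcases le_total 0 t with h | h
    · linarith [hpos t ⟨h, ht.2⟩]
    · have := hneg (-t) ⟨by linarith, by linarith [ht.1]⟩
      rw [neg_neg] at this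
      linarith
  refine ⟨α, h0, fun t ht => ?_⟩
  have h1 := (hα t (Ioo_subset_Icc_self ht)).hasDerivAt (Icc_mem_nhds ht.1 ht.2)
  have h2 : u t (α t) = v t (α t) := by
    simp only [u]
    rw [hρ3 _ (hball t (Ioo_subset_Icc_self ht)), add_sub_cancel]
  rwa [h2] at h1

/-- A globally Lipschitz differential equation has global solutions. -/
theorem exists_global_solution {v : ℝ → F → F} {K : NNReal} (hv : ∀ t, LipschitzWith K (v t))
    (hc : ∀ x, Continuous fun t => v t x) (x₀ : F) :
    ∃ x : ℝ → F, x 0 = x₀ ∧ ∀ t, HasDerivAt x (v t (x t)) t := by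
  -- the solutions on the intervals `(-(N + 1), N + 1)` are restrictions of one function
  choose α h0 hα using fun N : ℕ => exists_solution_Ioo hv hc x₀ (N := (N : ℝ) + 1) (by positivity)
  have heq : ∀ M N : ℕ, M ≤ N → ∀ t ∈ Ioo (-((M : ℝ) + 1)) (M + 1), α M t = α N t := by
    intro M N hMN t ht
    have hMN' : (M : ℝ) ≤ N := by exact_mod_cast hMN
    refine ODE_solution_unique_of_mem_Ioo (v := v) (s := fun _ => univ) (K := K) (t₀ := 0)
      (a := -((M : ℝ) + 1)) (b := (M : ℝ) + 1)
      (fun t _ => (hv t).lipschitzOnWith) ⟨by linarith [M.cast_nonneg (α := ℝ)], by positivity⟩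
      (fun s hs => ⟨hα M s hs, mem_univ _⟩)
      (fun s hs => ⟨hα N s ⟨by linarith [hs.1], by linarith [hs.2]⟩, mem_univ _⟩)
      (by rw [h0, h0]) ht
  have hmem : ∀ t : ℝ, t ∈ Ioo (-((⌈|t|⌉₊ : ℝ) + 1)) (⌈|t|⌉₊ + 1) := fun t => by
    rw [mem_Ioo, ← abs_lt]
    linarith [Nat.le_ceil |t|]
  refine ⟨fun t => α ⌈|t|⌉₊ t, h0 _, fun t => ?_⟩
  have hev : (fun s : ℝ => α ⌈|s|⌉₊ s) =ᶠ[𝓝 t] α (⌈|t|⌉₊ + 1) := by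
    have hnear : ∀ᶠ s : ℝ in 𝓝 t, |s| < (⌈|t|⌉₊ : ℝ) + 1 :=
      (continuous_abs.tendsto t).eventually_lt_const (by linarith [Nat.le_ceil |t|])
    filter_upwards [hnear] with s hs
    refine heq _ _ ?_ s (hmem s)
    rw [Nat.ceil_le]
    push_cast
    exact hs.le
  have h1 := hα (⌈|t|⌉₊ + 1) t
    ⟨by push_cast; linarith [(hmem t).1], by push_cast; linarith [(hmem t).2]⟩
  rw [← hev.eq_of_nhds] at h1
  exact h1.congr_of_eventuallyEq hev

end GlobalSolutions

/-! ### Averaging for globally defined fields -/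

section Averaging

variable {E : Type*} [NormedAddCommGroup E] [NormedSpace ℝ E]

/-- Uniform bounds for an averaging problem. `G₀` is the average of the `T`-periodic field
`G x t ε` at `ε = 0`, and `w` is the primitive in `t` of the oscillating part `G x t 0 - G₀ x` which
vanishes at `t = 0`. The maps `DG`, `DG₀`, `Dw` are the derivatives in `x`; all derivatives are
bounded by `K` and Lipschitz continuous with constant `K`. -/
structure IsAveragingData (T K : ℝ) (G : E → ℝ → ℝ → E) (G₀ : E → E) (w : E → ℝ → E)
    (DG : E → ℝ → ℝ → E →L[ℝ] E) (DG₀ : E → E →L[ℝ] E) (Dw : E → ℝ → E →L[ℝ] E) : Prop where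
  T_pos : 0 < T
  K_pos : 0 < K
  continuous_time : ∀ x ε, Continuous fun t => G x t ε
  periodic : ∀ x t ε, G x (t + T) ε = G x t ε
  norm_le : ∀ x t ε, ‖G x t ε‖ ≤ K
  dist_le : ∀ x x' t ε ε', ‖G x t ε - G x' t ε'‖ ≤ K * (‖x - x'‖ + |ε - ε'|)
  hasFDerivAt : ∀ x t ε, HasFDerivAt (fun x => G x t ε) (DG x t ε) x
  continuous_deriv : ∀ ε, Continuous fun p : E × ℝ => DG p.1 p.2 ε
  norm_deriv_le : ∀ x t ε, ‖DG x t ε‖ ≤ K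
  dist_deriv_le : ∀ x x' t ε ε', ‖DG x t ε - DG x' t ε'‖ ≤ K * (‖x - x'‖ + |ε - ε'|)
  hasFDerivAt_avg : ∀ x, HasFDerivAt G₀ (DG₀ x) x
  norm_deriv_avg_le : ∀ x, ‖DG₀ x‖ ≤ K
  dist_deriv_avg_le : ∀ x x', ‖DG₀ x - DG₀ x'‖ ≤ K * ‖x - x'‖
  w_zero : ∀ x, w x 0 = 0
  w_period : ∀ x, w x T = 0
  norm_w_le : ∀ x t, ‖w x t‖ ≤ K
  hasFDerivAt_w : ∀ x t, HasFDerivAt (fun p : E × ℝ => w p.1 p.2)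
    ((Dw x t).coprod (ContinuousLinearMap.toSpanSingleton ℝ (G x t 0 - G₀ x))) (x, t)
  norm_deriv_w_le : ∀ x t, ‖Dw x t‖ ≤ K
  dist_deriv_w_le : ∀ x x' t, ‖Dw x t - Dw x' t‖ ≤ K * ‖x - x'‖
  hasDerivAt_deriv_w : ∀ x t, HasDerivAt (fun t => Dw x t) (DG x t 0 - DG₀ x) t

/-- A field differentiable in `x` with derivative bounded by `C` is Lipschitz. -/
theorem norm_sub_le_of_hasFDerivAt {F : Type*} [NormedAddCommGroup F] [NormedSpace ℝ F]
    {f : E → F} {f' : E → E →L[ℝ] F} {C : ℝ} (hf : ∀ x, HasFDerivAt f (f' x) x)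
    (hC : ∀ x, ‖f' x‖ ≤ C) (x y : E) : ‖f x - f y‖ ≤ C * ‖x - y‖ :=
  convex_univ.norm_image_sub_le_of_norm_hasFDerivWithin_le
    (fun x _ => (hf x).hasFDerivWithinAt) (fun x _ => hC x) (mem_univ y) (mem_univ x)

namespace IsAveragingData

variable {T K : ℝ} {G : E → ℝ → ℝ → E} {G₀ : E → E} {w : E → ℝ → E}
  {DG : E → ℝ → ℝ → E →L[ℝ] E} {DG₀ : E → E →L[ℝ] E} {Dw : E → ℝ → E →L[ℝ] E}

/-- The remainder `H` in the equation `z' = ε (G₀ x + H)` of `z = x - ε w(x, t)`. -/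
def remainder (G : E → ℝ → ℝ → E) (Dw : E → ℝ → E →L[ℝ] E) (ε : ℝ) (x : E) (t : ℝ) : E :=
  G x t ε - G x t 0 - ε • Dw x t (G x t ε)

variable (h : IsAveragingData T K G G₀ w DG DG₀ Dw)

include h

theorem dist_avg_le (x x' : E) : ‖G₀ x - G₀ x'‖ ≤ K * ‖x - x'‖ :=
  norm_sub_le_of_hasFDerivAt h.hasFDerivAt_avg h.norm_deriv_avg_le x x'

theorem hasFDerivAt_w_left (x : E) (t : ℝ) : HasFDerivAt (fun x => w x t) (Dw x t) x := by
  have h1 := HasFDerivAt.comp (f := fun y => (y, t)) x (h.hasFDerivAt_w x t)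
    ((hasFDerivAt_id x).prodMk (hasFDerivAt_const t x))
  convert! h1 using 1
  ext v
  simp

theorem dist_w_le (x x' : E) (t : ℝ) : ‖w x t - w x' t‖ ≤ K * ‖x - x'‖ :=
  norm_sub_le_of_hasFDerivAt (fun x => h.hasFDerivAt_w_left x t)
    (fun x => h.norm_deriv_w_le x t) x x'

theorem deriv_w_zero (x : E) : Dw x 0 = 0 := by
  have h1 := h.hasFDerivAt_w_left x 0
  simp only [h.w_zero] at h1
  exact h1.unique (hasFDerivAt_const 0 x)

theorem deriv_w_period (x : E) : Dw x T = 0 := by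
  have h1 := h.hasFDerivAt_w_left x T
  simp only [h.w_period] at h1
  exact h1.unique (hasFDerivAt_const 0 x)

theorem norm_remainder_le {ε : ℝ} (hε : 0 ≤ ε) (x : E) (t : ℝ) :
    ‖remainder G Dw ε x t‖ ≤ (K + 2 * K ^ 2) * ε := by
  have hK := h.K_pos
  have h1 := h.dist_le x x t ε 0
  rw [sub_self, norm_zero, zero_add, sub_zero, abs_of_nonneg hε] at h1
  have h2 : ‖ε • Dw x t (G x t ε)‖ ≤ ε * (K * K) := by
    rw [norm_smul, Real.norm_of_nonneg hε]
    gcongr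
    exact (Dw x t).le_of_opNorm_le_of_le (h.norm_deriv_w_le x t) (h.norm_le x t ε)
  refine (norm_sub_le _ _).trans ?_
  nlinarith [mul_nonneg hε (sq_nonneg K)]

/-- The remainder is `O(ε)` also in the Lipschitz sense, which is what uniqueness and stability
arguments need. -/
theorem dist_remainder_le {ε : ℝ} (hε : 0 ≤ ε) (x x' : E) (t : ℝ) :
    ‖remainder G Dw ε x t - remainder G Dw ε x' t‖ ≤ (K + 2 * K ^ 2) * ε * ‖x - x'‖ := by
  have hK := h.K_pos
  have h1 : ‖(G x t ε - G x t 0) - (G x' t ε - G x' t 0)‖ ≤ K * ε * ‖x - x'‖ := by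
    refine norm_sub_le_of_hasFDerivAt (f := fun x => G x t ε - G x t 0)
      (fun x => (h.hasFDerivAt x t ε).sub (h.hasFDerivAt x t 0)) (fun x => ?_) x x'
    have := h.dist_deriv_le x x t ε 0
    rwa [sub_self, norm_zero, zero_add, sub_zero, abs_of_nonneg hε] at this
  have h2 : ‖Dw x t (G x t ε) - Dw x' t (G x' t ε)‖ ≤ 2 * K ^ 2 * ‖x - x'‖ := by
    have e : Dw x t (G x t ε) - Dw x' t (G x' t ε) =
        Dw x t (G x t ε - G x' t ε) + (Dw x t - Dw x' t) (G x' t ε) := by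
      simp
    have h3 : ‖G x t ε - G x' t ε‖ ≤ K * ‖x - x'‖ := by simpa using h.dist_le x x' t ε ε
    rw [e]
    refine (norm_add_le _ _).trans ?_
    have h4 := (Dw x t).le_of_opNorm_le_of_le (h.norm_deriv_w_le x t) h3
    have h5 := (Dw x t - Dw x' t).le_of_opNorm_le_of_le (h.dist_deriv_w_le x x' t)
      (h.norm_le x' t ε)
    linarith
  have e : remainder G Dw ε x t - remainder G Dw ε x' t =
      ((G x t ε - G x t 0) - (G x' t ε - G x' t 0)) -
        ε • (Dw x t (G x t ε) - Dw x' t (G x' t ε)) := by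
    simp only [remainder, smul_sub]
    abel
  rw [e]
  refine (norm_sub_le _ _).trans ?_
  rw [norm_smul, Real.norm_of_nonneg hε]
  nlinarith [mul_le_mul_of_nonneg_left h2 hε]

/-- The near-identity transformation `z = x - ε w(x, t)` removes the oscillating part of the field
up to an error of order `ε²`. -/
theorem hasDerivWithinAt_reduced {ε t : ℝ} {x : ℝ → E} {s : Set ℝ}
    (hx : HasDerivWithinAt x (ε • G (x t) t ε) s t) :
    HasDerivWithinAt (fun t => x t - ε • w (x t) t)
      (ε • (G₀ (x t) + remainder G Dw ε (x t) t)) s t := by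
  have h1 := (h.hasFDerivAt_w (x t) t).comp_hasDerivWithinAt t (f := fun t => (x t, t))
    (hx.prodMk (hasDerivWithinAt_id t s))
  convert! hx.sub (h1.const_smul ε) using 1
  simp only [remainder, ContinuousLinearMap.coprod_apply, map_smul,
    ContinuousLinearMap.toSpanSingleton_apply, one_smul, smul_add, smul_sub]
  abel

/-- Linearization error of the average in a ball. -/
theorem norm_avg_sub_linear_le {c a b : E} {ρ : ℝ} (ha : ‖a - c‖ ≤ ρ) (hb : ‖b - c‖ ≤ ρ) :
    ‖G₀ a - G₀ b - DG₀ c (a - b)‖ ≤ K * ρ * ‖a - b‖ := by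
  refine (convex_closedBall c ρ).norm_image_sub_le_of_norm_hasFDerivWithin_le'
    (fun x _ => (h.hasFDerivAt_avg x).hasFDerivWithinAt) (fun x hx => ?_)
    (mem_closedBall_iff_norm.2 hb) (mem_closedBall_iff_norm.2 ha)
  have := h.K_pos
  exact (h.dist_deriv_avg_le x c).trans (by gcongr; exact mem_closedBall_iff_norm.1 hx)

theorem lipschitzWith_field (ε t : ℝ) :
    LipschitzWith (Real.toNNReal (|ε| * K)) fun x => ε • G x t ε := by
  have hK := h.K_pos
  refine LipschitzWith.of_dist_le_mul fun x y => ?_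
  rw [dist_eq_norm, dist_eq_norm, ← smul_sub, norm_smul, Real.norm_eq_abs,
    Real.coe_toNNReal _ (by positivity), mul_assoc]
  gcongr
  simpa using h.dist_le x y t ε ε

theorem exists_solution [FiniteDimensional ℝ E] (ε : ℝ) (x₀ : E) :
    ∃ x : ℝ → E, x 0 = x₀ ∧ ∀ t, HasDerivAt x (ε • G (x t) t ε) t :=
  exists_global_solution (v := fun t x => ε • G x t ε) (h.lipschitzWith_field ε)
    (fun x => (h.continuous_time x ε).const_smul ε) x₀

theorem solution_unique {ε : ℝ} {x y : ℝ → E} (hx : ∀ t, HasDerivAt x (ε • G (x t) t ε) t)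
    (hy : ∀ t, HasDerivAt y (ε • G (y t) t ε) t) (h0 : x 0 = y 0) : x = y :=
  ODE_solution_unique_univ (v := fun t x => ε • G x t ε) (s := fun _ => univ) (t₀ := 0)
    (fun t => (h.lipschitzWith_field ε t).lipschitzOnWith) (fun t => ⟨hx t, mem_univ _⟩)
    (fun t => ⟨hy t, mem_univ _⟩) h0

theorem solution_unique_Icc {ε τ : ℝ} {x y : ℝ → E}
    (hx : ∀ t ∈ Icc 0 τ, HasDerivWithinAt x (ε • G (x t) t ε) (Icc 0 τ) t)
    (hy : ∀ t ∈ Icc 0 τ, HasDerivWithinAt y (ε • G (y t) t ε) (Icc 0 τ) t) (h0 : x 0 = y 0) :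
    EqOn x y (Icc 0 τ) :=
  ODE_solution_unique (v := fun t x => ε • G x t ε) (h.lipschitzWith_field ε)
    (fun t ht => (hx t ht).continuousWithinAt)
    (fun t ht => (hx t (Ico_subset_Icc_self ht)).mono_of_mem_nhdsWithin (Icc_mem_nhdsGE_of_mem ht))
    (fun t ht => (hy t ht).continuousWithinAt)
    (fun t ht => (hy t (Ico_subset_Icc_self ht)).mono_of_mem_nhdsWithin (Icc_mem_nhdsGE_of_mem ht))
    h0

theorem solution_dist_le {ε : ℝ} (hε : 0 ≤ ε) {x y : ℝ → E}
    (hx : ∀ t, HasDerivAt x (ε • G (x t) t ε) t)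
    (hy : ∀ t, HasDerivAt y (ε • G (y t) t ε) t) {t : ℝ} (ht : t ∈ Icc 0 T) :
    ‖x t - y t‖ ≤ Real.exp (ε * K * T) * ‖x 0 - y 0‖ := by
  have hK := h.K_pos
  have h1 := dist_le_of_trajectories_ODE (v := fun t x => ε • G x t ε) (a := 0) (b := T)
    (h.lipschitzWith_field ε)
    (fun t _ => (hx t).continuousAt.continuousWithinAt) (fun t _ => (hx t).hasDerivWithinAt)
    (fun t _ => (hy t).continuousAt.continuousWithinAt) (fun t _ => (hy t).hasDerivWithinAt)
    le_rfl t ht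
  rw [dist_eq_norm, dist_eq_norm, Real.coe_toNNReal _ (by positivity), abs_of_nonneg hε,
    sub_zero] at h1
  rw [mul_comm]
  refine h1.trans ?_
  gcongr
  exact ht.2

/-- Over one period, solutions move by `O(ε)`. -/
theorem solution_sub_initial_le {ε : ℝ} (hε : 0 ≤ ε) {x : ℝ → E}
    (hx : ∀ t, HasDerivAt x (ε • G (x t) t ε) t) {t : ℝ} (ht : t ∈ Icc 0 T) :
    ‖x t - x 0‖ ≤ ε * K * T := by
  have hK := h.K_pos
  have h1 := norm_image_sub_le_of_norm_deriv_le_segment' (f := x) (a := 0) (b := T) (C := ε * K)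
    (fun t _ => (hx t).hasDerivWithinAt) (fun t _ => by
      rw [norm_smul, Real.norm_of_nonneg hε]
      gcongr
      exact h.norm_le _ _ _) t ht
  refine h1.trans ?_
  gcongr
  linarith [ht.2]

/-- The averaging principle on times of order `1 / ε`. Grönwall's inequality is applied to
`z = x - ε w(x, t)`, which solves the averaged equation up to an error of order `ε²`. -/
theorem exists_dist_le {C₀ : ℝ} (hC₀ : 0 < C₀) (L : ℝ) : ∃ C > 0, ∀ ε ≥ 0, ∀ τ, ε * τ ≤ L →
    ∀ x y : ℝ → E, (∀ t ∈ Icc 0 τ, HasDerivWithinAt x (ε • G (x t) t ε) (Icc 0 τ) t) →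
      (∀ t ∈ Icc 0 τ, HasDerivWithinAt y (ε • G₀ (y t)) (Icc 0 τ) t) →
      ‖x 0 - y 0‖ ≤ C₀ * ε → ∀ t ∈ Icc 0 τ, ‖x t - y t‖ ≤ C * ε := by
  have hK := h.K_pos
  set c : ℝ := K ^ 2 + (K + 2 * K ^ 2) with hc
  have hc0 : 0 < c := by positivity
  refine ⟨K + (C₀ + c / K) * Real.exp (K * L), by positivity, ?_⟩
  intro ε hε τ hτ x y hx hy h0 t ht
  rcases hε.eq_or_lt with rfl | hε
  · -- for `ε = 0` both functions are constant
    have h1 := fun (x : ℝ → E) (hx : ∀ t ∈ Icc 0 τ, HasDerivWithinAt x 0 (Icc 0 τ) t) =>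
      norm_image_sub_le_of_norm_deriv_le_segment' (C := 0) hx (by simp) t ht
    have hx1 := h1 x (by simpa using hx)
    have hy1 := h1 y (by simpa using hy)
    simp only [zero_mul, norm_le_zero_iff, sub_eq_zero, mul_zero] at hx1 hy1 h0 ⊢
    rw [hx1, hy1, h0]
  set z : ℝ → E := fun t => x t - ε • w (x t) t with hz
  have hzx : ∀ t, ‖x t - z t‖ ≤ K * ε := fun t => by
    simp only [hz, sub_sub_cancel, norm_smul, Real.norm_of_nonneg hε.le]
    rw [mul_comm]
    gcongr
    exact h.norm_w_le _ _
  have hz' : ∀ t ∈ Icc 0 τ, HasDerivWithinAt z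
      (ε • (G₀ (x t) + remainder G Dw ε (x t) t)) (Icc 0 τ) t :=
    fun t ht => h.hasDerivWithinAt_reduced (hx t ht)
  have hlip : ∀ _ : ℝ, LipschitzWith (Real.toNNReal (ε * K)) fun x => ε • G₀ x := fun _ => by
    refine LipschitzWith.of_dist_le_mul fun x y => ?_
    rw [dist_eq_norm, dist_eq_norm, ← smul_sub, norm_smul, Real.norm_of_nonneg hε.le,
      Real.coe_toNNReal _ (by positivity), mul_assoc]
    gcongr
    exact h.dist_avg_le x y
  have hmain := dist_le_of_approx_trajectories_ODE (v := fun _ x => ε • G₀ x) (a := 0) (b := τ)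
    (f := z) (g := y) (εf := ε ^ 2 * c) (εg := 0) (δ := C₀ * ε) hlip
    (fun t ht => (hz' t ht).continuousWithinAt)
    (fun t ht => (hz' t (Ico_subset_Icc_self ht)).mono_of_mem_nhdsWithin
      (Icc_mem_nhdsGE_of_mem ht))
    (fun t ht => by
      rw [dist_eq_norm, ← smul_sub, norm_smul, Real.norm_of_nonneg hε.le, sq, mul_assoc]
      gcongr
      have h1 : ‖G₀ (x t) - G₀ (z t)‖ ≤ K * (K * ε) :=
        (h.dist_avg_le _ _).trans (by gcongr; exact hzx t)
      have h2 := h.norm_remainder_le hε.le (x t) t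
      calc _ = ‖(G₀ (x t) - G₀ (z t)) + remainder G Dw ε (x t) t‖ := by congr 1; abel
        _ ≤ _ := norm_add_le _ _
        _ ≤ _ := by rw [hc]; linarith)
    (fun t ht => (hy t ht).continuousWithinAt)
    (fun t ht => (hy t (Ico_subset_Icc_self ht)).mono_of_mem_nhdsWithin
      (Icc_mem_nhdsGE_of_mem ht))
    (fun t _ => by simp)
    (by simpa [hz, h.w_zero, dist_eq_norm] using h0) t ht
  rw [dist_eq_norm, Real.coe_toNNReal _ (by positivity), add_zero, sub_zero,
    gronwallBound_of_K_ne_0 (by positivity)] at hmain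
  have hexp : Real.exp (ε * K * t) ≤ Real.exp (K * L) := by
    rw [Real.exp_le_exp]
    calc ε * K * t = K * (ε * t) := by ring
      _ ≤ K * (ε * τ) := by gcongr; exact ht.2
      _ ≤ K * L := by gcongr
  have hbound : ‖z t - y t‖ ≤ (C₀ + c / K) * Real.exp (K * L) * ε := by
    calc ‖z t - y t‖ ≤ C₀ * ε * Real.exp (ε * K * t) +
          ε ^ 2 * c / (ε * K) * (Real.exp (ε * K * t) - 1) := hmain
      _ = C₀ * ε * Real.exp (ε * K * t) + c / K * ε * (Real.exp (ε * K * t) - 1) := by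
        congr 2
        field_simp
      _ ≤ C₀ * ε * Real.exp (K * L) + c / K * ε * Real.exp (K * L) := by
        gcongr
        linarith
      _ = _ := by ring
  calc ‖x t - y t‖ = ‖(x t - z t) + (z t - y t)‖ := by congr 1; abel
    _ ≤ ‖x t - z t‖ + ‖z t - y t‖ := norm_add_le _ _
    _ ≤ K * ε + (C₀ + c / K) * Real.exp (K * L) * ε := add_le_add (hzx t) hbound
    _ = _ := by ring

end IsAveragingData

end Averaging

/-! ### Periodic solutions and their monodromy maps -/

section AveragingPeriodic

namespace IsAveragingData

variable {E : Type*} [NormedAddCommGroup E] [NormedSpace ℝ E]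
  {T K : ℝ} {G : E → ℝ → ℝ → E} {G₀ : E → E} {w : E → ℝ → E}
  {DG : E → ℝ → ℝ → E →L[ℝ] E} {DG₀ : E → E →L[ℝ] E} {Dw : E → ℝ → E →L[ℝ] E}
  (h : IsAveragingData T K G G₀ w DG DG₀ Dw)

include h

/-- The displacement over one period is, up to terms which are small in the Lipschitz sense, the
linearization of the averaged field. -/
theorem displacement_approx {c x₁ x₂ : E} {ρ ε : ℝ} (hε : ε ∈ Icc 0 1) (hρ₁ : ‖x₁ - c‖ ≤ ρ)
    (hρ₂ : ‖x₂ - c‖ ≤ ρ) {x y : ℝ → E} (hx : ∀ t, HasDerivAt x (ε • G (x t) t ε) t)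
    (hy : ∀ t, HasDerivAt y (ε • G (y t) t ε) t) (hx0 : x 0 = x₁) (hy0 : y 0 = x₂) :
    ‖(x T - x₁) - (y T - x₂) - (ε * T) • DG₀ c (x₁ - x₂)‖ ≤
      ε * T * (Real.exp (K * T) * (K * (ρ + ε * K * T) + (K + 2 * K ^ 2) * ε + K * (K * T * ε)) *
        ‖x₁ - x₂‖) := by
  have hK := h.K_pos
  have hT := h.T_pos
  obtain ⟨hε0, hε1⟩ := hε
  have hρ : 0 ≤ ρ := (norm_nonneg _).trans hρ₁
  set e := Real.exp (K * T) with he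
  set d := ‖x₁ - x₂‖ with hd
  have hd0 : 0 ≤ d := norm_nonneg _
  have hee : Real.exp (ε * K * T) ≤ e := by
    rw [he, Real.exp_le_exp, mul_assoc]
    exact mul_le_of_le_one_left (by positivity) hε1
  have hdist : ∀ t ∈ Icc 0 T, ‖x t - y t‖ ≤ e * d := fun t ht => by
    have := h.solution_dist_le hε0 hx hy ht
    rw [hx0, hy0] at this
    exact this.trans (by gcongr)
  have hdrift : ∀ t ∈ Icc 0 T, ‖(x t - y t) - (x₁ - x₂)‖ ≤ K * T * ε * (e * d) := fun t ht => by
    have h1 := norm_image_sub_le_of_norm_deriv_le_segment' (f := fun t => x t - y t) (a := 0)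
      (b := T) (C := ε * (K * (e * d)))
      (fun t _ => ((hx t).sub (hy t)).hasDerivWithinAt) (fun t ht => by
        rw [← smul_sub, norm_smul, Real.norm_of_nonneg hε0]
        gcongr
        have := h.dist_le (x t) (y t) t ε ε
        rw [sub_self, abs_zero, add_zero] at this
        exact this.trans (by gcongr; exact hdist t (Ico_subset_Icc_self ht))) t ht
    simp only [hx0, hy0, sub_zero] at h1
    calc _ ≤ ε * (K * (e * d)) * t := h1
      _ ≤ ε * (K * (e * d)) * T := by gcongr; exact ht.2
      _ = _ := by ring
  have hnear : ∀ (z : ℝ → E) (z₀ : E), (∀ t, HasDerivAt z (ε • G (z t) t ε) t) → z 0 = z₀ →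
      ‖z₀ - c‖ ≤ ρ → ∀ t ∈ Icc 0 T, ‖z t - c‖ ≤ ρ + ε * K * T := fun z z₀ hz hz0 hzc t ht => by
    have := h.solution_sub_initial_le hε0 hz ht
    rw [hz0] at this
    calc ‖z t - c‖ = ‖(z₀ - c) + (z t - z₀)‖ := by congr 1; abel
      _ ≤ _ := (norm_add_le _ _).trans (add_le_add hzc this)
  have hu : ∀ t, HasDerivAt (fun t => (x t - ε • w (x t) t) - (y t - ε • w (y t) t) -
      t • (ε • DG₀ c (x₁ - x₂)))
      (ε • (G₀ (x t) + remainder G Dw ε (x t) t) - ε • (G₀ (y t) + remainder G Dw ε (y t) t) -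
        ε • DG₀ c (x₁ - x₂)) t := fun t => by
    have h1 := (h.hasDerivWithinAt_reduced (hx t).hasDerivWithinAt (s := univ)).hasDerivAt univ_mem
    have h2 := (h.hasDerivWithinAt_reduced (hy t).hasDerivWithinAt (s := univ)).hasDerivAt univ_mem
    simpa using (h1.fun_sub h2).fun_sub ((hasDerivAt_id t).smul_const (ε • DG₀ c (x₁ - x₂)))
  have hfinal := norm_image_sub_le_of_norm_deriv_le_segment' (a := 0) (b := T)
    (C := ε * (e * (K * (ρ + ε * K * T) + (K + 2 * K ^ 2) * ε + K * (K * T * ε)) * d))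
    (fun t _ => (hu t).hasDerivWithinAt) (fun t ht => by
      have ht' := Ico_subset_Icc_self ht
      rw [← smul_sub, ← smul_sub, norm_smul, Real.norm_of_nonneg hε0]
      gcongr
      have h1 := h.norm_avg_sub_linear_le (hnear x x₁ hx hx0 hρ₁ t ht')
        (hnear y x₂ hy hy0 hρ₂ t ht')
      have h2 := h.dist_remainder_le hε0 (x t) (y t) t
      have h3 := (DG₀ c).le_of_opNorm_le_of_le (h.norm_deriv_avg_le c) (hdrift t ht')
      have h4 := hdist t ht'
      calc _ = ‖(G₀ (x t) - G₀ (y t) - DG₀ c (x t - y t)) +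
            (remainder G Dw ε (x t) t - remainder G Dw ε (y t) t) +
            DG₀ c ((x t - y t) - (x₁ - x₂))‖ := by
            congr 1
            rw [map_sub (DG₀ c) (x t - y t)]
            abel
        _ ≤ K * (ρ + ε * K * T) * (e * d) + (K + 2 * K ^ 2) * ε * (e * d) +
            K * (K * T * ε * (e * d)) := by
          refine (norm_add₃_le).trans (add_le_add (add_le_add (h1.trans ?_) (h2.trans ?_)) h3)
          · gcongr
          · gcongr
        _ = _ := by ring) T ⟨hT.le, le_rfl⟩
  simp only [h.w_period, h.w_zero, hx0, hy0, smul_zero, sub_zero, zero_smul] at hfinal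
  calc _ = ‖x T - y T - T • ε • DG₀ c (x₁ - x₂) - (x₁ - x₂)‖ := by
        congr 1
        rw [smul_smul, mul_comm T]
        abel
    _ ≤ _ := hfinal
    _ = _ := by ring

/-- At a zero `c` of the averaged field the displacement over one period is of order `ε²`. -/
theorem displacement_le {c : E} (hc : G₀ c = 0) {ε : ℝ} (hε : 0 ≤ ε) {x : ℝ → E}
    (hx : ∀ t, HasDerivAt x (ε • G (x t) t ε) t) (hx0 : x 0 = c) :
    ‖x T - c‖ ≤ ε * T * ((K ^ 2 * T + (K + 2 * K ^ 2)) * ε) := by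
  have hK := h.K_pos
  have hT := h.T_pos
  have hu : ∀ t, HasDerivAt (fun t => x t - ε • w (x t) t)
      (ε • (G₀ (x t) + remainder G Dw ε (x t) t)) t := fun t =>
    (h.hasDerivWithinAt_reduced (hx t).hasDerivWithinAt (s := univ)).hasDerivAt univ_mem
  have hfinal := norm_image_sub_le_of_norm_deriv_le_segment' (a := 0) (b := T)
    (C := ε * ((K ^ 2 * T + (K + 2 * K ^ 2)) * ε))
    (fun t _ => (hu t).hasDerivWithinAt) (fun t ht => by
      rw [norm_smul, Real.norm_of_nonneg hε]
      gcongr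
      have h1 := h.dist_avg_le (x t) c
      have h2 := h.solution_sub_initial_le hε hx (Ico_subset_Icc_self ht)
      have h3 := h.norm_remainder_le hε (x t) t
      rw [hc, sub_zero] at h1
      rw [hx0] at h2
      calc _ ≤ K * (ε * K * T) + (K + 2 * K ^ 2) * ε :=
            (norm_add_le _ _).trans (add_le_add (h1.trans (by gcongr)) h3)
        _ = _ := by ring) T ⟨hT.le, le_rfl⟩
  simp only [h.w_period, h.w_zero, hx0, smul_zero, sub_zero] at hfinal
  linarith

/-- A solution with `x T = x 0` of the periodic equation is periodic. -/
theorem periodic_of_eq {ε : ℝ} {x : ℝ → E} (hx : ∀ t, HasDerivAt x (ε • G (x t) t ε) t)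
    (hxT : x T = x 0) : Function.Periodic x T := by
  have h1 : ∀ t, HasDerivAt (fun t => x (t + T)) (ε • G (x (t + T)) t ε) t := fun t => by
    have := (hx (t + T)).comp_add_const t T
    rwa [h.periodic] at this
  exact congrFun (h.solution_unique h1 hx (by simpa using hxT))

variable [FiniteDimensional ℝ E]

/-- Periodic solutions near a nondegenerate zero `c` of the averaged field. The Poincaré map is
treated in the form of the function `(x(T) - x(0)) / (εT)` of `x(0)`, which is approximated by the
invertible linear map `A` in a ball whose radius does not depend on `ε`. -/
theorem exists_periodic {c : E} (hc : G₀ c = 0) (A : E ≃L[ℝ] E) (hA : (A : E →L[ℝ] E) = DG₀ c) :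
    ∃ C > 0, ∃ ε₁ > 0, ∀ ε ∈ Ioc 0 ε₁, ∃ γ : ℝ → E, (∀ t, HasDerivAt γ (ε • G (γ t) t ε) t) ∧
      Function.Periodic γ T ∧ ∀ t, ‖γ t - c‖ ≤ C * ε := by
  have hK := h.K_pos
  have hT := h.T_pos
  set e := Real.exp (K * T) with he
  have he0 : 0 < e := Real.exp_pos _
  -- it suffices to find initial values of periodic solutions
  suffices hsuff : ∃ C > 0, ∃ ε₁ > 0, ∀ ε ∈ Ioc 0 ε₁, ∃ x : ℝ → E,
      (∀ t, HasDerivAt x (ε • G (x t) t ε) t) ∧ x T = x 0 ∧ ‖x 0 - c‖ ≤ C * ε by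
    obtain ⟨C, hC, ε₁, hε₁, H⟩ := hsuff
    refine ⟨C + K * T, by positivity, ε₁, hε₁, fun ε hε => ?_⟩
    obtain ⟨x, hx, hxT, hx0⟩ := H ε hε
    have hper := h.periodic_of_eq hx hxT
    refine ⟨x, hx, hper, fun t => ?_⟩
    obtain ⟨s, hs, hst⟩ := hper.exists_mem_Ico₀ hT t
    rw [hst]
    have := h.solution_sub_initial_le hε.1.le hx (Ico_subset_Icc_self hs)
    calc ‖x s - c‖ = ‖(x s - x 0) + (x 0 - c)‖ := by congr 1; abel
      _ ≤ ε * K * T + C * ε := (norm_add_le _ _).trans (add_le_add this hx0)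
      _ = _ := by ring
  rcases subsingleton_or_nontrivial E with hE | hE
  · refine ⟨1, one_pos, 1, one_pos, fun ε hε => ?_⟩
    obtain ⟨x, hx0, hx⟩ := h.exists_solution ε c
    exact ⟨x, hx, Subsingleton.elim _ _, by rw [hx0]; simpa using hε.1.le⟩
  -- `c₁ ρ` bounds the Lipschitz error on the ball of radius `ρ`, for `ε ≤ ρ`, and `c₂ ε` bounds the
  -- value at `c`; `ρ` makes the error less than half of `N⁻¹`, and `C` is the solution of
  -- `N⁻¹ / 2 * C = c₂`
  set N : ℝ := ‖(A.symm : E →L[ℝ] E)‖ with hN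
  have hN0 : 0 < N := norm_pos_iff.2 fun h0 => by
    obtain ⟨v, hv⟩ := exists_ne (0 : E)
    exact hv (by simpa using congrArg (fun B : E →L[ℝ] E => A (B v)) h0)
  set c₁ : ℝ := e * (K + (K ^ 2 * T + (K + 2 * K ^ 2) + K * (K * T))) with hc₁
  have hc₁0 : 0 < c₁ := by positivity
  set c₂ : ℝ := K ^ 2 * T + (K + 2 * K ^ 2) with hc₂
  have hc₂0 : 0 < c₂ := by positivity
  set ρ : ℝ := N⁻¹ / 4 / c₁ with hρ
  have hρ0 : 0 < ρ := by positivity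
  set C : ℝ := 2 * N * c₂ with hC
  have hC0 : 0 < C := by positivity
  refine ⟨C, hC0, min 1 (min ρ (ρ / C)), by positivity, fun ε hε => ?_⟩
  have hε0 : 0 < ε := hε.1
  have hε1 : ε ≤ 1 := hε.2.trans (min_le_left _ _)
  have hερ : ε ≤ ρ := hε.2.trans ((min_le_right _ _).trans (min_le_left _ _))
  have hεC : C * ε ≤ ρ := by
    have := hε.2.trans ((min_le_right _ _).trans (min_le_right _ _))
    rw [le_div_iff₀ hC0] at this
    linarith
  choose φ hφ0 hφ using h.exists_solution ε
  let f : E → E := fun x => (ε * T)⁻¹ • (φ x T - x)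
  have hεT : 0 < ε * T := by positivity
  let k : NNReal := ⟨N⁻¹ / 2, by positivity⟩
  have happ : ApproximatesLinearOn f (A : E →L[ℝ] E) (Metric.closedBall c ρ) k := by
    intro x hx y hy
    have h1 := h.displacement_approx ⟨hε0.le, hε1⟩ (mem_closedBall_iff_norm.1 hx)
      (mem_closedBall_iff_norm.1 hy) (hφ x) (hφ y) (hφ0 x) (hφ0 y)
    have e1 : f x - f y - (A : E →L[ℝ] E) (x - y) = (ε * T)⁻¹ • ((φ x T - x) - (φ y T - y) -
        (ε * T) • DG₀ c (x - y)) := by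
      rw [hA, smul_sub (ε * T)⁻¹ _ ((ε * T) • DG₀ c (x - y)), inv_smul_smul₀ hεT.ne', smul_sub]
    rw [e1, norm_smul, norm_inv, Real.norm_of_nonneg hεT.le, inv_mul_le_iff₀ hεT]
    refine h1.trans ?_
    gcongr
    change _ ≤ N⁻¹ / 2
    calc _ = e * (K * ρ + (K ^ 2 * T + (K + 2 * K ^ 2) + K * (K * T)) * ε) := by ring
      _ ≤ e * (K * ρ + (K ^ 2 * T + (K + 2 * K ^ 2) + K * (K * T)) * ρ) := by gcongr
      _ = c₁ * ρ := by rw [hc₁]; ring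
      _ = N⁻¹ / 4 := by rw [hρ]; field_simp
      _ ≤ N⁻¹ / 2 := by linarith [inv_pos.2 hN0]
  have hsurj := happ.surjOn_closedBall_of_nonlinearRightInverse A.toNonlinearRightInverse
    (ε := C * ε) (b := c) (by positivity) (Metric.closedBall_subset_closedBall hεC)
  have hfc : ‖f c‖ ≤ c₂ * ε := by
    have := h.displacement_le hc hε0.le (hφ c) (hφ0 c)
    simp only [f]
    rw [norm_smul, norm_inv, Real.norm_of_nonneg hεT.le, inv_mul_le_iff₀ hεT]
    exact this
  have hzero : (0 : E) ∈ Metric.closedBall (f c)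
      ((((A.toNonlinearRightInverse).nnnorm : ℝ)⁻¹ - k) * (C * ε)) := by
    rw [mem_closedBall_iff_norm, zero_sub, norm_neg]
    change _ ≤ (N⁻¹ - N⁻¹ / 2) * (C * ε)
    refine hfc.trans (le_of_eq ?_)
    rw [hC]
    field_simp
    ring
  obtain ⟨x, hx, hfx⟩ := hsurj hzero
  refine ⟨φ x, hφ x, ?_, by rw [hφ0]; exact mem_closedBall_iff_norm.1 hx⟩
  rw [hφ0]
  exact sub_eq_zero.1 ((smul_eq_zero_iff_right (inv_ne_zero hεT.ne')).1 hfx)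

/-- The monodromy operator of the linearization along a solution near `c` is
`1 + εT DG₀(c) + O(ε²)`. -/
theorem exists_monodromy (c : E) {C : ℝ} (hC : 0 ≤ C) : ∃ C' ≥ 0, ∀ ε ∈ Icc (0 : ℝ) 1,
    ∀ γ : ℝ → E, Continuous γ → (∀ t, ‖γ t - c‖ ≤ C * ε) → ∃ X : ℝ → E →L[ℝ] E,
      X 0 = ContinuousLinearMap.id ℝ E ∧
      (∀ t, HasDerivAt X ((ε • DG (γ t) t ε).comp (X t)) t) ∧
      ‖X T - ContinuousLinearMap.id ℝ E - (ε * T) • DG₀ c‖ ≤ C' * ε ^ 2 := by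
  have hK := h.K_pos
  have hT := h.T_pos
  set e := Real.exp (K * T) with he
  have he0 : 0 < e := Real.exp_pos _
  refine ⟨T * (K * (K * T * e) + K * (C + 1)), by positivity, ?_⟩
  rintro ε ⟨hε0, hε1⟩ γ hγ hγc
  obtain ⟨X, hX0, hX⟩ := exists_global_solution
    (v := fun t (X : E →L[ℝ] E) => (ε • DG (γ t) t ε).comp X) (K := Real.toNNReal K)
    (fun t => LipschitzWith.of_dist_le_mul fun X Y => by
      rw [dist_eq_norm, dist_eq_norm, ← ContinuousLinearMap.comp_sub, Real.coe_toNNReal _ hK.le]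
      refine (ContinuousLinearMap.opNorm_comp_le _ _).trans ?_
      gcongr
      rw [norm_smul, Real.norm_of_nonneg hε0]
      exact (mul_le_of_le_one_left (norm_nonneg _) hε1).trans (h.norm_deriv_le _ _ _))
    (fun X => (((h.continuous_deriv ε).comp (hγ.prodMk continuous_id)).const_smul ε).clm_comp
      continuous_const) (ContinuousLinearMap.id ℝ E)
  refine ⟨X, hX0, hX, ?_⟩
  have hbound : ∀ t ∈ Icc 0 T, ‖X t‖ ≤ e := fun t ht => by
    have h1 := norm_le_gronwallBound_of_norm_deriv_right_le (f := X)
      (f' := fun t => (ε • DG (γ t) t ε).comp (X t)) (δ := 1) (K := K) (ε := 0) (a := 0) (b := T)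
      (fun t _ => (hX t).continuousAt.continuousWithinAt) (fun t _ => (hX t).hasDerivWithinAt)
      (by rw [hX0]; exact ContinuousLinearMap.norm_id_le)
      (fun t _ => by
        rw [add_zero]
        refine (ContinuousLinearMap.opNorm_comp_le _ _).trans ?_
        gcongr
        rw [norm_smul, Real.norm_of_nonneg hε0]
        exact (mul_le_of_le_one_left (norm_nonneg _) hε1).trans (h.norm_deriv_le _ _ _)) t ht
    rw [gronwallBound_ε0, one_mul, sub_zero] at h1
    refine h1.trans (Real.exp_le_exp.2 ?_)
    gcongr
    exact ht.2
  have hdrift : ∀ t ∈ Icc 0 T, ‖X t - ContinuousLinearMap.id ℝ E‖ ≤ K * T * e * ε := fun t ht => by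
    have h1 := norm_image_sub_le_of_norm_deriv_le_segment' (a := 0) (b := T) (C := ε * K * e)
      (fun t _ => (hX t).hasDerivWithinAt) (fun t ht => by
        refine (ContinuousLinearMap.opNorm_comp_le _ _).trans ?_
        rw [norm_smul, Real.norm_of_nonneg hε0]
        have := hbound t (Ico_subset_Icc_self ht)
        gcongr
        exact h.norm_deriv_le _ _ _) t ht
    rw [hX0, sub_zero] at h1
    calc _ ≤ ε * K * e * t := h1
      _ ≤ ε * K * e * T := by gcongr; exact ht.2
      _ = _ := by ring
  -- subtracting `ε Dw c t`, which vanishes at `0` and `T`, removes the oscillating part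
  have hu : ∀ t, HasDerivAt (fun t => X t - ε • Dw c t - t • (ε • DG₀ c))
      ((ε • DG (γ t) t ε).comp (X t) - ε • (DG c t 0 - DG₀ c) - (1 : ℝ) • (ε • DG₀ c)) t :=
    fun t => ((hX t).sub ((h.hasDerivAt_deriv_w c t).const_smul ε)).sub
      ((hasDerivAt_id t).smul_const (ε • DG₀ c))
  have hfinal := norm_image_sub_le_of_norm_deriv_le_segment' (a := 0) (b := T)
    (C := ε * ((K * (K * T * e) + K * (C + 1)) * ε))
    (fun t _ => (hu t).hasDerivWithinAt) (fun t ht => by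
      have ht' := Ico_subset_Icc_self ht
      have e1 : (ε • DG (γ t) t ε).comp (X t) - ε • (DG c t 0 - DG₀ c) - (1 : ℝ) • (ε • DG₀ c) =
          ε • ((DG (γ t) t ε).comp (X t - ContinuousLinearMap.id ℝ E) +
            (DG (γ t) t ε - DG c t 0)) := by
        rw [ContinuousLinearMap.comp_sub, ContinuousLinearMap.comp_id,
          ContinuousLinearMap.smul_comp, one_smul, smul_sub, smul_add, smul_sub, smul_sub]
        abel
      rw [e1, norm_smul, Real.norm_of_nonneg hε0]
      gcongr
      have h1 := (ContinuousLinearMap.opNorm_comp_le (DG (γ t) t ε)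
        (X t - ContinuousLinearMap.id ℝ E)).trans
        (mul_le_mul (h.norm_deriv_le _ _ _) (hdrift t ht') (norm_nonneg _) hK.le)
      have h2 := h.dist_deriv_le (γ t) c t ε 0
      rw [sub_zero, abs_of_nonneg hε0] at h2
      have h3 : K * (‖γ t - c‖ + ε) ≤ K * (C * ε + ε) := by gcongr; exact hγc t
      calc _ ≤ K * (K * T * e * ε) + K * (C * ε + ε) :=
            (norm_add_le _ _).trans (add_le_add h1 (h2.trans h3))
        _ = _ := by ring) T ⟨hT.le, le_rfl⟩
  rw [h.deriv_w_period, h.deriv_w_zero, smul_zero, sub_zero, zero_smul, sub_zero, sub_zero, hX0,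
    smul_smul, mul_comm T ε, sub_right_comm] at hfinal
  calc _ ≤ _ := hfinal
    _ = _ := by ring

end IsAveragingData

end AveragingPeriodic

/-! ### Attraction and instability near an equilibrium of the averaged equation -/

section AveragingStability

open scoped RealInnerProductSpace

namespace IsAveragingData

variable {E : Type*} [NormedAddCommGroup E] [InnerProductSpace ℝ E]
  {T K : ℝ} {G : E → ℝ → ℝ → E} {G₀ : E → E} {w : E → ℝ → E}
  {DG : E → ℝ → ℝ → E →L[ℝ] E} {DG₀ : E → E →L[ℝ] E} {Dw : E → ℝ → E →L[ℝ] E}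
  (h : IsAveragingData T K G G₀ w DG DG₀ Dw)

/-- The difference of two solutions in the coordinates `z = x - ε w(x, t)`. -/
def reducedDiff (w : E → ℝ → E) (ε : ℝ) (x γ : ℝ → E) (t : ℝ) : E :=
  (x t - ε • w (x t) t) - (γ t - ε • w (γ t) t)

/-- The nonlinear part in the equation `ζ' = ε (A ζ + N)` of the difference of two solutions in the
coordinates `z = x - ε w(x, t)`. -/
def nonlinearPart (G : E → ℝ → ℝ → E) (G₀ : E → E) (w : E → ℝ → E) (Dw : E → ℝ → E →L[ℝ] E)
    (A : E →L[ℝ] E) (ε : ℝ) (x γ : ℝ → E) (t : ℝ) : E :=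
  (G₀ (x t) + remainder G Dw ε (x t) t) - (G₀ (γ t) + remainder G Dw ε (γ t) t) -
    A (reducedDiff w ε x γ t)

include h

theorem hasDerivWithinAt_reducedDiff (A : E →L[ℝ] E) {ε t : ℝ} {x γ : ℝ → E} {s : Set ℝ}
    (hx : HasDerivWithinAt x (ε • G (x t) t ε) s t)
    (hγ : HasDerivWithinAt γ (ε • G (γ t) t ε) s t) :
    HasDerivWithinAt (reducedDiff w ε x γ)
      (ε • (A (reducedDiff w ε x γ t) + nonlinearPart G G₀ w Dw A ε x γ t)) s t := by
  have h1 := (h.hasDerivWithinAt_reduced hx).sub (h.hasDerivWithinAt_reduced hγ)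
  convert! h1 using 1
  rw [nonlinearPart, add_sub_cancel, smul_sub]

omit h in
theorem reducedDiff_sub (ε : ℝ) (x γ : ℝ → E) (t : ℝ) :
    reducedDiff w ε x γ t - (x t - γ t) = -(ε • (w (x t) t - w (γ t) t)) := by
  rw [reducedDiff, smul_sub]
  abel

theorem norm_reducedDiff_sub_le {ε : ℝ} (hε : 0 ≤ ε) (x γ : ℝ → E) (t : ℝ) :
    ‖reducedDiff w ε x γ t - (x t - γ t)‖ ≤ K * ε * ‖x t - γ t‖ := by
  rw [reducedDiff_sub, norm_neg, norm_smul, Real.norm_of_nonneg hε, mul_comm K, mul_assoc]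
  gcongr
  exact h.dist_w_le _ _ _

theorem reducedDiff_zero (ε : ℝ) (x γ : ℝ → E) : reducedDiff w ε x γ 0 = x 0 - γ 0 := by
  simp [reducedDiff, h.w_zero]

theorem norm_le_reducedDiff {ε : ℝ} (hε : 0 ≤ ε) (hεK : K * ε ≤ 1 / 2) (x γ : ℝ → E) (t : ℝ) :
    ‖x t - γ t‖ ≤ 2 * ‖reducedDiff w ε x γ t‖ := by
  have h1 := h.norm_reducedDiff_sub_le hε x γ t
  have h2 : ‖x t - γ t‖ ≤ ‖reducedDiff w ε x γ t‖ + ‖reducedDiff w ε x γ t - (x t - γ t)‖ := by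
    rw [norm_sub_rev (reducedDiff w ε x γ t)]
    exact norm_le_norm_add_norm_sub' _ _
  nlinarith [mul_le_mul_of_nonneg_right hεK (norm_nonneg (x t - γ t))]

theorem norm_reducedDiff_le {ε : ℝ} (hε : 0 ≤ ε) (hεK : K * ε ≤ 1 / 2) (x γ : ℝ → E) (t : ℝ) :
    ‖reducedDiff w ε x γ t‖ ≤ 2 * ‖x t - γ t‖ := by
  have h1 := h.norm_reducedDiff_sub_le hε x γ t
  have h2 : ‖reducedDiff w ε x γ t‖ ≤ ‖x t - γ t‖ + ‖reducedDiff w ε x γ t - (x t - γ t)‖ :=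
    norm_le_norm_add_norm_sub' _ _
  nlinarith [mul_le_mul_of_nonneg_right hεK (norm_nonneg (x t - γ t)), norm_nonneg (x t - γ t)]

/-- The nonlinear part is small compared to the difference of the solutions, if both `ε` and the
difference are small. -/
theorem norm_nonlinearPart_le {c : E} {C : ℝ} {ε : ℝ} (hε : 0 ≤ ε) (hC : 0 ≤ C)
    {x γ : ℝ → E} {t : ℝ} (hγ : ‖γ t - c‖ ≤ C * ε) :
    ‖nonlinearPart G G₀ w Dw (DG₀ c) ε x γ t‖ ≤
      (K * C + 2 * K + 3 * K ^ 2) * (ε + ‖x t - γ t‖) * ‖x t - γ t‖ := by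
  have hK := h.K_pos
  have hx : ‖x t - c‖ ≤ C * ε + ‖x t - γ t‖ := by
    calc ‖x t - c‖ = ‖(γ t - c) + (x t - γ t)‖ := by congr 1; abel
      _ ≤ _ := (norm_add_le _ _).trans (by gcongr)
  have h1 := h.norm_avg_sub_linear_le hx (hγ.trans (le_add_of_nonneg_right (norm_nonneg _)))
  have h2 := h.dist_remainder_le hε (x t) (γ t) t
  have h3 := (DG₀ c).le_of_opNorm_le_of_le (h.norm_deriv_avg_le c)
    (h.norm_reducedDiff_sub_le hε x γ t)
  have e1 : nonlinearPart G G₀ w Dw (DG₀ c) ε x γ t =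
      (G₀ (x t) - G₀ (γ t) - DG₀ c (x t - γ t)) +
        (remainder G Dw ε (x t) t - remainder G Dw ε (γ t) t) -
        DG₀ c (reducedDiff w ε x γ t - (x t - γ t)) := by
    rw [nonlinearPart, map_sub (DG₀ c) (reducedDiff w ε x γ t)]
    abel
  rw [e1]
  have hd := norm_nonneg (x t - γ t)
  calc _ ≤ _ :=
        (norm_sub_le _ _).trans (add_le_add ((norm_add_le _ _).trans (add_le_add h1 h2)) h3)
    _ = (K * C + (K + 2 * K ^ 2) + K ^ 2) * ε * ‖x t - γ t‖ + K * ‖x t - γ t‖ * ‖x t - γ t‖ := by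
      ring
    _ ≤ (K * C + 2 * K + 3 * K ^ 2) * ε * ‖x t - γ t‖ +
        (K * C + 2 * K + 3 * K ^ 2) * ‖x t - γ t‖ * ‖x t - γ t‖ :=
      add_le_add
        (mul_le_mul_of_nonneg_right (mul_le_mul_of_nonneg_right (by linarith) hε) hd)
        (mul_le_mul_of_nonneg_right (mul_le_mul_of_nonneg_right
          (by nlinarith [mul_nonneg hK.le hC, sq_nonneg K]) hd) hd)
    _ = _ := by ring

omit h in
theorem hasDerivWithinAt_quadratic {P : E →L[ℝ] E} (hP : ∀ u v, ⟪P u, v⟫ = ⟪u, P v⟫)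
    {ζ : ℝ → E} {ζ' : E} {s : Set ℝ} {t : ℝ} (hζ : HasDerivWithinAt ζ ζ' s t) :
    HasDerivWithinAt (fun t => ⟪P (ζ t), ζ t⟫) (2 * ⟪P (ζ t), ζ'⟫) s t := by
  have h1 := (P.hasFDerivAt.comp_hasDerivWithinAt t hζ).inner ℝ hζ
  convert! h1 using 1
  rw [hP ζ', real_inner_comm (P (ζ t)) ζ', Function.comp_apply]
  ring

/-- If the averaged linearization has a Lyapunov function, then all solutions of the full equation
near a solution `γ` which is `O(ε)`-close to the equilibrium `c` approach `γ` exponentially. -/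
theorem exists_exponential_attraction {c : E} {P : E →L[ℝ] E}
    (hP : ∀ u v, ⟪P u, v⟫ = ⟪u, P v⟫) (hPA : ∀ u, 2 * ⟪P u, DG₀ c u⟫ = -‖u‖ ^ 2)
    {p : ℝ} (hp : 0 < p) (hpP : ∀ u, p * ‖u‖ ^ 2 ≤ ⟪P u, u⟫) {C : ℝ} (hC : 0 ≤ C) :
    ∃ ε₂ > 0, ∃ δ > 0, ∃ m > 0, ∃ a > 0, ∀ ε ∈ Ioc 0 ε₂, ∀ γ x : ℝ → E,
      (∀ t, HasDerivAt γ (ε • G (γ t) t ε) t) → (∀ t, ‖γ t - c‖ ≤ C * ε) →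
      (∀ t ∈ Ici 0, HasDerivWithinAt x (ε • G (x t) t ε) (Ici 0) t) →
      ∀ r ∈ Ioc 0 δ, ‖x 0 - γ 0‖ ≤ r → ∀ t ≥ 0, ‖x t - γ t‖ ≤ m * Real.exp (-(a * ε * t)) * r := by
  have hK := h.K_pos
  set q : ℝ := ‖P‖ + 1 with hq
  have hq0 : 0 < q := by positivity
  have hPq : ‖P‖ ≤ q := by linarith
  have hV : ∀ u, ⟪P u, u⟫ ≤ q * ‖u‖ ^ 2 := fun u => by
    calc ⟪P u, u⟫ ≤ ‖P u‖ * ‖u‖ := real_inner_le_norm _ _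
      _ ≤ q * ‖u‖ * ‖u‖ := by
        gcongr
        exact P.le_of_opNorm_le hPq u
      _ = _ := by ring
  -- the constant in the bound for the nonlinear part
  set κ : ℝ := K * C + 2 * K + 3 * K ^ 2 with hκ
  have hκ0 : 0 < κ := by positivity
  set m : ℝ := 2 * Real.sqrt (q / p) with hm
  have hm0 : 0 < m := by positivity
  refine ⟨min (1 / (2 * K)) (1 / (16 * κ * q)), by positivity, 1 / (16 * κ * q * m), by positivity,
    m, hm0, 1 / (8 * q), by positivity, ?_⟩
  rintro ε ⟨hε0, hε2⟩ γ x hγ hγc hx r ⟨hr0, hrδ⟩ hx0 t ht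
  have hεK : K * ε ≤ 1 / 2 := by
    have := hε2.trans (min_le_left _ _)
    rw [le_div_iff₀ (by positivity)] at this
    linarith
  have hεκ : 4 * q * κ * ε ≤ 1 / 4 := by
    have := hε2.trans (min_le_right _ _)
    rw [le_div_iff₀ (by positivity)] at this
    linarith
  have hrκ : 4 * q * κ * (m * r) ≤ 1 / 4 := by
    rw [le_div_iff₀ (by positivity)] at hrδ
    linarith
  set ζ := reducedDiff w ε x γ with hζ
  have hmem : ∀ s ∈ Ici (0 : ℝ), HasDerivWithinAt ζ
      (ε • (DG₀ c (ζ s) + nonlinearPart G G₀ w Dw (DG₀ c) ε x γ s)) (Ici 0) s := fun s hs =>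
    h.hasDerivWithinAt_reducedDiff (DG₀ c) (hx s hs) (hγ s).hasDerivWithinAt
  set B : ℝ → ℝ := fun s => q * r ^ 2 * Real.exp (-(1 / (4 * q) * ε) * s) with hB
  have hBpos : ∀ s, 0 < B s := fun s => by positivity
  have hB' : ∀ s, HasDerivAt B (-(1 / (4 * q) * ε) * B s) s := fun s => by
    have := ((hasDerivAt_id s).const_mul (-(1 / (4 * q) * ε))).exp.const_mul (q * r ^ 2)
    convert! this using 1
    simp only [hB, id]
    ring
  -- where the quadratic form is at most `B s`, the point `x s` is so close to `γ s` that the linear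
  -- part dominates
  have hsmall : ∀ s ≥ 0, ⟪P (ζ s), ζ s⟫ ≤ B s →
      ‖x s - γ s‖ ≤ m * Real.exp (-(1 / (8 * q) * ε * s)) * r := fun s hs hVs => by
    refine (h.norm_le_reducedDiff hε0.le hεK x γ s).trans ?_
    rw [hm, mul_assoc, mul_assoc]
    refine mul_le_mul_of_nonneg_left ?_ zero_le_two
    refine abs_le_of_sq_le_sq' ?_ (by positivity) |>.2
    have h1 : Real.exp (-(1 / (8 * q) * ε * s)) ^ 2 = Real.exp (-(1 / (4 * q) * ε) * s) := by
      rw [← Real.exp_nat_mul]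
      congr 1
      push_cast
      field_simp
      ring
    rw [mul_pow, mul_pow, h1, Real.sq_sqrt (by positivity), div_mul_eq_mul_div, le_div_iff₀ hp]
    calc ‖ζ s‖ ^ 2 * p = p * ‖ζ s‖ ^ 2 := mul_comm _ _
      _ ≤ _ := hpP _
      _ ≤ _ := hVs
      _ = _ := by rw [hB]; ring
  -- the quadratic form cannot cross `B`, since its derivative is smaller wherever they agree
  have hfence := image_le_of_deriv_right_lt_deriv_boundary (a := 0) (b := t)
    (f := fun s => ⟪P (ζ s), ζ s⟫)
    (f' := fun s => 2 * ⟪P (ζ s), ε • (DG₀ c (ζ s) + nonlinearPart G G₀ w Dw (DG₀ c) ε x γ s)⟫)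
    (B := B) (B' := fun s => -(1 / (4 * q) * ε) * B s)
    (fun s hs => ((hasDerivWithinAt_quadratic hP (hmem s hs.1)).mono
      Icc_subset_Ici_self).continuousWithinAt)
    (fun s hs => (hasDerivWithinAt_quadratic hP (hmem s hs.1)).mono (Ici_subset_Ici.2 hs.1))
    (by
      simp only [hB, mul_zero, Real.exp_zero, mul_one]
      rw [hζ, h.reducedDiff_zero]
      exact (hV _).trans (by gcongr))
    hB'
    (fun s hs hVB => by
      have h1 := hsmall s hs.1 hVB.le
      have h2 : ‖x s - γ s‖ ≤ m * r := by
        refine h1.trans ?_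
        gcongr
        refine mul_le_of_le_one_right hm0.le (Real.exp_le_one_iff.2 ?_)
        have := hs.1
        simp only [Left.neg_nonpos_iff]
        positivity
      have h3 := h.norm_nonlinearPart_le hε0.le hC (x := x) (hγc s)
      have h4 := h.norm_le_reducedDiff hε0.le hεK x γ s
      have h5 : 2 * ⟪P (ζ s), nonlinearPart G G₀ w Dw (DG₀ c) ε x γ s⟫ ≤ 1 / 2 * ‖ζ s‖ ^ 2 := by
        have h6 : ‖nonlinearPart G G₀ w Dw (DG₀ c) ε x γ s‖ ≤ κ * (ε + m * r) * (2 * ‖ζ s‖) :=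
          h3.trans (by gcongr)
        have h7 := (real_inner_le_norm (P (ζ s)) (nonlinearPart G G₀ w Dw (DG₀ c) ε x γ s)).trans
          (mul_le_mul (P.le_of_opNorm_le hPq (ζ s)) h6 (norm_nonneg _) (by positivity))
        nlinarith [mul_le_mul_of_nonneg_right hεκ (sq_nonneg ‖ζ s‖),
          mul_le_mul_of_nonneg_right hrκ (sq_nonneg ‖ζ s‖)]
      have h8 : 2 * ⟪P (ζ s), ε • (DG₀ c (ζ s) + nonlinearPart G G₀ w Dw (DG₀ c) ε x γ s)⟫ =
          ε * (2 * ⟪P (ζ s), DG₀ c (ζ s)⟫ +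
            2 * ⟪P (ζ s), nonlinearPart G G₀ w Dw (DG₀ c) ε x γ s⟫) := by
        rw [inner_smul_right, inner_add_right]
        ring
      rw [h8, hPA]
      have h9 := hV (ζ s)
      have h10 : B s ≤ q * ‖ζ s‖ ^ 2 := hVB ▸ h9
      have h11 : B s / (2 * q) ≤ 1 / 2 * ‖ζ s‖ ^ 2 := by
        rw [div_le_iff₀ (by positivity)]
        linarith
      have h12 : -(1 / (4 * q) * ε) * B s = ε * (-(B s / (2 * q)) + B s / (4 * q)) := by
        field_simp
        ring
      rw [h12]
      have h13 : 0 < B s / (4 * q) := div_pos (hBpos s) (by positivity)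
      refine mul_lt_mul_of_pos_left ?_ hε0
      linarith)
  exact hsmall t ht (hfence ⟨ht, le_rfl⟩)

/-- If the averaged linearization has a quadratic form with exponential growth, then solutions of
the full equation cannot stay near `γ` for all positive times if the form is positive at their
initial deviation. -/
theorem exists_instability {c : E} {P : E →L[ℝ] E}
    (hP : ∀ u v, ⟪P u, v⟫ = ⟪u, P v⟫) {σ : ℝ} (hσ : 0 < σ)
    (hPA : ∀ u, 2 * ⟪P u, DG₀ c u⟫ = 2 * σ * ⟪P u, u⟫ + ‖u‖ ^ 2) {C : ℝ} (hC : 0 ≤ C) :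
    ∃ ε₂ > 0, ∃ δ > 0, ∀ ε ∈ Ioc 0 ε₂, ∀ γ x : ℝ → E,
      (∀ t, HasDerivAt γ (ε • G (γ t) t ε) t) → (∀ t, ‖γ t - c‖ ≤ C * ε) →
      (∀ t ∈ Ici 0, HasDerivWithinAt x (ε • G (x t) t ε) (Ici 0) t) →
      (∀ t ≥ 0, ‖x t - γ t‖ ≤ δ) → ⟪P (x 0 - γ 0), x 0 - γ 0⟫ ≤ 0 := by
  have hK := h.K_pos
  set q : ℝ := ‖P‖ + 1 with hq
  have hq0 : 0 < q := by positivity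
  have hPq : ‖P‖ ≤ q := by linarith
  -- the constant in the bound for the nonlinear part
  set κ : ℝ := K * C + 2 * K + 3 * K ^ 2 with hκ
  have hκ0 : 0 < κ := by positivity
  refine ⟨min (1 / (2 * K)) (1 / (16 * κ * q)), by positivity, 1 / (16 * κ * q), by positivity, ?_⟩
  rintro ε ⟨hε0, hε2⟩ γ x hγ hγc hx hδ
  set δ : ℝ := 1 / (16 * κ * q) with hδdef
  have hδ0 : 0 < δ := by positivity
  have hεK : K * ε ≤ 1 / 2 := by
    have := hε2.trans (min_le_left _ _)
    rw [le_div_iff₀ (by positivity)] at this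
    linarith
  have hεκ : 4 * q * κ * ε ≤ 1 / 4 := by
    have := hε2.trans (min_le_right _ _)
    rw [le_div_iff₀ (by positivity)] at this
    linarith
  have hδκ : 4 * q * κ * δ ≤ 1 / 4 := by
    rw [hδdef]
    field_simp
    norm_num
  set ζ := reducedDiff w ε x γ with hζ
  have hmem : ∀ s ∈ Ici (0 : ℝ), HasDerivWithinAt ζ
      (ε • (DG₀ c (ζ s) + nonlinearPart G G₀ w Dw (DG₀ c) ε x γ s)) (Ici 0) s := fun s hs =>
    h.hasDerivWithinAt_reducedDiff (DG₀ c) (hx s hs) (hγ s).hasDerivWithinAt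
  have hderiv : ∀ s ≥ 0, 2 * ε * σ * ⟪P (ζ s), ζ s⟫ ≤
      2 * ⟪P (ζ s), ε • (DG₀ c (ζ s) + nonlinearPart G G₀ w Dw (DG₀ c) ε x γ s)⟫ := fun s hs => by
    have h3 := h.norm_nonlinearPart_le hε0.le hC (x := x) (hγc s)
    have h4 := h.norm_le_reducedDiff hε0.le hεK x γ s
    have h5 : -(1 / 2 * ‖ζ s‖ ^ 2) ≤ 2 * ⟪P (ζ s), nonlinearPart G G₀ w Dw (DG₀ c) ε x γ s⟫ := by
      have h6 : ‖nonlinearPart G G₀ w Dw (DG₀ c) ε x γ s‖ ≤ κ * (ε + δ) * (2 * ‖ζ s‖) :=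
        h3.trans (by gcongr; exact hδ s hs)
      have h7 := (abs_real_inner_le_norm (P (ζ s))
        (nonlinearPart G G₀ w Dw (DG₀ c) ε x γ s)).trans
        (mul_le_mul (P.le_of_opNorm_le hPq (ζ s)) h6 (norm_nonneg _) (by positivity))
      nlinarith [mul_le_mul_of_nonneg_right hεκ (sq_nonneg ‖ζ s‖),
        mul_le_mul_of_nonneg_right hδκ (sq_nonneg ‖ζ s‖), neg_le_of_abs_le h7]
    rw [inner_smul_right, inner_add_right]
    have h8 := hPA (ζ s)
    have h9 : 2 * σ * ⟪P (ζ s), ζ s⟫ ≤ 2 * (⟪P (ζ s), DG₀ c (ζ s)⟫ +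
        ⟪P (ζ s), nonlinearPart G G₀ w Dw (DG₀ c) ε x γ s⟫) := by
      nlinarith [sq_nonneg ‖ζ s‖]
    calc _ = ε * (2 * σ * ⟪P (ζ s), ζ s⟫) := by ring
      _ ≤ ε * (2 * (⟪P (ζ s), DG₀ c (ζ s)⟫ +
        ⟪P (ζ s), nonlinearPart G G₀ w Dw (DG₀ c) ε x γ s⟫)) := by gcongr
      _ = _ := by ring
  by_contra! hpos
  set V₀ : ℝ := ⟪P (x 0 - γ 0), x 0 - γ 0⟫ with hV₀
  set B : ℝ → ℝ := fun s => -(V₀ * Real.exp (ε * σ * s)) with hB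
  have hB' : ∀ s, HasDerivAt B (ε * σ * B s) s := fun s => by
    have := (((hasDerivAt_id s).const_mul (ε * σ)).exp.const_mul V₀).neg
    convert! this using 1
    simp only [hB, id]
    ring
  -- if the form is positive initially, it grows exponentially, which contradicts boundedness
  have hgrow : ∀ t ≥ 0, V₀ * Real.exp (ε * σ * t) ≤ ⟪P (ζ t), ζ t⟫ := fun t ht => by
    have hfence := image_le_of_deriv_right_lt_deriv_boundary (a := 0) (b := t)
      (f := fun s => -⟪P (ζ s), ζ s⟫)
      (f' := fun s => -(2 * ⟪P (ζ s),
        ε • (DG₀ c (ζ s) + nonlinearPart G G₀ w Dw (DG₀ c) ε x γ s)⟫))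
      (B := B) (B' := fun s => ε * σ * B s)
      (fun s hs => ((hasDerivWithinAt_quadratic hP (hmem s hs.1)).fun_neg.mono
        Icc_subset_Ici_self).continuousWithinAt)
      (fun s hs => (hasDerivWithinAt_quadratic hP (hmem s hs.1)).fun_neg.mono
        (Ici_subset_Ici.2 hs.1))
      (by
        simp only [hB, mul_zero, Real.exp_zero, mul_one]
        rw [hζ, h.reducedDiff_zero])
      hB'
      (fun s hs hVB => by
        have h1 := hderiv s hs.1
        have h2 : ⟪P (ζ s), ζ s⟫ = V₀ * Real.exp (ε * σ * s) := by
          simp only [hB] at hVB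
          linarith
        have h3 : 0 < ε * σ * (V₀ * Real.exp (ε * σ * s)) := by positivity
        rw [h2] at h1
        simp only [hB]
        linarith)
    have := hfence ⟨ht, le_rfl⟩
    simp only [hB] at this
    linarith
  have hbdd : ∀ t ≥ 0, ⟪P (ζ t), ζ t⟫ ≤ q * (2 * δ) ^ 2 := fun t ht => by
    have h1 := (h.norm_reducedDiff_le hε0.le hεK x γ t).trans
      (mul_le_mul_of_nonneg_left (hδ t ht) zero_le_two)
    calc ⟪P (ζ t), ζ t⟫ ≤ ‖P (ζ t)‖ * ‖ζ t‖ := real_inner_le_norm _ _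
      _ ≤ q * ‖ζ t‖ * ‖ζ t‖ := by
        gcongr
        exact P.le_of_opNorm_le hPq _
      _ = q * ‖ζ t‖ ^ 2 := by ring
      _ ≤ _ := by gcongr
  have htend : Tendsto (fun t => V₀ * Real.exp (ε * σ * t)) atTop atTop :=
    (Real.tendsto_exp_atTop.comp (tendsto_id.const_mul_atTop (by positivity))).const_mul_atTop hpos
  obtain ⟨t, ht1, ht2⟩ := ((htend.eventually_gt_atTop (q * (2 * δ) ^ 2)).and
    (eventually_ge_atTop 0)).exists
  linarith [hgrow t ht2, hbdd t ht2]

end IsAveragingData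

end AveragingStability

/-! ### Regular fields and the primitive of their oscillating part -/

section ParametricIntegrals

universe u

variable {X F : Type u} [NormedAddCommGroup X] [NormedSpace ℝ X] [FiniteDimensional ℝ X]
  [NormedAddCommGroup F] [NormedSpace ℝ F]

/-- Differentiation of `∫ₐᵇ f(x, t) dt` for a `C¹` function `f`. -/
theorem hasFDerivAt_integral_of_contDiff {f : X × ℝ → F} (hf : ContDiff ℝ 1 f) (a b : ℝ) (x₀ : X) :
    HasFDerivAt (fun x => ∫ t in a..b, f (x, t))
      (∫ t in a..b, (fderiv ℝ f (x₀, t)).comp (ContinuousLinearMap.inl ℝ X ℝ)) x₀ := by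
  have hc := hf.continuous
  have hc' : Continuous fun p => (fderiv ℝ f p).comp (ContinuousLinearMap.inl ℝ X ℝ) :=
    (hf.continuous_fderiv one_ne_zero).clm_comp continuous_const
  obtain ⟨B, hB⟩ := ((isCompact_closedBall x₀ 1).prod (isCompact_uIcc (a := a) (b := b))
    ).exists_bound_of_continuousOn hc'.continuousOn
  refine intervalIntegral.hasFDerivAt_integral_of_dominated_of_fderiv_le (μ := MeasureTheory.volume)
    (F := fun x t => f (x, t))
    (F' := fun x t => (fderiv ℝ f (x, t)).comp (ContinuousLinearMap.inl ℝ X ℝ))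
    (bound := fun _ => B) (Metric.closedBall_mem_nhds x₀ one_pos)
    (Eventually.of_forall fun x => (Continuous.aestronglyMeasurable (by fun_prop)))
    ((show Continuous fun t => f (x₀, t) by fun_prop).intervalIntegrable _ _)
    (Continuous.aestronglyMeasurable (hc'.comp (by fun_prop : Continuous fun t : ℝ => (x₀, t))))
    (Eventually.of_forall fun t ht x hx => hB (x, t) ⟨hx, uIoc_subset_uIcc ht⟩)
    intervalIntegrable_const
    (Eventually.of_forall fun t _ x _ => ?_)
  exact HasFDerivAt.comp (f := fun x => (x, t)) x
    (hf.differentiable one_ne_zero _).hasFDerivAt (hasFDerivAt_prodMk_left x t)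

/-- Integrals of `Cᵏ` functions depend in a `Cᵏ` way on parameters. -/
theorem contDiff_integral {k : ℕ} {f : X × ℝ → F} (hf : ContDiff ℝ k f) (a b : ℝ) :
    ContDiff ℝ k (fun x => ∫ t in a..b, f (x, t)) := by
  induction k generalizing F with
  | zero =>
    have hc : Continuous (Function.uncurry fun x t => f (x, t)) := hf.continuous
    exact contDiff_zero.2
      (intervalIntegral.continuous_parametric_intervalIntegral_of_continuous' hc a b)
  | succ k ih =>
    have hf1 : ContDiff ℝ 1 f := hf.of_le (by norm_cast; omega)
    push_cast at hf ⊢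
    rw [contDiff_succ_iff_hasFDerivAt]
    exact ⟨_, ih ((hf.fderiv_right le_rfl).clm_comp contDiff_const),
      hasFDerivAt_integral_of_contDiff hf1 a b⟩

end ParametricIntegrals

section PeriodicBounds

variable {Y F : Type*} [NormedAddCommGroup Y] [NormedSpace ℝ Y] [FiniteDimensional ℝ Y]
  [NormedAddCommGroup F] [NormedSpace ℝ F]

/-- A function of `(y, t)` which is `T`-periodic in `t` and vanishes for large `y`. -/
structure PeriodicSupported (T : ℝ) (f : Y × ℝ → F) : Prop where
  periodic : ∀ y t, f (y, t + T) = f (y, t)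
  support : ∃ R : ℝ, ∀ y t, R < ‖y‖ → f (y, t) = 0

omit [NormedSpace ℝ F] in
theorem PeriodicSupported.exists_norm_le {T : ℝ} (hT : 0 < T) {f : Y × ℝ → F}
    (h : PeriodicSupported T f) (hf : Continuous f) : ∃ B, ∀ p, ‖f p‖ ≤ B := by
  obtain ⟨R, hR⟩ := h.support
  obtain ⟨B, hB⟩ := ((isCompact_closedBall (0 : Y) R).prod (isCompact_Icc (a := 0) (b := T))
    ).exists_bound_of_continuousOn hf.continuousOn
  refine ⟨max B 0, fun ⟨y, t⟩ => ?_⟩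
  by_cases hy : R < ‖y‖
  · rw [hR y t hy, norm_zero]
    exact le_max_right _ _
  · have hper : Function.Periodic (fun t => f (y, t)) T := h.periodic y
    obtain ⟨s, hs, hst⟩ := hper.exists_mem_Ico₀ hT t
    change f (y, t) = f (y, s) at hst
    rw [hst]
    exact (hB (y, s) ⟨by simpa using hy, Ico_subset_Icc_self hs⟩).trans (le_max_left _ _)

omit [FiniteDimensional ℝ Y] in
theorem PeriodicSupported.fderiv {T : ℝ} {f : Y × ℝ → F} (h : PeriodicSupported T f) :
    PeriodicSupported T (fderiv ℝ f) := by
  obtain ⟨R, hR⟩ := h.support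
  refine ⟨fun y t => ?_, R, fun y t hy => ?_⟩
  · have h1 : (fun p : Y × ℝ => f (p + (0, T))) = f := funext fun p => by
      rw [← h.periodic p.1 p.2]
      simp [Prod.add_def]
    have h2 := fderiv_comp_add_right (𝕜 := ℝ) (f := f) (x := (y, t)) (0, T)
    rw [h1] at h2
    rw [h2]
    simp
  · have hev : f =ᶠ[𝓝 (y, t)] fun _ => 0 := by
      have : ∀ᶠ p : Y × ℝ in 𝓝 (y, t), R < ‖p.1‖ :=
        (continuous_fst.norm.tendsto (y, t)).eventually_const_lt hy
      filter_upwards [this] with p hp using hR p.1 p.2 hp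
    rw [hev.fderiv_eq]
    simp

/-- `C²` functions which are periodic in time and vanish for large arguments have bounded and
Lipschitz continuous derivatives. -/
theorem PeriodicSupported.exists_bounds {T : ℝ} (hT : 0 < T) {f : Y × ℝ → F}
    (h : PeriodicSupported T f) (hf : ContDiff ℝ 2 f) :
    ∃ K, 0 < K ∧ (∀ p, ‖f p‖ ≤ K) ∧ (∀ p q, ‖f p - f q‖ ≤ K * ‖p - q‖) ∧
      (∀ p, ‖_root_.fderiv ℝ f p‖ ≤ K) ∧
      ∀ p q, ‖_root_.fderiv ℝ f p - _root_.fderiv ℝ f q‖ ≤ K * ‖p - q‖ := by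
  have hf' : ContDiff ℝ 1 (_root_.fderiv ℝ f) := hf.fderiv_right (by norm_num)
  have hd : ∀ p, HasFDerivAt f (_root_.fderiv ℝ f p) p := fun p =>
    (hf.differentiable two_ne_zero p).hasFDerivAt
  have hd' : ∀ p, HasFDerivAt (_root_.fderiv ℝ f) (_root_.fderiv ℝ (_root_.fderiv ℝ f) p) p :=
    fun p => (hf'.differentiable one_ne_zero p).hasFDerivAt
  obtain ⟨B₀, hB₀⟩ := h.exists_norm_le hT hf.continuous
  obtain ⟨B₁, hB₁⟩ := h.fderiv.exists_norm_le hT hf'.continuous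
  obtain ⟨B₂, hB₂⟩ := h.fderiv.fderiv.exists_norm_le hT (hf'.continuous_fderiv one_ne_zero)
  set K := max 1 (max B₀ (max B₁ B₂))
  have h0 : B₀ ≤ K := by simp [K]
  have h1 : B₁ ≤ K := by simp [K]
  have h2 : B₂ ≤ K := by simp [K]
  refine ⟨K, lt_of_lt_of_le one_pos (le_max_left _ _), fun p => (hB₀ p).trans h0,
    fun p q => norm_sub_le_of_hasFDerivAt hd (fun p => (hB₁ p).trans h1) p q,
    fun p => (hB₁ p).trans h1,
    fun p q => norm_sub_le_of_hasFDerivAt hd' (fun p => (hB₂ p).trans h2) p q⟩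

end PeriodicBounds

section Regularity

variable {E : Type*} [NormedAddCommGroup E] [NormedSpace ℝ E] [FiniteDimensional ℝ E]

/-- The average of `G` over one period at `ε = 0`. -/
noncomputable def timeAverage (T : ℝ) (G : E → ℝ → ℝ → E) (x : E) : E :=
  T⁻¹ • ∫ t in (0 : ℝ)..T, G x t 0

/-- The primitive `w(x, t) = ∫₀ᵗ (G(x, s, 0) - ⟨G⟩(x)) ds` of the oscillating part. -/
noncomputable def oscPrimitive (T : ℝ) (G : E → ℝ → ℝ → E) (x : E) (t : ℝ) : E :=
  ∫ s in (0 : ℝ)..t, (G x s 0 - timeAverage T G x)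

/-- The derivative of `G` in `x`, as a restriction of the total derivative. -/
noncomputable def spaceDeriv (G : E → ℝ → ℝ → E) (x : E) (t ε : ℝ) : E →L[ℝ] E :=
  (fderiv ℝ (fun p : (E × ℝ) × ℝ => G p.1.1 p.2 p.1.2) ((x, ε), t)).comp
    ((ContinuousLinearMap.inl ℝ (E × ℝ) ℝ).comp (ContinuousLinearMap.inl ℝ E ℝ))

/-- The derivative of `oscPrimitive` in `x`, as a restriction of the total derivative. -/
noncomputable def oscPrimitiveDeriv (T : ℝ) (G : E → ℝ → ℝ → E) (x : E) (t : ℝ) : E →L[ℝ] E :=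
  (fderiv ℝ (fun p : E × ℝ => oscPrimitive T G p.1 p.2) (x, t)).comp (ContinuousLinearMap.inl ℝ E ℝ)

/-- A global `Cʳ` field `G x t ε` which is `T`-periodic in `t` and vanishes for large `(x, ε)`. -/
structure IsRegularField (T : ℝ) (r : ℕ) (G : E → ℝ → ℝ → E) : Prop where
  contDiff : ContDiff ℝ r fun p : (E × ℝ) × ℝ => G p.1.1 p.2 p.1.2
  periodicSupported : PeriodicSupported T fun p : (E × ℝ) × ℝ => G p.1.1 p.2 p.1.2

namespace IsRegularField

variable {T : ℝ} {r : ℕ} {G : E → ℝ → ℝ → E} (h : IsRegularField T r G)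

include h

omit [FiniteDimensional ℝ E] in
theorem continuous_time (x : E) (ε : ℝ) : Continuous fun t => G x t ε :=
  h.contDiff.continuous.comp (by fun_prop : Continuous fun t : ℝ => ((x, ε), t))

omit [FiniteDimensional ℝ E] in
theorem contDiff_zero : ContDiff ℝ r fun p : E × ℝ => G p.1 p.2 0 :=
  h.contDiff.comp (by fun_prop : ContDiff ℝ r fun p : E × ℝ => ((p.1, (0 : ℝ)), p.2))

omit [FiniteDimensional ℝ E] in
theorem periodicSupported_zero : PeriodicSupported T fun p : E × ℝ => G p.1 p.2 0 := by
  obtain ⟨R, hR⟩ := h.periodicSupported.support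
  exact ⟨fun y t => h.periodicSupported.periodic (y, 0) t, R, fun y t hy =>
    hR (y, 0) t (by rwa [Prod.norm_mk, norm_zero, max_eq_left (norm_nonneg _)])⟩

theorem contDiff_timeAverage : ContDiff ℝ r (timeAverage T G) :=
  (contDiff_integral h.contDiff_zero 0 T).const_smul T⁻¹

theorem contDiff_oscillating :
    ContDiff ℝ r fun p : E × ℝ => G p.1 p.2 0 - timeAverage T G p.1 :=
  h.contDiff_zero.sub (h.contDiff_timeAverage.comp contDiff_fst)

theorem contDiff_oscPrimitive :
    ContDiff ℝ r fun p : E × ℝ => oscPrimitive T G p.1 p.2 := by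
  -- rescaling to a fixed interval turns the upper limit into a parameter
  have h1 : (fun p : E × ℝ => oscPrimitive T G p.1 p.2) = fun p =>
      p.2 • ∫ u in (0 : ℝ)..1, (G p.1 (p.2 * u) 0 - timeAverage T G p.1) := by
    funext p
    rw [intervalIntegral.smul_integral_comp_mul_left
      (f := fun s => G p.1 s 0 - timeAverage T G p.1), mul_zero, mul_one, oscPrimitive]
  rw [h1]
  exact contDiff_snd.smul (contDiff_integral (X := E × ℝ) (h.contDiff_oscillating.comp
    (by fun_prop : ContDiff ℝ r fun q : (E × ℝ) × ℝ => (q.1.1, q.1.2 * q.2))) 0 1)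

omit [FiniteDimensional ℝ E] in
theorem continuous_oscillating (x : E) : Continuous fun s => G x s 0 - timeAverage T G x :=
  (h.continuous_time x 0).sub continuous_const

omit [FiniteDimensional ℝ E] in
theorem periodic_time (x : E) (ε : ℝ) : Function.Periodic (fun t => G x t ε) T := fun t =>
  h.periodicSupported.periodic (x, ε) t

theorem oscPrimitive_period (hT : 0 < T) (x : E) : oscPrimitive T G x T = 0 := by
  have := FiniteDimensional.complete ℝ E
  rw [oscPrimitive, intervalIntegral.integral_sub ((h.continuous_time x 0).intervalIntegrable _ _)
    intervalIntegrable_const, intervalIntegral.integral_const, timeAverage, sub_zero,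
    smul_inv_smul₀ hT.ne', sub_self]

theorem oscPrimitive_add (hT : 0 < T) (x : E) (t : ℝ) :
    oscPrimitive T G x (t + T) = oscPrimitive T G x t := by
  have hper : Function.Periodic (fun s => G x s 0 - timeAverage T G x) T := fun t => by
    simp only [h.periodic_time x 0 t]
  have hi := fun a b => (h.continuous_oscillating x).intervalIntegrable
    (μ := MeasureTheory.volume) a b
  rw [oscPrimitive, ← intervalIntegral.integral_add_adjacent_intervals (hi 0 t) (hi t (t + T)),
    hper.intervalIntegral_add_eq t 0, zero_add]
  have := h.oscPrimitive_period hT x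
  rw [oscPrimitive] at this
  rw [this, add_zero, oscPrimitive]

omit [FiniteDimensional ℝ E] in
theorem periodicSupported_timeAverage :
    PeriodicSupported T fun p : E × ℝ => timeAverage T G p.1 := by
  obtain ⟨R, hR⟩ := h.periodicSupported_zero.support
  refine ⟨fun _ _ => rfl, R, fun y t hy => ?_⟩
  have : (fun t => G y t 0) = fun _ => 0 := funext fun t => hR y t hy
  simp [timeAverage, this]

theorem periodicSupported_oscPrimitive (hT : 0 < T) :
    PeriodicSupported T fun p : E × ℝ => oscPrimitive T G p.1 p.2 := by
  obtain ⟨R, hR⟩ := h.periodicSupported_zero.support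
  refine ⟨fun y t => h.oscPrimitive_add hT y t, R, fun y t hy => ?_⟩
  have : (fun t => G y t 0) = fun _ => 0 := funext fun t => hR y t hy
  have h0 : ∀ t, G y t 0 = 0 := fun t => hR y t hy
  simp [oscPrimitive, timeAverage, h0]

omit [FiniteDimensional ℝ E] in
theorem hasFDerivAt_space (hr : 2 ≤ r) (x : E) (t ε : ℝ) :
    HasFDerivAt (fun x => G x t ε) (spaceDeriv G x t ε) x := by
  have h1 : ContDiff ℝ 1 fun p : (E × ℝ) × ℝ => G p.1.1 p.2 p.1.2 :=
    h.contDiff.of_le (by norm_cast; omega)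
  have h2 : HasFDerivAt (fun x : E => ((x, ε), t)) ((ContinuousLinearMap.inl ℝ (E × ℝ) ℝ).comp
      (ContinuousLinearMap.inl ℝ E ℝ)) x :=
    HasFDerivAt.comp (f := fun x => (x, ε)) (g := fun p : E × ℝ => (p, t)) x
      (hasFDerivAt_prodMk_left (x, ε) t)
      (hasFDerivAt_prodMk_left x ε)
  exact HasFDerivAt.comp (f := fun x => ((x, ε), t)) x
    (h1.differentiable one_ne_zero _).hasFDerivAt h2

theorem hasDerivAt_oscPrimitive (x : E) (t : ℝ) :
    HasDerivAt (fun t => oscPrimitive T G x t) (G x t 0 - timeAverage T G x) t :=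
  have := FiniteDimensional.complete ℝ E
  ((h.continuous_oscillating x).integral_hasStrictDerivAt 0 t).hasDerivAt

theorem hasFDerivAt_oscPrimitive (hr : 2 ≤ r) (x : E) (t : ℝ) :
    HasFDerivAt (fun p : E × ℝ => oscPrimitive T G p.1 p.2) ((oscPrimitiveDeriv T G x t).coprod
      (ContinuousLinearMap.toSpanSingleton ℝ (G x t 0 - timeAverage T G x))) (x, t) := by
  have h1 : ContDiff ℝ 1 fun p : E × ℝ => oscPrimitive T G p.1 p.2 :=
    h.contDiff_oscPrimitive.of_le (by norm_cast; omega)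
  have h2 := (h1.differentiable one_ne_zero (x, t)).hasFDerivAt
  have h3 : HasDerivAt (fun t => oscPrimitive T G x t)
      (fderiv ℝ (fun p : E × ℝ => oscPrimitive T G p.1 p.2) (x, t) (0, 1)) t := by
    have := h2.comp_hasDerivAt t (f := fun t => (x, t))
      ((hasDerivAt_const t x).prodMk (hasDerivAt_id t))
    exact this
  have h4 := h3.unique (h.hasDerivAt_oscPrimitive x t)
  convert! h2 using 1
  ext v
  · simp [oscPrimitiveDeriv]
  · simp [h4]

/-- The mixed derivative of the primitive. It is computed by differentiating under the
integral. -/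
theorem hasDerivAt_oscPrimitiveDeriv (hr : 2 ≤ r) (x : E) (t : ℝ) :
    HasDerivAt (fun t => oscPrimitiveDeriv T G x t)
      (spaceDeriv G x t 0 - fderiv ℝ (timeAverage T G) x) t := by
  have h1 : ContDiff ℝ 1 fun p : E × ℝ => G p.1 p.2 0 - timeAverage T G p.1 :=
    h.contDiff_oscillating.of_le (by norm_cast; omega)
  have h2 : ∀ s, (fderiv ℝ (fun p : E × ℝ => G p.1 p.2 0 - timeAverage T G p.1) (x, s)).comp
      (ContinuousLinearMap.inl ℝ E ℝ) = spaceDeriv G x s 0 - fderiv ℝ (timeAverage T G) x := by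
    intro s
    have h3 : HasFDerivAt (fun x => G x s 0 - timeAverage T G x) _ x :=
      HasFDerivAt.comp (f := fun x => (x, s)) x
      (h1.differentiable one_ne_zero (x, s)).hasFDerivAt (hasFDerivAt_prodMk_left x s)
    refine h3.unique ((h.hasFDerivAt_space hr x s 0).sub
      (DifferentiableAt.hasFDerivAt ?_))
    exact h.contDiff_timeAverage.differentiable (by norm_cast; omega) x
  have h4 : ∀ t, oscPrimitiveDeriv T G x t =
      ∫ s in (0 : ℝ)..t, (spaceDeriv G x s 0 - fderiv ℝ (timeAverage T G) x) := by
    intro t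
    have h5 := hasFDerivAt_integral_of_contDiff h1 0 t x
    simp only [h2] at h5
    have h6 : HasFDerivAt (fun x => oscPrimitive T G x t) (oscPrimitiveDeriv T G x t) x := by
      have := HasFDerivAt.comp (f := fun x => (x, t)) x (h.hasFDerivAt_oscPrimitive hr x t)
        (hasFDerivAt_prodMk_left x t)
      convert! this using 1
      ext v
      simp
    exact h6.unique h5
  have hc : Continuous fun s => spaceDeriv G x s 0 - fderiv ℝ (timeAverage T G) x := by
    simp only [← h2]
    exact ((h1.continuous_fderiv one_ne_zero).comp (by fun_prop)).clm_comp continuous_const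
  simp only [h4]
  exact (hc.integral_hasStrictDerivAt 0 t).hasDerivAt

omit h in
theorem norm_inl_le {Y Z : Type*} [NormedAddCommGroup Y] [NormedSpace ℝ Y] [NormedAddCommGroup Z]
    [NormedSpace ℝ Z] : ‖ContinuousLinearMap.inl ℝ Y Z‖ ≤ 1 :=
  ContinuousLinearMap.opNorm_le_bound _ zero_le_one fun v => by simp

omit h in
theorem norm_comp_inl_le {Y Z F : Type*} [NormedAddCommGroup Y] [NormedSpace ℝ Y]
    [NormedAddCommGroup Z] [NormedSpace ℝ Z] [NormedAddCommGroup F] [NormedSpace ℝ F]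
    (L : (Y × Z) →L[ℝ] F) : ‖L.comp (ContinuousLinearMap.inl ℝ Y Z)‖ ≤ ‖L‖ :=
  (ContinuousLinearMap.opNorm_comp_le _ _).trans
    (mul_le_of_le_one_right (norm_nonneg _) norm_inl_le)

/-- A regular field satisfies the uniform bounds on which averaging rests. -/
theorem exists_isAveragingData (hT : 0 < T) (hr : 2 ≤ r) :
    ∃ K, IsAveragingData T K G (timeAverage T G) (oscPrimitive T G) (spaceDeriv G)
      (fderiv ℝ (timeAverage T G)) (oscPrimitiveDeriv T G) := by
  have hr2 : ((2 : ℕ) : WithTop ℕ∞) ≤ r := by exact_mod_cast hr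
  obtain ⟨K₁, hK₁, a1, a2, a3, a4⟩ := h.periodicSupported.exists_bounds hT (h.contDiff.of_le hr2)
  obtain ⟨K₂, hK₂, b1, b2, b3, b4⟩ := h.periodicSupported_timeAverage.exists_bounds hT
    ((h.contDiff_timeAverage.comp contDiff_fst).of_le hr2)
  obtain ⟨K₃, hK₃, c1, c2, c3, c4⟩ := (h.periodicSupported_oscPrimitive hT).exists_bounds hT
    (h.contDiff_oscPrimitive.of_le hr2)
  have hdiff : ∀ x, HasFDerivAt (timeAverage T G) (fderiv ℝ (timeAverage T G) x) x := fun x =>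
    (h.contDiff_timeAverage.differentiable (by norm_cast; omega) x).hasFDerivAt
  have hb : ∀ x, fderiv ℝ (timeAverage T G) x =
      (fderiv ℝ (fun p : E × ℝ => timeAverage T G p.1) (x, 0)).comp
        (ContinuousLinearMap.inl ℝ E ℝ) := fun x =>
    (hdiff x).unique (HasFDerivAt.comp (f := fun x => (x, (0 : ℝ))) x
      (((h.contDiff_timeAverage.comp contDiff_fst).differentiable
        (by norm_cast; omega) (x, 0)).hasFDerivAt) (hasFDerivAt_prodMk_left x 0))
  set K := max K₁ (max K₂ K₃) with hK
  have hK1 : K₁ ≤ K := by simp [hK]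
  have hK2 : K₂ ≤ K := by simp [hK]
  have hK3 : K₃ ≤ K := by simp [hK]
  have hp : ∀ (x x' : E) (t ε ε' : ℝ), ‖((x, ε), t) - ((x', ε'), t)‖ ≤ ‖x - x'‖ + |ε - ε'| := by
    intro x x' t ε ε'
    simp only [Prod.mk_sub_mk, sub_self, Prod.norm_mk, norm_zero, Real.norm_eq_abs]
    have h1 := norm_nonneg (x - x')
    have h2 := abs_nonneg (ε - ε')
    simp only [sup_le_iff]
    refine ⟨⟨?_, ?_⟩, ?_⟩ <;> linarith
  have hq : ∀ (x x' : E) (t : ℝ), ‖(x, t) - (x', t)‖ ≤ ‖x - x'‖ := by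
    intro x x' t
    simp
  refine ⟨K, hT, lt_of_lt_of_le hK₁ hK1, h.continuous_time, fun x t ε => h.periodic_time x ε t,
    fun x t ε => (a1 ((x, ε), t)).trans hK1, fun x x' t ε ε' => ?_, h.hasFDerivAt_space hr,
    fun ε => ?_, fun x t ε => ?_, fun x x' t ε ε' => ?_, hdiff, fun x => ?_, fun x x' => ?_,
    fun x => by simp [oscPrimitive], h.oscPrimitive_period hT, fun x t => (c1 (x, t)).trans hK3,
    h.hasFDerivAt_oscPrimitive hr, fun x t => ?_, fun x x' t => ?_,
    h.hasDerivAt_oscPrimitiveDeriv hr⟩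
  · refine (a2 ((x, ε), t) ((x', ε'), t)).trans ?_
    gcongr
    exact hp x x' t ε ε'
  · have hc : Continuous (fderiv ℝ fun p : (E × ℝ) × ℝ => G p.1.1 p.2 p.1.2) :=
      h.contDiff.continuous_fderiv (by norm_cast; omega)
    exact (hc.comp (by fun_prop : Continuous fun p : E × ℝ => ((p.1, ε), p.2))).clm_comp
      continuous_const
  · rw [spaceDeriv, ← ContinuousLinearMap.comp_assoc]
    exact (norm_comp_inl_le _).trans ((norm_comp_inl_le _).trans ((a3 _).trans hK1))
  · rw [spaceDeriv, spaceDeriv, ← ContinuousLinearMap.sub_comp, ← ContinuousLinearMap.comp_assoc]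
    refine (norm_comp_inl_le _).trans ((norm_comp_inl_le _).trans ((a4 _ _).trans ?_))
    gcongr
    exact hp x x' t ε ε'
  · rw [hb]
    exact (norm_comp_inl_le _).trans ((b3 _).trans hK2)
  · rw [hb, hb, ← ContinuousLinearMap.sub_comp]
    refine (norm_comp_inl_le _).trans ((b4 _ _).trans ?_)
    gcongr
    exact hq x x' 0
  · exact (norm_comp_inl_le _).trans ((c3 _).trans hK3)
  · rw [oscPrimitiveDeriv, oscPrimitiveDeriv, ← ContinuousLinearMap.sub_comp]
    refine (norm_comp_inl_le _).trans ((c4 _ _).trans ?_)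
    gcongr
    exact hq x x' t

end IsRegularField

end Regularity

/-! ### Cutoff of local fields, and diffeomorphisms near the identity -/

section Cutoff

variable {E : Type*} [NormedAddCommGroup E] [NormedSpace ℝ E] [FiniteDimensional ℝ E]

/-- A smooth cutoff function for a compact subset of an open set. -/
theorem exists_contDiff_cutoff {K U : Set E} (hK : IsCompact K) (hU : IsOpen U) (hKU : K ⊆ U) :
    ∃ (χ : E → ℝ) (L : Set E), ContDiff ℝ (⊤ : ℕ∞) χ ∧ IsCompact L ∧ L ⊆ U ∧ (∀ x ∈ K, χ x = 1) ∧
      ∀ x ∉ L, χ x = 0 := by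
  obtain ⟨L, hL, hKL, hLU⟩ := exists_compact_between hK hU hKU
  obtain ⟨f, h0, h1, -⟩ := exists_contMDiffMap_zero_one_of_isClosed (n := (⊤ : ℕ∞))
    (modelWithCornersSelf ℝ E) isOpen_interior.isClosed_compl hK.isClosed
    (by rwa [← subset_compl_iff_disjoint_left, compl_compl])
  exact ⟨f, L, f.contMDiff.contDiff, hL, hLU, fun x hx => h1 hx,
    fun x hx => h0 fun h => hx (interior_subset h)⟩

/-- A field `g x t ε` of class `Cʳ`, defined for `x ∈ U` and `ε ∈ J`, where `J` contains
`[0, ε₀]`, and `T`-periodic in `t`. -/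
structure IsLocalField (r : ℕ) (T ε₀ : ℝ) (U : Set E) (J : Set ℝ) (g : E → ℝ → ℝ → E) : Prop where
  isOpen_space : IsOpen U
  isOpen_param : IsOpen J
  Icc_subset : Icc 0 ε₀ ⊆ J
  contDiffOn : ContDiffOn ℝ r (fun p : E × ℝ × ℝ => g p.1 p.2.1 p.2.2) (U ×ˢ (univ ×ˢ J))
  periodic : ∀ x ∈ U, ∀ ε ∈ J, ∀ t, g x (t + T) ε = g x t ε

/-- A field which is given near a compact set agrees there with a globally defined regular
field. -/
theorem IsLocalField.exists_isRegularField {r : ℕ} {T ε₀ : ℝ} {U : Set E} {J : Set ℝ}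
    {g : E → ℝ → ℝ → E} (h : IsLocalField r T ε₀ U J g) {K : Set E} (hK : IsCompact K)
    (hKU : K ⊆ U) :
    ∃ G, IsRegularField T r G ∧ ∀ x ∈ K, ∀ t, ∀ ε ∈ Icc 0 ε₀, G x t ε = g x t ε := by
  obtain ⟨hU, hJ, hJ₀, hg, hper⟩ := h
  obtain ⟨χ, L, hχ, hL, hLU, h1, h0⟩ := exists_contDiff_cutoff (hK.prod isCompact_Icc)
    (hU.prod hJ) (prod_mono hKU hJ₀)
  refine ⟨fun x t ε => χ (x, ε) • g x t ε, ⟨?_, fun p t => ?_, ?_⟩, fun x hx t ε hε => ?_⟩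
  · rw [contDiff_iff_contDiffAt]
    rintro ⟨p, t⟩
    by_cases hp : p ∈ U ×ˢ J
    · have h2 : ContDiffAt ℝ r (fun p : E × ℝ × ℝ => g p.1 p.2.1 p.2.2) (p.1, t, p.2) :=
        hg.contDiffAt ((hU.prod (isOpen_univ.prod hJ)).mem_nhds ⟨hp.1, mem_univ _, hp.2⟩)
      have h3 : ContDiff ℝ r fun q : (E × ℝ) × ℝ => (q.1.1, q.2, q.1.2) := by fun_prop
      have h4 : ContDiff ℝ r fun q : (E × ℝ) × ℝ => χ q.1 :=
        (hχ.of_le (by exact_mod_cast le_top)).comp contDiff_fst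
      exact h4.contDiffAt.smul
        (ContDiffAt.comp (f := fun q : (E × ℝ) × ℝ => (q.1.1, q.2, q.1.2)) (p, t) h2 h3.contDiffAt)
    · have hev : (fun q : (E × ℝ) × ℝ => χ (q.1.1, q.1.2) • g q.1.1 q.2 q.1.2) =ᶠ[𝓝 (p, t)]
          fun _ => 0 := by
        have : ∀ᶠ q : (E × ℝ) × ℝ in 𝓝 (p, t), q.1 ∈ Lᶜ :=
          continuous_fst.continuousAt.eventually
            (hL.isClosed.isOpen_compl.mem_nhds fun h => hp (hLU h))
        filter_upwards [this] with q hq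
        rw [Prod.mk.eta, h0 _ hq, zero_smul]
      exact contDiffAt_const.congr_of_eventuallyEq hev
  · by_cases hp : p ∈ L
    · simp only [hper p.1 (hLU hp).1 p.2 (hLU hp).2]
    · simp only [Prod.mk.eta, h0 p hp, zero_smul]
  · obtain ⟨R, hR⟩ := hL.isBounded.exists_norm_le
    refine ⟨R, fun p t hp => ?_⟩
    rw [Prod.mk.eta, h0 p fun h => (hR p h).not_gt hp, zero_smul]
  · simp only [h1 (x, ε) ⟨hx, hε⟩, one_smul]

end Cutoff

section NearIdentity

/-- A perturbation of the identity by a `Cʳ` map with Lipschitz constant less than one is a `Cʳ`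
diffeomorphism. -/
theorem exists_homeomorph_of_near_identity {P : Type*} [NormedAddCommGroup P] [NormedSpace ℝ P]
    [CompleteSpace P] [Nontrivial P] {r : ℕ} (hr : r ≠ 0) {f : P → P} {c : NNReal} (hc : c < 1)
    (hf : ContDiff ℝ r f) (hfc : ∀ p q, ‖(f p - f q) - (p - q)‖ ≤ c * ‖p - q‖) :
    ∃ e : P ≃ₜ P, (∀ p, e p = f p) ∧ ContDiff ℝ r e.symm := by
  have hN : ‖((ContinuousLinearEquiv.refl ℝ P).symm : P →L[ℝ] P)‖₊ = 1 := by
    ext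
    exact ContinuousLinearMap.norm_id
  have hA : ApproximatesLinearOn f (ContinuousLinearEquiv.refl ℝ P : P →L[ℝ] P) univ c :=
    ApproximatesLinearOn.approximatesLinearOn_iff_lipschitzOnWith.2 <|
      LipschitzOnWith.of_dist_le_mul fun p _ q _ => by
        rw [dist_eq_norm, dist_eq_norm]
        convert! hfc p q using 2
        simp
        abel
  have hr0 : (r : WithTop ℕ∞) ≠ 0 := by exact_mod_cast hr
  -- the derivative is invertible, as its distance to the identity is less than one
  have hd : ∀ p, ∃ L : P ≃L[ℝ] P, HasFDerivAt f (L : P →L[ℝ] P) p := by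
    intro p
    have h1 := (hf.differentiable hr0 p).hasFDerivAt
    have h2 : HasFDerivAt (fun x => f x - x) (fderiv ℝ f p - ContinuousLinearMap.id ℝ P) p :=
      h1.sub (hasFDerivAt_id p)
    have h3 : ‖fderiv ℝ f p - ContinuousLinearMap.id ℝ P‖ ≤ c :=
      h2.le_of_lipschitz <| LipschitzWith.of_dist_le_mul fun x y => by
        rw [dist_eq_norm, dist_eq_norm]
        convert! hfc x y using 2
        abel
    have h4 : IsUnit (fderiv ℝ f p) := by
      have h5 : ‖ContinuousLinearMap.id ℝ P - fderiv ℝ f p‖ < 1 := by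
        rw [norm_sub_rev]
        exact h3.trans_lt (by exact_mod_cast hc)
      have h6 := isUnit_one_sub_of_norm_lt_one h5
      rwa [show (1 : P →L[ℝ] P) - (ContinuousLinearMap.id ℝ P - fderiv ℝ f p) = fderiv ℝ f p from
        sub_sub_cancel _ _] at h6
    obtain ⟨u, hu⟩ := h4
    exact ⟨ContinuousLinearEquiv.unitsEquiv ℝ P u, by convert! h1 using 1⟩
  choose L hL using hd
  refine ⟨hA.toHomeomorph f (Or.inr (by rwa [hN, inv_one])), fun p => rfl, ?_⟩
  exact Homeomorph.contDiff_symm _ hL hf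

end NearIdentity

/-! ### The near-identity change of variables -/

section ChangeOfVariables

variable {E : Type*} [NormedAddCommGroup E] [NormedSpace ℝ E] [FiniteDimensional ℝ E]

/-- The integral over `s ∈ [0, 1]` of the derivative of `G` at `(y + s ε w(y, t), s ε)` in the
direction `(w(y, t), 1)`; its product with `ε` is `G(y + ε w, t, ε) - G(y, t, 0)`. -/
noncomputable def secantSlope (T : ℝ) (G : E → ℝ → ℝ → E) (y : E) (t ε : ℝ) : E :=
  ∫ s in (0 : ℝ)..1, fderiv ℝ (fun p : (E × ℝ) × ℝ => G p.1.1 p.2 p.1.2)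
    ((y + (s * ε) • oscPrimitive T G y t, s * ε), t) ((oscPrimitive T G y t, 1), 0)

/-- The remainder `g₁` of the equation transformed by `x = y + ε w(y, t)`, where `w` is the
primitive of the oscillating part. `Ring.inverse` is the inverse of `1 + ε ∂w` as soon as the
latter is invertible. -/
noncomputable def transformedRemainder (T : ℝ) (G : E → ℝ → ℝ → E) (y : E) (t ε : ℝ) : E :=
  Ring.inverse (1 + ε • oscPrimitiveDeriv T G y t)
    (secantSlope T G y t ε - oscPrimitiveDeriv T G y t (timeAverage T G y))

namespace IsRegularField

variable {T : ℝ} {r : ℕ} {G : E → ℝ → ℝ → E} (h : IsRegularField T r G)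

include h

theorem contDiff_oscPrimitiveDeriv (hr : 2 ≤ r) :
    ContDiff ℝ (r - 1 : ℕ) fun p : E × ℝ => oscPrimitiveDeriv T G p.1 p.2 :=
  (h.contDiff_oscPrimitive.fderiv_right (by norm_cast; omega)).clm_comp contDiff_const

theorem contDiff_secantSlope (hr : 2 ≤ r) :
    ContDiff ℝ (r - 1 : ℕ) fun p : E × ℝ × ℝ => secantSlope T G p.1 p.2.1 p.2.2 := by
  have hle : ((r - 1 : ℕ) : WithTop ℕ∞) ≤ r := by norm_cast; omega
  have h1 : ContDiff ℝ (r - 1 : ℕ) (fderiv ℝ fun p : (E × ℝ) × ℝ => G p.1.1 p.2 p.1.2) :=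
    h.contDiff.fderiv_right (by norm_cast; omega)
  have h2 : ContDiff ℝ (r - 1 : ℕ) fun q : (E × ℝ × ℝ) × ℝ =>
      oscPrimitive T G q.1.1 q.1.2.1 :=
    (h.contDiff_oscPrimitive.of_le hle).comp
      (by fun_prop : ContDiff ℝ (r - 1 : ℕ) fun q : (E × ℝ × ℝ) × ℝ => (q.1.1, q.1.2.1))
  have h3 : ContDiff ℝ (r - 1 : ℕ) fun q : (E × ℝ × ℝ) × ℝ =>
      ((q.1.1 + (q.2 * q.1.2.2) • oscPrimitive T G q.1.1 q.1.2.1, q.2 * q.1.2.2), q.1.2.1) := by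
    fun_prop
  have h4 : ContDiff ℝ (r - 1 : ℕ) fun q : (E × ℝ × ℝ) × ℝ =>
      (((oscPrimitive T G q.1.1 q.1.2.1, 1), 0) : (E × ℝ) × ℝ) := by
    fun_prop
  exact contDiff_integral ((h1.comp h3).clm_apply h4) 0 1

theorem smul_secantSlope (hr : 2 ≤ r) (y : E) (t ε : ℝ) :
    ε • secantSlope T G y t ε = G (y + ε • oscPrimitive T G y t) t ε - G y t 0 := by
  have := FiniteDimensional.complete ℝ E
  set w := oscPrimitive T G y t with hw
  have hd : ContDiff ℝ 1 fun p : (E × ℝ) × ℝ => G p.1.1 p.2 p.1.2 :=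
    h.contDiff.of_le (by norm_cast; omega)
  have hcurve : ∀ s : ℝ, HasDerivAt (fun s : ℝ => (((y + (s * ε) • w, s * ε), t) : (E × ℝ) × ℝ))
      (ε • ((w, 1), 0)) s := by
    intro s
    have h1 : HasDerivAt (fun s : ℝ => s * ε) ε s := by
      simpa using (hasDerivAt_id s).mul_const ε
    convert! (((h1.smul_const w).const_add y).prodMk h1).prodMk (hasDerivAt_const s t) using 1
    simp
  have h1 : ∀ s : ℝ, HasDerivAt (fun s : ℝ => G (y + (s * ε) • w) t (s * ε))
      (ε • fderiv ℝ (fun p : (E × ℝ) × ℝ => G p.1.1 p.2 p.1.2)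
        ((y + (s * ε) • w, s * ε), t) ((w, 1), 0)) s := by
    intro s
    rw [← map_smul]
    exact (hd.differentiable one_ne_zero _).hasFDerivAt.comp_hasDerivAt s (hcurve s)
  have hc : Continuous fun s : ℝ => ε • fderiv ℝ (fun p : (E × ℝ) × ℝ => G p.1.1 p.2 p.1.2)
        ((y + (s * ε) • w, s * ε), t) ((w, 1), 0) :=
    (((hd.continuous_fderiv one_ne_zero).comp (by fun_prop)).clm_apply
      continuous_const).const_smul ε
  rw [secantSlope, ← hw, ← intervalIntegral.integral_smul,
    intervalIntegral.integral_eq_sub_of_hasDerivAt (fun s _ => h1 s) (hc.intervalIntegrable _ _)]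
  simp

omit h in
theorem isUnit_one_add {y : E} {t ε : ℝ} (hε : ‖ε • oscPrimitiveDeriv T G y t‖ < 1) :
    IsUnit (1 + ε • oscPrimitiveDeriv T G y t) := by
  have := FiniteDimensional.complete ℝ E
  have h1 := isUnit_one_sub_of_norm_lt_one (x := -(ε • oscPrimitiveDeriv T G y t))
    (by rwa [norm_neg])
  rwa [sub_neg_eq_add] at h1

theorem contDiffAt_transformedRemainder (hr : 2 ≤ r) {p : E × ℝ × ℝ}
    (hp : ‖p.2.2 • oscPrimitiveDeriv T G p.1 p.2.1‖ < 1) :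
    ContDiffAt ℝ (r - 1 : ℕ) (fun p : E × ℝ × ℝ => transformedRemainder T G p.1 p.2.1 p.2.2) p := by
  have := FiniteDimensional.complete ℝ E
  obtain ⟨u, hu⟩ := isUnit_one_add hp
  have h1 : ContDiff ℝ (r - 1 : ℕ) fun p : E × ℝ × ℝ => oscPrimitiveDeriv T G p.1 p.2.1 :=
    (h.contDiff_oscPrimitiveDeriv hr).comp
      (by fun_prop : ContDiff ℝ (r - 1 : ℕ) fun p : E × ℝ × ℝ => (p.1, p.2.1))
  have h2 : ContDiff ℝ (r - 1 : ℕ) fun p : E × ℝ × ℝ => timeAverage T G p.1 :=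
    (h.contDiff_timeAverage.of_le (by norm_cast; omega)).comp contDiff_fst
  have h3 : ContDiff ℝ (r - 1 : ℕ) fun p : E × ℝ × ℝ =>
      1 + p.2.2 • oscPrimitiveDeriv T G p.1 p.2.1 := by fun_prop
  have h4 : ContDiffAt ℝ (r - 1 : ℕ) (Ring.inverse : (E →L[ℝ] E) → E →L[ℝ] E)
      (1 + p.2.2 • oscPrimitiveDeriv T G p.1 p.2.1) := by
    rw [← hu]
    exact contDiffAt_ringInverse ℝ u
  have h5 := ContDiffAt.comp (f := fun p : E × ℝ × ℝ =>
      1 + p.2.2 • oscPrimitiveDeriv T G p.1 p.2.1) p h4 h3.contDiffAt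
  exact h5.clm_apply ((h.contDiff_secantSlope hr).sub (h1.clm_apply h2)).contDiffAt

theorem oscPrimitiveDeriv_add (hT : 0 < T) (y : E) (t : ℝ) :
    oscPrimitiveDeriv T G y (t + T) = oscPrimitiveDeriv T G y t := by
  rw [oscPrimitiveDeriv, (h.periodicSupported_oscPrimitive hT).fderiv.periodic y t,
    oscPrimitiveDeriv]

theorem transformedRemainder_add (hT : 0 < T) (y : E) (t ε : ℝ) :
    transformedRemainder T G y (t + T) ε = transformedRemainder T G y t ε := by
  simp only [transformedRemainder, secantSlope, h.oscPrimitiveDeriv_add hT, h.oscPrimitive_add hT,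
    h.periodicSupported.fderiv.periodic]

/-- The equation which the remainder `g₁` has to satisfy in order that `y + ε w(y, t)` solves the
original equation if `y` solves the transformed one. -/
theorem transformedRemainder_spec (hr : 2 ≤ r) {y : E} {t ε : ℝ}
    (hε : ‖ε • oscPrimitiveDeriv T G y t‖ < 1) :
    (1 + ε • oscPrimitiveDeriv T G y t)
        (ε • timeAverage T G y + ε ^ 2 • transformedRemainder T G y t ε) +
      ε • (G y t 0 - timeAverage T G y) = ε • G (y + ε • oscPrimitive T G y t) t ε := by
  have h1 : (1 + ε • oscPrimitiveDeriv T G y t) (transformedRemainder T G y t ε) =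
      secantSlope T G y t ε - oscPrimitiveDeriv T G y t (timeAverage T G y) := by
    rw [transformedRemainder, ← mul_apply_eq_comp,
      Ring.mul_inverse_cancel _ (isUnit_one_add hε), one_apply_eq_self]
  have h2 := h.smul_secantSlope hr y t ε
  have h3 : G (y + ε • oscPrimitive T G y t) t ε = ε • secantSlope T G y t ε + G y t 0 := by
    rw [h2, sub_add_cancel]
  rw [map_add, map_smul, map_smul, h1, h3]
  simp only [_root_.add_apply, one_apply_eq_self, _root_.smul_apply]
  module

/-- For small `ε`, the map `(y, t) ↦ (y + ε w(y, t), t)` is a global `Cʳ` diffeomorphism. -/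
theorem exists_changeOfVariables (hT : 0 < T) (hr : 2 ≤ r) :
    ∃ K : ℝ, 0 < K ∧ (∀ y t, ‖oscPrimitive T G y t‖ ≤ K) ∧
      (∀ y t, ‖oscPrimitiveDeriv T G y t‖ ≤ K) ∧
      ∀ ε : ℝ, |ε| * K < 1 → ∃ e : E × ℝ ≃ₜ E × ℝ,
        (∀ p, e p = (p.1 + ε • oscPrimitive T G p.1 p.2, p.2)) ∧
        ContDiff ℝ r e ∧ ContDiff ℝ r e.symm := by
  have := FiniteDimensional.complete ℝ E
  obtain ⟨K, hK, c1, c2, c3, -⟩ := (h.periodicSupported_oscPrimitive hT).exists_bounds hT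
    (h.contDiff_oscPrimitive.of_le (by norm_cast))
  refine ⟨K, hK, fun y t => c1 (y, t), fun y t => (norm_comp_inl_le _).trans (c3 (y, t)),
    fun ε hε => ?_⟩
  have hf : ContDiff ℝ r fun p : E × ℝ => (p.1 + ε • oscPrimitive T G p.1 p.2, p.2) :=
    (contDiff_fst.add (h.contDiff_oscPrimitive.const_smul ε)).prodMk contDiff_snd
  obtain ⟨e, he, he'⟩ := exists_homeomorph_of_near_identity (by omega : r ≠ 0)
    (c := ⟨|ε| * K, by positivity⟩) (by exact_mod_cast hε) hf fun p q => by
      have e1 : ((p.1 + ε • oscPrimitive T G p.1 p.2, p.2) -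
          (q.1 + ε • oscPrimitive T G q.1 q.2, q.2)) - (p - q) =
          (ε • (oscPrimitive T G p.1 p.2 - oscPrimitive T G q.1 q.2), 0) := by
        ext
        · simp only [Prod.fst_sub]
          module
        · simp
      rw [e1, Prod.norm_mk, norm_zero, max_eq_left (norm_nonneg _), norm_smul, Real.norm_eq_abs]
      change _ ≤ |ε| * K * _
      rw [mul_assoc]
      gcongr
      exact c2 p q
  refine ⟨e, he, ?_, he'⟩
  rwa [show (e : E × ℝ → E × ℝ) = _ from funext he]

/-- The change of variables conjugates the two differential equations. In the direction from `x` to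
`y`, the differentiability of `y` comes from that of the inverse map, so no assumption on the set
`I` is needed. -/
theorem hasDerivWithinAt_changeOfVariables_iff (hr : 2 ≤ r) {ε : ℝ} {e : E × ℝ ≃ₜ E × ℝ}
    (he : ∀ p, e p = (p.1 + ε • oscPrimitive T G p.1 p.2, p.2)) (he' : ContDiff ℝ r e.symm)
    (y : ℝ → E) (I : Set ℝ) (t : ℝ) (hε : ‖ε • oscPrimitiveDeriv T G (y t) t‖ < 1) :
    HasDerivWithinAt (fun t => y t + ε • oscPrimitive T G (y t) t)
      (ε • G (y t + ε • oscPrimitive T G (y t) t) t ε) I t ↔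
    HasDerivWithinAt y
      (ε • timeAverage T G (y t) + ε ^ 2 • transformedRemainder T G (y t) t ε) I t := by
  have hspec := h.transformedRemainder_spec hr hε
  set v := ε • timeAverage T G (y t) + ε ^ 2 • transformedRemainder T G (y t) t ε with hv
  have hw := h.hasFDerivAt_oscPrimitive hr (y t) t
  have hid : HasDerivWithinAt (fun t : ℝ => t) 1 I t := hasDerivWithinAt_id t I
  constructor
  · intro hx
    have h1 : HasDerivWithinAt (fun s => (y s + ε • oscPrimitive T G (y s) s, s))
        (ε • G (y t + ε • oscPrimitive T G (y t) t) t ε, 1) I t := hx.prodMk hid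
    have hD := (he'.differentiable (by norm_cast; omega) (e (y t, t))).hasFDerivAt
    have h2 : HasDerivWithinAt (fun s => e.symm (y s + ε • oscPrimitive T G (y s) s, s))
        (fderiv ℝ e.symm (e (y t, t))
          (ε • G (y t + ε • oscPrimitive T G (y t) t) t ε, 1)) I t := by
      refine HasFDerivAt.comp_hasDerivWithinAt t ?_ h1
      rwa [he] at hD ⊢
    have h3 : (fun s => e.symm (y s + ε • oscPrimitive T G (y s) s, s)) = fun s => (y s, s) :=
      funext fun s => by rw [← e.symm_apply_apply (y s, s), he]
    -- the derivative of `e` maps `(v, 1)` to the velocity of `(x, t)`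
    have h4 : HasDerivAt (fun s : ℝ => e (y t + (s - t) • v, s))
        (ε • G (y t + ε • oscPrimitive T G (y t) t) t ε, 1) t := by
      have h5 : HasDerivAt (fun s : ℝ => y t + (s - t) • v) v t := by
        simpa using (((hasDerivAt_id t).sub_const t).smul_const v).const_add (y t)
      have h6 : HasDerivAt (fun s : ℝ => oscPrimitive T G (y t + (s - t) • v) s)
          (oscPrimitiveDeriv T G (y t) t v + (G (y t) t 0 - timeAverage T G (y t))) t := by
        have hw' := hw
        rw [show (y t, t) = (y t + (t - t) • v, t) by rw [sub_self, zero_smul, add_zero]] at hw'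
        have := hw'.comp_hasDerivAt (f := fun s => (y t + (s - t) • v, s)) t
          (h5.prodMk (hasDerivAt_id t))
        convert! this using 1
        simp
      simp only [he]
      refine HasDerivAt.prodMk ?_ (hasDerivAt_id t)
      convert! h5.add (h6.const_smul ε) using 1
      rw [← hspec]
      simp only [_root_.add_apply, one_apply_eq_self, _root_.smul_apply]
      module
    have h7 : HasDerivAt (fun s : ℝ => e.symm (e (y t + (s - t) • v, s)))
        (fderiv ℝ e.symm (e (y t, t))
          (ε • G (y t + ε • oscPrimitive T G (y t) t) t ε, 1)) t := by
      refine HasFDerivAt.comp_hasDerivAt t ?_ h4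
      rwa [sub_self, zero_smul, add_zero]
    simp only [e.symm_apply_apply] at h7
    have h8 : HasDerivAt (fun s : ℝ => (y t + (s - t) • v, s)) (v, 1) t :=
      (by simpa using (((hasDerivAt_id t).sub_const t).smul_const v).const_add (y t) :
        HasDerivAt (fun s : ℝ => y t + (s - t) • v) v t).prodMk (hasDerivAt_id t)
    rw [h7.unique h8, h3] at h2
    exact h2.fst
  · intro hy
    have h1 : HasDerivWithinAt (fun s => oscPrimitive T G (y s) s)
        (oscPrimitiveDeriv T G (y t) t v + (G (y t) t 0 - timeAverage T G (y t))) I t := by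
      have := hw.comp_hasDerivWithinAt (f := fun s => (y s, s)) t (hy.prodMk hid)
      convert! this using 1
      simp
    convert! hy.add (h1.const_smul ε) using 1
    rw [← hspec]
    simp only [_root_.add_apply, one_apply_eq_self, _root_.smul_apply]
    module

end IsRegularField

end ChangeOfVariables

/-! ### Local fields: change of coordinates and approximation -/

section Euclidean

variable {n r : ℕ} {T ε₀ : ℝ} {D U : Set (EuclideanSpace ℝ (Fin n))} {J : Set ℝ}
  {g : EuclideanSpace ℝ (Fin n) → ℝ → ℝ → EuclideanSpace ℝ (Fin n)}

theorem average_eq_timeAverage {G : EuclideanSpace ℝ (Fin n) → ℝ → ℝ → EuclideanSpace ℝ (Fin n)}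
    {x : EuclideanSpace ℝ (Fin n)} (hG : ∀ t, G x t 0 = g x t 0) :
    average T g x = timeAverage T G x := by
  simp only [average, timeAverage, hG]

theorem mem_cthickening_of_mem_of_norm_le {E : Type*} [NormedAddCommGroup E] {D : Set E} {δ : ℝ}
    {x y : E} (hy : y ∈ D) (h : ‖x - y‖ ≤ δ) : x ∈ Metric.cthickening δ D :=
  Metric.mem_cthickening_of_dist_le x y δ D hy (by rwa [dist_eq_norm])

/-- The near-identity change of coordinates for a local field. -/
theorem IsLocalField.exists_change_of_coordinates (hg : IsLocalField r T ε₀ U J g) (hr : 2 ≤ r)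
    (hT : 0 < T) (hε₀ : 0 < ε₀) (hD : IsCompact D) (hDU : D ⊆ U) :
    ∃ (V : Set (EuclideanSpace ℝ (Fin n)))
        (w : EuclideanSpace ℝ (Fin n) → ℝ → EuclideanSpace ℝ (Fin n))
        (g₁ : EuclideanSpace ℝ (Fin n) → ℝ → ℝ → EuclideanSpace ℝ (Fin n)) (ε₁ : ℝ),
      IsOpen V ∧ D ⊆ V ∧ V ⊆ U ∧ 0 < ε₁ ∧ ε₁ ≤ ε₀ ∧
      ContDiffOn ℝ r (fun p : EuclideanSpace ℝ (Fin n) × ℝ => w p.1 p.2) (V ×ˢ univ) ∧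
      (∀ y ∈ V, ∀ t, w y (t + T) = w y t) ∧
      ContDiffOn ℝ (r - 1 : ℕ)
        (fun p : EuclideanSpace ℝ (Fin n) × ℝ × ℝ => g₁ p.1 p.2.1 p.2.2)
        (V ×ˢ (univ ×ˢ Icc 0 ε₁)) ∧
      (∀ y ∈ V, ∀ ε ∈ Icc 0 ε₁, ∀ t, g₁ y (t + T) ε = g₁ y t ε) ∧
      ∀ ε ∈ Icc 0 ε₁,
        IsChangeOfCoordinates r D U V w ε ∧
        ∀ (I : Set ℝ) (y : ℝ → EuclideanSpace ℝ (Fin n)), I.OrdConnected → (∀ t ∈ I, y t ∈ V) →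
          (IsSolutionOn (originalField g ε) U (fun t => y t + ε • w (y t) t) I ↔
            IsSolutionOn (transformedField T g g₁ ε) V y I) := by
  obtain ⟨δ, hδ, hδU⟩ := hD.exists_cthickening_subset_open hg.isOpen_space hDU
  obtain ⟨G, hG, hGg⟩ := hg.exists_isRegularField hD.cthickening hδU
  obtain ⟨K, hK, hw, hDw, hcv⟩ := hG.exists_changeOfVariables hT hr
  -- `ε K < 1` makes the transformation invertible, and `ε K < δ / 2` makes it map `V` into `U` and
  -- onto a set containing `D`
  set ε₁ := min ε₀ (min 1 (δ / 2) / (2 * K)) with hε₁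
  have hm : 0 < min 1 (δ / 2) := lt_min one_pos (by positivity)
  have hpos : 0 < ε₁ := lt_min hε₀ (by positivity)
  have hεK : ∀ ε ∈ Icc 0 ε₁, ε * K < 1 ∧ ε * K < δ / 2 := by
    intro ε hε
    have h1 : ε * K < min 1 (δ / 2) := by
      have : ε ≤ min 1 (δ / 2) / (2 * K) := hε.2.trans (min_le_right _ _)
      rw [le_div_iff₀ (by positivity)] at this
      nlinarith
    exact ⟨h1.trans_le (min_le_left _ _), h1.trans_le (min_le_right _ _)⟩
  have hDwε : ∀ ε ∈ Icc 0 ε₁, ∀ y t, ‖ε • oscPrimitiveDeriv T G y t‖ < 1 := by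
    intro ε hε y t
    rw [norm_smul, Real.norm_of_nonneg hε.1]
    exact (mul_le_mul_of_nonneg_left (hDw y t) hε.1).trans_lt (hεK ε hε).1
  have hwε : ∀ ε ∈ Icc 0 ε₁, ∀ y t, ‖ε • oscPrimitive T G y t‖ < δ / 2 := by
    intro ε hε y t
    rw [norm_smul, Real.norm_of_nonneg hε.1]
    exact (mul_le_mul_of_nonneg_left (hw y t) hε.1).trans_lt (hεK ε hε).2
  have hV : ∀ y ∈ Metric.thickening (δ / 2) D, y ∈ Metric.cthickening δ D := fun y hy =>
    Metric.thickening_subset_cthickening _ _ (Metric.thickening_mono (by linarith) _ hy)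
  have hV' : ∀ ε ∈ Icc 0 ε₁, ∀ y ∈ Metric.thickening (δ / 2) D, ∀ t,
      y + ε • oscPrimitive T G y t ∈ Metric.cthickening δ D := by
    intro ε hε y hy t
    obtain ⟨z, hz, hyz⟩ := Metric.mem_thickening_iff.1 hy
    refine mem_cthickening_of_mem_of_norm_le hz ?_
    rw [dist_eq_norm] at hyz
    rw [add_sub_right_comm]
    refine (norm_add_le _ _).trans ?_
    linarith [hwε ε hε y t]
  have h0 : (0 : ℝ) ∈ Icc 0 ε₀ := left_mem_Icc.2 hε₀.le
  refine ⟨Metric.thickening (δ / 2) D, oscPrimitive T G, transformedRemainder T G, ε₁,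
    Metric.isOpen_thickening, Metric.self_subset_thickening (by positivity) _,
    fun y hy => hδU (hV y hy), hpos, min_le_left _ _, hG.contDiff_oscPrimitive.contDiffOn,
    fun y _ t => hG.oscPrimitive_add hT y t,
    fun p hp => (hG.contDiffAt_transformedRemainder hr
      (hDwε p.2.2 hp.2.2 p.1 p.2.1)).contDiffWithinAt,
    fun y _ ε _ t => hG.transformedRemainder_add hT y t ε, fun ε hε => ?_⟩
  obtain ⟨e, he, her, her'⟩ := hcv ε (by rw [abs_of_nonneg hε.1]; exact (hεK ε hε).1)
  constructor
  · refine ⟨e.toOpenPartialHomeomorphOfImageEq (Metric.thickening (δ / 2) D ×ˢ univ)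
      (Metric.isOpen_thickening.prod isOpen_univ) _ rfl, rfl, fun p _ => he p, ?_, ?_,
      her.contDiffOn, her'.contDiffOn⟩
    · rintro ⟨x, t⟩ ⟨hx, -⟩
      have h1 := e.apply_symm_apply (x, t)
      obtain ⟨⟨y, s⟩, hys⟩ : ∃ p, p = e.symm (x, t) := ⟨_, rfl⟩
      rw [← hys, he, Prod.mk.injEq] at h1
      refine ⟨(y, s), ⟨Metric.mem_thickening_iff.2 ⟨x, hx, ?_⟩, mem_univ _⟩, by
        rw [he]; exact Prod.ext h1.1 h1.2⟩
      have h2 : y - x = -(ε • oscPrimitive T G y s) := by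
        rw [← h1.1]
        simp
      rw [dist_eq_norm, h2, norm_neg]
      exact hwε ε hε y s
    · rintro _ ⟨⟨y, s⟩, ⟨hy, -⟩, rfl⟩
      rw [he]
      exact ⟨hδU (hV' ε hε y hy s), mem_univ _⟩
  · intro I y _ hy
    refine forall₂_congr fun t ht => ?_
    have h1 := hG.hasDerivWithinAt_changeOfVariables_iff hr he her' y I t (hDwε ε hε (y t) t)
    have h2 := hV' ε hε (y t) (hy t ht) t
    rw [hGg _ h2 t ε ⟨hε.1, hε.2.trans (min_le_left _ _)⟩] at h1
    simp only [originalField, transformedField, hδU h2, hy t ht, true_and,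
      average_eq_timeAverage (T := T) fun s => hGg (y t) (hV _ (hy t ht)) s 0 h0]
    exact h1

/-- The averaging principle for a local field: solutions of the averaged equation in the compact set
`D` approximate solutions of the original one, which therefore cannot leave `U`. -/
theorem IsLocalField.exists_approximation (hg : IsLocalField r T ε₀ U J g) (hr : 2 ≤ r)
    (hT : 0 < T) (hε₀ : 0 < ε₀) (hD : IsCompact D) (hDU : D ⊆ U) {C₀ : ℝ} (hC₀ : 0 < C₀) (L : ℝ) :
    ∃ C > 0, ∃ ε₁ > 0, ε₁ ≤ ε₀ ∧
      ∀ ε ∈ Ioc 0 ε₁, ∀ τ ∈ Icc 0 (L / ε), ∀ y₀ : ℝ → EuclideanSpace ℝ (Fin n),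
        IsSolutionOn (averagedField T g ε) D y₀ (Icc 0 τ) →
        ∀ x₀, ‖x₀ - y₀ 0‖ ≤ C₀ * ε →
          (∃ x, IsSolutionOn (originalField g ε) U x (Icc 0 τ) ∧ x 0 = x₀) ∧
          ∀ x, IsSolutionOn (originalField g ε) U x (Icc 0 τ) → x 0 = x₀ →
            ∀ t ∈ Icc 0 τ, ‖x t - y₀ t‖ ≤ C * ε := by
  obtain ⟨δ, hδ, hδU⟩ := hD.exists_cthickening_subset_open hg.isOpen_space hDU
  obtain ⟨G, hG, hGg⟩ := hg.exists_isRegularField hD.cthickening hδU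
  obtain ⟨K, hK⟩ := hG.exists_isAveragingData hT hr
  obtain ⟨C, hC, hdist⟩ := hK.exists_dist_le hC₀ L
  have h0 : (0 : ℝ) ∈ Icc 0 ε₀ := left_mem_Icc.2 hε₀.le
  refine ⟨C, hC, min ε₀ (δ / C), lt_min hε₀ (by positivity), min_le_left _ _, ?_⟩
  intro ε hε τ hτ y₀ hy₀ x₀ hx₀
  have hε' : ε ∈ Icc 0 ε₀ := ⟨hε.1.le, hε.2.trans (min_le_left _ _)⟩
  have hCε : C * ε ≤ δ := by
    have := hε.2.trans (min_le_right _ _)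
    rw [le_div_iff₀ hC] at this
    linarith
  have hτL : ε * τ ≤ L := by
    have := hτ.2
    rw [le_div_iff₀ hε.1] at this
    linarith
  obtain ⟨X, hX0, hX⟩ := hK.exists_solution ε x₀
  have hclose : ∀ t ∈ Icc 0 τ, ‖X t - y₀ t‖ ≤ C * ε := by
    refine hdist ε hε.1.le τ hτL X y₀ (fun t _ => (hX t).hasDerivWithinAt) (fun t ht => ?_)
      (by rwa [hX0])
    rw [← average_eq_timeAverage (T := T) fun s => hGg (y₀ t)
      (Metric.self_subset_cthickening _ (hy₀ t ht).1) s 0 h0]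
    exact (hy₀ t ht).2
  have hXδ : ∀ t ∈ Icc 0 τ, X t ∈ Metric.cthickening δ D := fun t ht =>
    mem_cthickening_of_mem_of_norm_le (hy₀ t ht).1 ((hclose t ht).trans hCε)
  refine ⟨⟨X, fun t ht => ⟨hδU (hXδ t ht), ?_⟩, hX0⟩, fun x hx hx0 => ?_⟩
  · rw [originalField, ← hGg _ (hXδ t ht) t ε hε']
    exact (hX t).hasDerivWithinAt
  · -- a second cutoff covers the range of the given solution, which may leave the thickening
    have hxc : IsCompact (x '' Icc 0 τ) :=
      isCompact_Icc.image_of_continuousOn fun t ht => (hx t ht).2.continuousWithinAt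
    obtain ⟨G', hG', hGg'⟩ := hg.exists_isRegularField (hD.cthickening.union hxc)
      (union_subset hδU (image_subset_iff.2 fun t ht => (hx t ht).1))
    obtain ⟨K', hK'⟩ := hG'.exists_isAveragingData hT hr
    have heq : EqOn x X (Icc 0 τ) := by
      refine hK'.solution_unique_Icc (ε := ε) (fun t ht => ?_) (fun t ht => ?_) (by rw [hx0, hX0])
      · rw [hGg' _ (Or.inr ⟨t, ht, rfl⟩) t ε hε']
        exact (hx t ht).2
      · rw [hGg' _ (Or.inl (hXδ t ht)) t ε hε', ← hGg _ (hXδ t ht) t ε hε']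
        exact (hX t).hasDerivWithinAt
    intro t ht
    rw [heq ht]
    exact hclose t ht

end Euclidean

/-! ### Local fields: periodic orbits and their stability -/

section PeriodicOrbits

open scoped InnerProductSpace RealInnerProductSpace

variable {n r : ℕ} {T ε₀ : ℝ} {U : Set (EuclideanSpace ℝ (Fin n))} {J : Set ℝ}
  {g : EuclideanSpace ℝ (Fin n) → ℝ → ℝ → EuclideanSpace ℝ (Fin n)}

namespace IsLocalField

/-- Near a point of `U`, the field `g` agrees with a global field to which the uniform estimates
apply. -/
theorem exists_isAveragingData_near (hg : IsLocalField r T ε₀ U J g) (hr : 2 ≤ r) (hT : 0 < T)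
    (hε₀ : 0 < ε₀) {c : EuclideanSpace ℝ (Fin n)} (hc : c ∈ U) :
    ∃ δ > 0, ∃ K G G₀ w DG DG₀ Dw, IsAveragingData T K G G₀ w DG DG₀ Dw ∧
      G₀ c = average T g c ∧ DG₀ c = fderiv ℝ (average T g) c ∧
      HasFDerivAt (average T g) (DG₀ c) c ∧ Metric.closedBall c δ ⊆ U ∧
      ∀ x ∈ Metric.closedBall c δ, ∀ t, ∀ ε ∈ Icc 0 ε₀, G x t ε = g x t ε := by
  obtain ⟨δ, hδ, hδU⟩ := Metric.nhds_basis_closedBall.mem_iff.1 (hg.isOpen_space.mem_nhds hc)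
  obtain ⟨G, hG, hGg⟩ := hg.exists_isRegularField (isCompact_closedBall c δ) hδU
  obtain ⟨K, hK⟩ := hG.exists_isAveragingData hT hr
  have h0 : (0 : ℝ) ∈ Icc 0 ε₀ := left_mem_Icc.2 hε₀.le
  have hev : average T g =ᶠ[𝓝 c] timeAverage T G := by
    filter_upwards [Metric.closedBall_mem_nhds c hδ] with x hx
    exact average_eq_timeAverage fun t => hGg x hx t 0 h0
  exact ⟨δ, hδ, K, G, _, _, _, _, _, hK, hev.eq_of_nhds.symm, hev.fderiv_eq.symm,
    (hK.hasFDerivAt_avg c).congr_of_eventuallyEq hev, hδU, hGg⟩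

/-- Nondegenerate equilibria of the averaged equation continue to periodic solutions. -/
theorem exists_periodic_solution (hg : IsLocalField r T ε₀ U J g) (hr : 2 ≤ r) (hT : 0 < T)
    (hε₀ : 0 < ε₀) {c : EuclideanSpace ℝ (Fin n)} (hc : c ∈ U) (hc0 : average T g c = 0)
    (hA : ¬ Module.End.HasEigenvalue (fderiv ℝ (average T g) c :
      EuclideanSpace ℝ (Fin n) →ₗ[ℝ] EuclideanSpace ℝ (Fin n)) 0) :
    ∃ C > 0, ∃ ε₁ > 0, ε₁ ≤ ε₀ ∧ ∀ ε ∈ Ioc 0 ε₁, ∃ γ : ℝ → EuclideanSpace ℝ (Fin n),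
      IsSolutionOn (originalField g ε) U γ univ ∧ (∀ t, γ (t + T) = γ t) ∧
        ∀ t, ‖γ t - c‖ ≤ C * ε := by
  obtain ⟨δ, hδ, K, G, G₀, w, DG, DG₀, Dw, hK, h0, h1, -, hδU, hGg⟩ :=
    hg.exists_isAveragingData_near hr hT hε₀ hc
  have hker : LinearMap.ker (fderiv ℝ (average T g) c :
      EuclideanSpace ℝ (Fin n) →ₗ[ℝ] EuclideanSpace ℝ (Fin n)) = ⊥ := by
    have h2 := hA
    rw [Module.End.hasEigenvalue_iff, not_not, Module.End.eigenspace_zero] at h2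
    exact h2
  obtain ⟨C, hC, ε₁, hε₁, H⟩ := hK.exists_periodic (c := c) (by rw [h0, hc0])
    (LinearEquiv.ofInjectiveEndo _ (LinearMap.ker_eq_bot.1 hker)).toContinuousLinearEquiv (by
      rw [h1]
      ext1 v
      rfl)
  refine ⟨C, hC, min ε₁ (min ε₀ (δ / C)), by positivity,
    (min_le_right _ _).trans (min_le_left _ _), fun ε hε => ?_⟩
  obtain ⟨γ, hγ, hper, hγc⟩ := H ε ⟨hε.1, hε.2.trans (min_le_left _ _)⟩
  have hε' : ε ∈ Icc 0 ε₀ :=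
    ⟨hε.1.le, hε.2.trans ((min_le_right _ _).trans (min_le_left _ _))⟩
  have hCε : C * ε ≤ δ := by
    have := hε.2.trans ((min_le_right _ _).trans (min_le_right _ _))
    rw [le_div_iff₀ hC] at this
    linarith
  have hmem : ∀ t, γ t ∈ Metric.closedBall c δ := fun t => by
    rw [mem_closedBall_iff_norm]
    exact (hγc t).trans hCε
  refine ⟨γ, fun t _ => ⟨hδU (hmem t), ?_⟩, hper, hγc⟩
  rw [originalField, ← hGg _ (hmem t) t ε hε']
  exact (hγ t).hasDerivWithinAt

/-- The Floquet multipliers of periodic solutions near a hyperbolic equilibrium of the averaged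
equation: the monodromy map is `1 + ε T A + O(ε²)`. -/
theorem exists_sameLinearType (hg : IsLocalField r T ε₀ U J g) (hr : 2 ≤ r) (hT : 0 < T)
    (hε₀ : 0 < ε₀) {c : EuclideanSpace ℝ (Fin n)} (hc : c ∈ U)
    (hA : ∀ μ ∈ complexEigenvalues (fderiv ℝ (average T g) c), μ.re ≠ 0) {C : ℝ} (hC : 0 ≤ C) :
    ∃ ε₂ > 0, ∀ ε ∈ Ioc 0 ε₂, ∀ γ : ℝ → EuclideanSpace ℝ (Fin n),
      IsSolutionOn (originalField g ε) U γ univ → (∀ t, ‖γ t - c‖ ≤ C * ε) →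
        SameLinearType T (originalField g ε) γ (fun y => ε • average T g y) c := by
  obtain ⟨δ, hδ, K, G, G₀, w, DG, DG₀, Dw, hK, h0, h1, hd, hδU, hGg⟩ :=
    hg.exists_isAveragingData_near hr hT hε₀ hc
  obtain ⟨C', hC', H⟩ := hK.exists_monodromy c hC
  obtain ⟨s₀, hs₀, hs⟩ := exists_forall_sameSpectralType hA (C' / T ^ 2)
  refine ⟨min (min 1 ε₀) (min (s₀ / T) (δ / (2 * (C + 1)))), by positivity, fun ε hε γ hγ hγc => ?_⟩
  obtain ⟨⟨hε1, hεε₀⟩, hεs, hεδ⟩ : (ε ≤ 1 ∧ ε ≤ ε₀) ∧ ε ≤ s₀ / T ∧ ε ≤ δ / (2 * (C + 1)) := by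
    simpa only [le_min_iff] using hε.2
  have hε0 := hε.1
  rw [le_div_iff₀ (by positivity)] at hεδ
  rw [le_div_iff₀ hT] at hεs
  have hmem : ∀ t, γ t ∈ Metric.ball c δ := fun t => by
    rw [mem_ball_iff_norm]
    refine (hγc t).trans_lt ?_
    nlinarith
  have hcont : Continuous γ := continuous_iff_continuousAt.2 fun t =>
    ((hγ t (mem_univ t)).2.hasDerivAt univ_mem).continuousAt
  obtain ⟨X, hX0, hX, hXT⟩ := H ε ⟨hε0.le, hε1⟩ γ hcont hγc
  have hfd : ∀ t, fderiv ℝ (fun x => originalField g ε x t) (γ t) = ε • DG (γ t) t ε := by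
    intro t
    have h2 : HasFDerivAt (fun x => ε • G x t ε) (ε • DG (γ t) t ε) (γ t) :=
      (hK.hasFDerivAt (γ t) t ε).const_smul ε
    refine (h2.congr_of_eventuallyEq ?_).fderiv
    filter_upwards [Metric.isOpen_ball.mem_nhds (hmem t)] with x hx
    rw [originalField, hGg x (Metric.ball_subset_closedBall hx) t ε ⟨hε0.le, hεε₀⟩]
  -- the scaled deviation of the monodromy map from the identity
  set B := (ε * T)⁻¹ • (X T - ContinuousLinearMap.id ℝ (EuclideanSpace ℝ (Fin n))) with hB
  have hεT : 0 < ε * T := by positivity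
  have hXB : X T = (1 : ℝ) • (1 : EuclideanSpace ℝ (Fin n) →L[ℝ] EuclideanSpace ℝ (Fin n)) +
      (ε * T) • B := by
    rw [hB, smul_inv_smul₀ hεT.ne', one_smul ℝ (1 : EuclideanSpace ℝ (Fin n) →L[ℝ] _)]
    exact (add_sub_cancel _ _).symm
  have hBA : ‖B - fderiv ℝ (average T g) c‖ ≤ C' / T ^ 2 * (ε * T) := by
    have h2 : B - fderiv ℝ (average T g) c = (ε * T)⁻¹ •
        (X T - ContinuousLinearMap.id ℝ (EuclideanSpace ℝ (Fin n)) - (ε * T) • DG₀ c) := by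
      rw [smul_sub, inv_smul_smul₀ hεT.ne', h1]
    rw [h2, norm_smul, norm_inv, Real.norm_of_nonneg hεT.le]
    calc (ε * T)⁻¹ * _ ≤ (ε * T)⁻¹ * (C' * ε ^ 2) := by gcongr
      _ = C' / T ^ 2 * (ε * T) := by
        field_simp
  have hsame := hs (ε * T) ⟨hεT, hεs⟩ B hBA
  rw [← hXB] at hsame
  have hcount : ∀ p q : ℂ → Prop, [DecidablePred p] → [DecidablePred q] →
      (∀ μ, p ((ε : ℂ) * μ) ↔ q μ) →
      (complexEigenvalues (fderiv ℝ (fun y => ε • average T g y) c)).countP p =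
      (complexEigenvalues (fderiv ℝ (average T g) c)).countP q := by
    intro p q _ _ hpq
    have h2 : fderiv ℝ (fun y => ε • average T g y) c = ε • fderiv ℝ (average T g) c := by
      rw [← h1]
      exact (hd.const_smul ε).fderiv
    rw [h2, complexEigenvalues_smul hε0.ne', Multiset.countP_map, Multiset.countP_eq_card_filter]
    congr 1
    exact Multiset.filter_congr fun μ _ => hpq μ
  refine ⟨X T, ⟨X, hX0, fun t => ?_, rfl⟩, hsame.1, ?_, ?_⟩
  · rw [hfd]
    exact hX t
  · rw [hsame.2.1]
    refine (hcount _ _ fun μ => ?_).symm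
    rw [Complex.re_ofReal_mul]
    exact ⟨fun h => by by_contra! h'; nlinarith, fun h => mul_neg_of_pos_of_neg hε0 h⟩
  · rw [hsame.2.2]
    refine (hcount _ _ fun μ => ?_).symm
    rw [Complex.re_ofReal_mul]
    exact mul_pos_iff_of_pos_left hε0

/-- If all eigenvalues at the equilibrium have negative real part, the solutions which stay close
to it attract their neighbours. -/
theorem exists_isSinkSolution (hg : IsLocalField r T ε₀ U J g) (hr : 2 ≤ r) (hT : 0 < T)
    (hε₀ : 0 < ε₀) {c : EuclideanSpace ℝ (Fin n)} (hc : c ∈ U)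
    (hA : ∀ μ ∈ complexEigenvalues (fderiv ℝ (average T g) c), μ.re < 0) {C : ℝ} (hC : 0 ≤ C) :
    ∃ ε₂ > 0, ∀ ε ∈ Ioc 0 ε₂, ∀ γ : ℝ → EuclideanSpace ℝ (Fin n),
      IsSolutionOn (originalField g ε) U γ univ → (∀ t, ‖γ t - c‖ ≤ C * ε) →
        IsSinkSolution (originalField g ε) U γ := by
  obtain ⟨δ, hδ, K, G, G₀, w, DG, DG₀, Dw, hK, h0, h1, hd, hδU, hGg⟩ :=
    hg.exists_isAveragingData_near hr hT hε₀ hc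
  obtain ⟨P, hP, hPA, p, hp, hpP⟩ := exists_lyapunov_of_re_neg hA
  obtain ⟨ε₂, hε₂, δ', hδ', m, hm, a, ha, H⟩ :=
    hK.exists_exponential_attraction hP (by rwa [h1]) hp hpP hC
  refine ⟨min (min ε₂ ε₀) (δ / (2 * (C + 1))), by positivity, fun ε hε γ hγ hγc => ?_⟩
  obtain ⟨⟨hε1, hεε₀⟩, hεδ⟩ : (ε ≤ ε₂ ∧ ε ≤ ε₀) ∧ ε ≤ δ / (2 * (C + 1)) := by
    simpa only [le_min_iff] using hε.2
  have hε0 := hε.1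
  rw [le_div_iff₀ (by positivity)] at hεδ
  have hγδ : ∀ t, ‖γ t - c‖ ≤ δ / 2 := fun t => (hγc t).trans (by nlinarith)
  have hγG : ∀ t, HasDerivAt γ (ε • G (γ t) t ε) t := fun t => by
    rw [hGg (γ t) (by rw [mem_closedBall_iff_norm]; linarith [hγδ t]) t ε ⟨hε0.le, hεε₀⟩]
    exact (hγ t (mem_univ t)).2.hasDerivAt univ_mem
  have key : ∀ η ∈ Ioc 0 (min δ' (δ / (2 * m))), ∀ x₀, ‖x₀ - γ 0‖ ≤ η →
      ∃ x, IsSolutionOn (originalField g ε) U x (Ici 0) ∧ x 0 = x₀ ∧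
        ∀ t ≥ 0, ‖x t - γ t‖ ≤ m * Real.exp (-(a * ε * t)) * η := by
    intro η hη x₀ hx₀
    have hη2 := hη.2.trans (min_le_right _ _)
    rw [le_div_iff₀ (by positivity)] at hη2
    have hη0 := hη.1
    obtain ⟨x, hx0, hx⟩ := hK.exists_solution ε x₀
    have hbound := H ε ⟨hε0, hε1⟩ γ x hγG hγc (fun t _ => (hx t).hasDerivWithinAt) η
      ⟨hη.1, hη.2.trans (min_le_left _ _)⟩ (by rwa [hx0])
    refine ⟨x, fun t ht => ?_, hx0, hbound⟩
    have hmem : x t ∈ Metric.closedBall c δ := by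
      rw [mem_closedBall_iff_norm, ← sub_add_sub_cancel (x t) (γ t) c]
      refine (norm_add_le _ _).trans ?_
      have h2 : Real.exp (-(a * ε * t)) ≤ 1 := Real.exp_le_one_iff.2 (by
        have : 0 ≤ a * ε * t := mul_nonneg (by positivity) ht
        linarith)
      have h3 : m * Real.exp (-(a * ε * t)) * η ≤ m * 1 * η := by gcongr
      linarith [hbound t ht, hγδ t]
    refine ⟨hδU hmem, ?_⟩
    rw [originalField, ← hGg _ hmem t ε ⟨hε0.le, hεε₀⟩]
    exact (hx t).hasDerivWithinAt
  constructor
  · intro δ₁ hδ₁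
    refine ⟨min (min δ' (δ / (2 * m))) (δ₁ / m), by positivity, fun x₀ hx₀ => ?_⟩
    obtain ⟨x, hx, hx0, hb⟩ := key _ ⟨by positivity, min_le_left _ (δ₁ / m)⟩ x₀ hx₀
    refine ⟨x, hx, hx0, fun t ht => (hb t ht).trans ?_⟩
    have h2 : Real.exp (-(a * ε * t)) ≤ 1 := Real.exp_le_one_iff.2 (by
      have : 0 ≤ a * ε * t := mul_nonneg (by positivity) ht
      linarith)
    calc m * Real.exp (-(a * ε * t)) * min (min δ' (δ / (2 * m))) (δ₁ / m)
        ≤ m * 1 * (δ₁ / m) := by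
          gcongr
          exact min_le_right _ _
      _ = δ₁ := by field_simp
  · refine ⟨min δ' (δ / (2 * m)), by positivity, fun x₀ hx₀ => ?_⟩
    obtain ⟨x, hx, hx0, hb⟩ := key _ ⟨by positivity, le_rfl⟩ x₀ hx₀
    refine ⟨x, hx, hx0, ?_⟩
    refine squeeze_zero_norm' (a := fun t => m * Real.exp (-(a * ε * t)) *
      min δ' (δ / (2 * m))) ?_ ?_
    · filter_upwards [eventually_ge_atTop 0] with t ht using hb t ht
    · have h2 : Tendsto (fun t => Real.exp (-(a * ε * t))) atTop (𝓝 0) :=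
        Real.tendsto_exp_neg_atTop_nhds_zero.comp
          (tendsto_id.const_mul_atTop (by positivity : 0 < a * ε))
      simpa using (h2.const_mul m).mul_const (min δ' (δ / (2 * m)))

/-- If some eigenvalue at the equilibrium has positive real part, no solution which stays close to
it is stable. -/
theorem exists_not_isStableSolution (hg : IsLocalField r T ε₀ U J g) (hr : 2 ≤ r) (hT : 0 < T)
    (hε₀ : 0 < ε₀) {c : EuclideanSpace ℝ (Fin n)} (hc : c ∈ U)
    (hA : ∃ μ ∈ complexEigenvalues (fderiv ℝ (average T g) c), 0 < μ.re) {C : ℝ} (hC : 0 ≤ C) :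
    ∃ ε₂ > 0, ∀ ε ∈ Ioc 0 ε₂, ∀ γ : ℝ → EuclideanSpace ℝ (Fin n),
      IsSolutionOn (originalField g ε) U γ univ → (∀ t, ‖γ t - c‖ ≤ C * ε) →
        ¬ IsStableSolution (originalField g ε) U γ := by
  obtain ⟨δ, hδ, K, G, G₀, w, DG, DG₀, Dw, hK, h0, h1, hd, hδU, hGg⟩ :=
    hg.exists_isAveragingData_near hr hT hε₀ hc
  obtain ⟨P, hP, ⟨u, hu⟩, σ, hσ, hPA⟩ := exists_chetaev_of_re_pos hA
  obtain ⟨ε₂, hε₂, δ', hδ', H⟩ := hK.exists_instability hP hσ (by rwa [h1]) hC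
  refine ⟨min (min ε₂ ε₀) (δ / (2 * (C + 1))), by positivity, fun ε hε γ hγ hγc hst => ?_⟩
  obtain ⟨⟨hε1, hεε₀⟩, hεδ⟩ : (ε ≤ ε₂ ∧ ε ≤ ε₀) ∧ ε ≤ δ / (2 * (C + 1)) := by
    simpa only [le_min_iff] using hε.2
  have hε0 := hε.1
  rw [le_div_iff₀ (by positivity)] at hεδ
  have hγδ : ∀ t, ‖γ t - c‖ ≤ δ / 2 := fun t => (hγc t).trans (by nlinarith)
  have hγG : ∀ t, HasDerivAt γ (ε • G (γ t) t ε) t := fun t => by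
    rw [hGg (γ t) (by rw [mem_closedBall_iff_norm]; linarith [hγδ t]) t ε ⟨hε0.le, hεε₀⟩]
    exact (hγ t (mem_univ t)).2.hasDerivAt univ_mem
  obtain ⟨η, hη, hstη⟩ := hst (min δ' (δ / 2)) (by positivity)
  -- start on the ray spanned by `u`, on which the quadratic form of `P` is positive
  set s := η / (‖u‖ + 1) with hs
  have hs0 : 0 < s := by positivity
  have hsu : ‖s • u‖ ≤ η := by
    rw [norm_smul, Real.norm_of_nonneg hs0.le, hs, div_mul_eq_mul_div, div_le_iff₀ (by positivity)]
    nlinarith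
  obtain ⟨x, hx, hx0, hxγ⟩ := hstη (γ 0 + s • u) (by rwa [add_sub_cancel_left])
  have hle := H ε ⟨hε0, hε1⟩ γ x hγG hγc (fun t ht => ?_)
    fun t ht => (hxγ t ht).trans (min_le_left _ _)
  · rw [hx0, add_sub_cancel_left, map_smul, real_inner_smul_left, real_inner_smul_right] at hle
    have : 0 < s * (s * ⟪P u, u⟫_ℝ) := by positivity
    linarith
  · have hmem : x t ∈ Metric.closedBall c δ := by
      rw [mem_closedBall_iff_norm, ← sub_add_sub_cancel (x t) (γ t) c]
      refine (norm_add_le _ _).trans ?_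
      linarith [(hxγ t ht).trans (min_le_right _ _), hγδ t]
    rw [hGg _ hmem t ε ⟨hε0.le, hεε₀⟩]
    exact (hx t ht).2

/-- Reversal of time. -/
theorem reversed (hg : IsLocalField r T ε₀ U J g) :
    IsLocalField r T ε₀ U J fun x t ε => -g x (-t) ε where
  isOpen_space := hg.isOpen_space
  isOpen_param := hg.isOpen_param
  Icc_subset := hg.Icc_subset
  contDiffOn := by
    have h1 : ContDiff ℝ r fun p : EuclideanSpace ℝ (Fin n) × ℝ × ℝ => (p.1, -p.2.1, p.2.2) := by
      fun_prop
    exact (hg.contDiffOn.comp h1.contDiffOn fun p hp => ⟨hp.1, mem_univ _, hp.2.2⟩).neg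
  periodic x hx ε hε t := by
    rw [← hg.periodic x hx ε hε (-(t + T))]
    congr 2
    ring

theorem average_reversed (hg : IsLocalField r T ε₀ U J g) (hε₀ : 0 < ε₀)
    {x : EuclideanSpace ℝ (Fin n)} (hx : x ∈ U) :
    average T (fun x t ε => -g x (-t) ε) x = -average T g x := by
  have hper : Function.Periodic (fun t => g x t 0) T := fun t =>
    hg.periodic x hx 0 (hg.Icc_subset (left_mem_Icc.2 hε₀.le)) t
  have h1 := hper.intervalIntegral_add_eq (-T) 0
  rw [neg_add_cancel, zero_add] at h1
  rw [average, average, intervalIntegral.integral_neg,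
    intervalIntegral.integral_comp_neg (fun t => g x t 0), neg_zero, h1, smul_neg]

theorem fderiv_average_reversed (hg : IsLocalField r T ε₀ U J g) (hε₀ : 0 < ε₀)
    {x : EuclideanSpace ℝ (Fin n)} (hx : x ∈ U) :
    fderiv ℝ (average T fun x t ε => -g x (-t) ε) x = -fderiv ℝ (average T g) x := by
  have hev : (average T fun x t ε => -g x (-t) ε) =ᶠ[𝓝 x] fun y => -average T g y := by
    filter_upwards [hg.isOpen_space.mem_nhds hx] with y hy using hg.average_reversed hε₀ hy
  rw [hev.fderiv_eq, fderiv_fun_neg]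

/-- The averaged equation as a special case of the original one. -/
theorem averaged (hg : IsLocalField r T ε₀ U J g) (hε₀ : 0 < ε₀) :
    IsLocalField r T ε₀ U J fun x _ _ => average T g x where
  isOpen_space := hg.isOpen_space
  isOpen_param := hg.isOpen_param
  Icc_subset := hg.Icc_subset
  contDiffOn := by
    have h1 : ContDiffOn ℝ r (average T g) U := by
      intro x hx
      obtain ⟨δ, hδ, hδU⟩ := Metric.nhds_basis_closedBall.mem_iff.1 (hg.isOpen_space.mem_nhds hx)
      obtain ⟨G, hG, hGg⟩ := hg.exists_isRegularField (isCompact_closedBall x δ) hδU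
      refine ((hG.contDiff_timeAverage.contDiffAt (x := x)).congr_of_eventuallyEq ?_
        ).contDiffWithinAt
      filter_upwards [Metric.closedBall_mem_nhds x hδ] with y hy
      exact average_eq_timeAverage fun t => hGg y hy t 0 (left_mem_Icc.2 hε₀.le)
    exact h1.comp contDiffOn_fst fun p hp => hp.1
  periodic _ _ _ _ _ := rfl

theorem average_averaged (hT : 0 < T) :
    average T (fun x _ _ => average T g x) = average T g := by
  funext x
  rw [average, intervalIntegral.integral_const, sub_zero, inv_smul_smul₀ hT.ne']

/-- Near a hyperbolic equilibrium of the averaged equation, the type of stability is determined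
by the signs of the real parts of the eigenvalues. -/
theorem exists_stability_iff (hg : IsLocalField r T ε₀ U J g) (hr : 2 ≤ r) (hT : 0 < T)
    (hε₀ : 0 < ε₀) {c : EuclideanSpace ℝ (Fin n)} (hc : c ∈ U)
    (hA : ∀ μ ∈ complexEigenvalues (fderiv ℝ (average T g) c), μ.re ≠ 0) {C : ℝ} (hC : 0 ≤ C) :
    ∃ ε₂ > 0, ∀ ε ∈ Ioc 0 ε₂, ∀ γ : ℝ → EuclideanSpace ℝ (Fin n),
      IsSolutionOn (originalField g ε) U γ univ → (∀ t, ‖γ t - c‖ ≤ C * ε) →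
        (IsStableSolution (originalField g ε) U γ ↔
          ∀ μ ∈ complexEigenvalues (fderiv ℝ (average T g) c), μ.re < 0) ∧
        (IsSinkSolution (originalField g ε) U γ ↔
          ∀ μ ∈ complexEigenvalues (fderiv ℝ (average T g) c), μ.re < 0) := by
  by_cases hneg : ∀ μ ∈ complexEigenvalues (fderiv ℝ (average T g) c), μ.re < 0
  · obtain ⟨ε₂, hε₂, H⟩ := hg.exists_isSinkSolution hr hT hε₀ hc hneg hC
    exact ⟨ε₂, hε₂, fun ε hε γ hγ hγc => ⟨iff_of_true (H ε hε γ hγ hγc).1 hneg,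
      iff_of_true (H ε hε γ hγ hγc) hneg⟩⟩
  · have hpos : ∃ μ ∈ complexEigenvalues (fderiv ℝ (average T g) c), 0 < μ.re := by
      push Not at hneg
      obtain ⟨μ, hμ, h⟩ := hneg
      exact ⟨μ, hμ, lt_of_le_of_ne h (hA μ hμ).symm⟩
    obtain ⟨ε₂, hε₂, H⟩ := hg.exists_not_isStableSolution hr hT hε₀ hc hpos hC
    exact ⟨ε₂, hε₂, fun ε hε γ hγ hγc => ⟨iff_of_false (H ε hε γ hγ hγc) hneg,
      iff_of_false (fun h => H ε hε γ hγ hγc h.1) hneg⟩⟩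

/-- The criterion for sources, obtained from the one for sinks by reversing time. -/
theorem exists_isSourceSolution_iff (hg : IsLocalField r T ε₀ U J g) (hr : 2 ≤ r) (hT : 0 < T)
    (hε₀ : 0 < ε₀) {c : EuclideanSpace ℝ (Fin n)} (hc : c ∈ U)
    (hA : ∀ μ ∈ complexEigenvalues (fderiv ℝ (average T g) c), μ.re ≠ 0) {C : ℝ} (hC : 0 ≤ C) :
    ∃ ε₂ > 0, ∀ ε ∈ Ioc 0 ε₂, ∀ γ : ℝ → EuclideanSpace ℝ (Fin n),
      IsSolutionOn (originalField g ε) U γ univ → (∀ t, ‖γ t - c‖ ≤ C * ε) →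
        (IsSourceSolution (originalField g ε) U γ ↔
          ∀ μ ∈ complexEigenvalues (fderiv ℝ (average T g) c), 0 < μ.re) := by
  have hfd := hg.fderiv_average_reversed hε₀ hc
  obtain ⟨ε₂, hε₂, H⟩ := hg.reversed.exists_stability_iff hr hT hε₀ hc (by
    rw [hfd, complexEigenvalues_neg]
    intro μ hμ
    obtain ⟨ν, hν, rfl⟩ := Multiset.mem_map.1 hμ
    simpa using hA ν hν) hC
  refine ⟨ε₂, hε₂, fun ε hε γ hγ hγc => ?_⟩
  have hfield : (fun x t => -originalField g ε x (-t)) =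
      originalField (fun x t ε => -g x (-t) ε) ε := by
    funext x t
    simp only [originalField, smul_neg]
  have hsol : IsSolutionOn (originalField (fun x t ε => -g x (-t) ε) ε) U (fun t => γ (-t))
      univ := by
    intro t _
    refine ⟨(hγ (-t) (mem_univ _)).1, HasDerivAt.hasDerivWithinAt ?_⟩
    rw [← hfield]
    convert! ((hγ (-t) (mem_univ _)).2.hasDerivAt univ_mem).scomp t (hasDerivAt_neg t) using 1
    simp
  rw [IsSourceSolution, hfield, (H ε hε _ hsol fun t => hγc (-t)).2, hfd, complexEigenvalues_neg]
  simp

/-- Solutions near a hyperbolic equilibrium of the averaged equation have the same type of stability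
as the equilibrium. -/
theorem exists_sameStabilityType (hg : IsLocalField r T ε₀ U J g) (hr : 2 ≤ r) (hT : 0 < T)
    (hε₀ : 0 < ε₀) {c : EuclideanSpace ℝ (Fin n)} (hc : c ∈ U) (hc0 : average T g c = 0)
    (hA : ∀ μ ∈ complexEigenvalues (fderiv ℝ (average T g) c), μ.re ≠ 0) {C : ℝ} (hC : 0 ≤ C) :
    ∃ ε₂ > 0, ∀ ε ∈ Ioc 0 ε₂, ∀ γ : ℝ → EuclideanSpace ℝ (Fin n),
      IsSolutionOn (originalField g ε) U γ univ → (∀ t, ‖γ t - c‖ ≤ C * ε) →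
        SameStabilityType U T (originalField g ε) γ (fun y => ε • average T g y) c := by
  have hA' : ∀ μ ∈ complexEigenvalues (fderiv ℝ (average T fun x _ _ => average T g x) c),
      μ.re ≠ 0 := by rwa [average_averaged hT]
  obtain ⟨ε₂, hε₂, H₁⟩ := hg.exists_sameLinearType hr hT hε₀ hc hA hC
  obtain ⟨ε₃, hε₃, H₂⟩ := hg.exists_stability_iff hr hT hε₀ hc hA hC
  obtain ⟨ε₄, hε₄, H₃⟩ := hg.exists_isSourceSolution_iff hr hT hε₀ hc hA hC
  obtain ⟨ε₅, hε₅, H₄⟩ := (hg.averaged hε₀).exists_stability_iff hr hT hε₀ hc hA' hC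
  obtain ⟨ε₆, hε₆, H₅⟩ := (hg.averaged hε₀).exists_isSourceSolution_iff hr hT hε₀ hc hA' hC
  rw [average_averaged hT] at H₄ H₅
  refine ⟨min ε₂ (min (min ε₃ ε₄) (min ε₅ ε₆)), by positivity, fun ε hε γ hγ hγc => ?_⟩
  obtain ⟨h2, ⟨h3, h4⟩, h5, h6⟩ : ε ≤ ε₂ ∧ (ε ≤ ε₃ ∧ ε ≤ ε₄) ∧ ε ≤ ε₅ ∧ ε ≤ ε₆ := by
    simpa only [le_min_iff] using hε.2
  have hsol : IsSolutionOn (originalField (fun x _ _ => average T g x) ε) U (fun _ => c) univ := by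
    refine fun t _ => ⟨hc, ?_⟩
    rw [originalField, hc0, smul_zero]
    exact hasDerivWithinAt_const _ _ _
  have hconst : ∀ _ : ℝ, ‖c - c‖ ≤ C * ε := fun _ => by
    rw [sub_self, norm_zero]
    exact mul_nonneg hC hε.1.le
  have k3 := H₂ ε ⟨hε.1, h3⟩ γ hγ hγc
  have k5 := H₄ ε ⟨hε.1, h5⟩ _ hsol hconst
  exact ⟨H₁ ε ⟨hε.1, h2⟩ γ hγ hγc, k3.1.trans k5.1.symm, k3.2.trans k5.2.symm,
    (H₃ ε ⟨hε.1, h4⟩ γ hγ hγc).trans (H₅ ε ⟨hε.1, h6⟩ _ hsol hconst).symm⟩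

end IsLocalField

end PeriodicOrbits

theorem mainTheorem2 {n r : ℕ} (hr : 2 ≤ r) {T ε₀ : ℝ} (hT : 0 < T) (hε₀ : 0 < ε₀)
    (D U : Set (EuclideanSpace ℝ (Fin n))) (J : Set ℝ)
    (hD : IsCompact D) (hU : IsOpen U) (hDU : D ⊆ U)
    (hJ : IsOpen J) (hJ₀ : Icc 0 ε₀ ⊆ J)
    (g : EuclideanSpace ℝ (Fin n) → ℝ → ℝ → EuclideanSpace ℝ (Fin n))
    (hg : ContDiffOn ℝ r (fun p : EuclideanSpace ℝ (Fin n) × ℝ × ℝ => g p.1 p.2.1 p.2.2)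
      (U ×ˢ (univ ×ˢ J)))
    (hper : ∀ x ∈ U, ∀ ε ∈ J, ∀ t, g x (t + T) ε = g x t ε) :
    -- the near-identity change of coordinates and the transformed system
    (∃ (V : Set (EuclideanSpace ℝ (Fin n)))
        (w : EuclideanSpace ℝ (Fin n) → ℝ → EuclideanSpace ℝ (Fin n))
        (g₁ : EuclideanSpace ℝ (Fin n) → ℝ → ℝ → EuclideanSpace ℝ (Fin n)) (ε₁ : ℝ),
      IsOpen V ∧ D ⊆ V ∧ V ⊆ U ∧ 0 < ε₁ ∧ ε₁ ≤ ε₀ ∧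
      ContDiffOn ℝ r (fun p : EuclideanSpace ℝ (Fin n) × ℝ => w p.1 p.2) (V ×ˢ univ) ∧
      (∀ y ∈ V, ∀ t, w y (t + T) = w y t) ∧
      ContDiffOn ℝ (r - 1 : ℕ)
        (fun p : EuclideanSpace ℝ (Fin n) × ℝ × ℝ => g₁ p.1 p.2.1 p.2.2)
        (V ×ˢ (univ ×ˢ Icc 0 ε₁)) ∧
      (∀ y ∈ V, ∀ ε ∈ Icc 0 ε₁, ∀ t, g₁ y (t + T) ε = g₁ y t ε) ∧
      ∀ ε ∈ Icc 0 ε₁,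
        IsChangeOfCoordinates r D U V w ε ∧
        ∀ (I : Set ℝ) (y : ℝ → EuclideanSpace ℝ (Fin n)), I.OrdConnected → (∀ t ∈ I, y t ∈ V) →
          (IsSolutionOn (originalField g ε) U (fun t => y t + ε • w (y t) t) I ↔
            IsSolutionOn (transformedField T g g₁ ε) V y I)) ∧
    -- closeness of solutions on times of order `1 / ε`
    (∀ C₀ > 0, ∀ L > 0, ∃ C > 0, ∃ ε₁ > 0, ε₁ ≤ ε₀ ∧
      ∀ ε ∈ Ioc 0 ε₁, ∀ τ ∈ Icc 0 (L / ε), ∀ y₀ : ℝ → EuclideanSpace ℝ (Fin n),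
        IsSolutionOn (averagedField T g ε) D y₀ (Icc 0 τ) →
        ∀ x₀, ‖x₀ - y₀ 0‖ ≤ C₀ * ε →
          (∃ x, IsSolutionOn (originalField g ε) U x (Icc 0 τ) ∧ x 0 = x₀) ∧
          ∀ x, IsSolutionOn (originalField g ε) U x (Icc 0 τ) → x 0 = x₀ →
            ∀ t ∈ Icc 0 τ, ‖x t - y₀ t‖ ≤ C * ε) ∧
    -- periodic solutions near nondegenerate equilibria, and their type of stability
    (∀ ys ∈ D, average T g ys = 0 →
      ¬ Module.End.HasEigenvalue
        (fderiv ℝ (average T g) ys :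
          EuclideanSpace ℝ (Fin n) →ₗ[ℝ] EuclideanSpace ℝ (Fin n)) 0 →
      ∃ C > 0, ∃ ε₁ > 0, ε₁ ≤ ε₀ ∧ ∃ γ : ℝ → ℝ → EuclideanSpace ℝ (Fin n),
        (∀ ε ∈ Ioc 0 ε₁,
          IsSolutionOn (originalField g ε) U (γ ε) univ ∧
          (∀ t, γ ε (t + T) = γ ε t) ∧ ∀ t, ‖γ ε t - ys‖ ≤ C * ε) ∧
        ((∀ μ ∈ complexEigenvalues (fderiv ℝ (average T g) ys), μ.re ≠ 0) →
          ∃ ε₂ > 0, ε₂ ≤ ε₁ ∧ ∀ ε ∈ Ioc 0 ε₂,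
            SameStabilityType U T (originalField g ε) (γ ε)
              (fun y => ε • average T g y) ys)) := by
  have hg' : IsLocalField r T ε₀ U J g := ⟨hU, hJ, hJ₀, hg, hper⟩
  refine ⟨hg'.exists_change_of_coordinates hr hT hε₀ hD hDU,
    fun C₀ hC₀ L _ => hg'.exists_approximation hr hT hε₀ hD hDU hC₀ L, fun ys hys h0 hA => ?_⟩
  obtain ⟨C, hC, ε₁, hε₁, hle, H⟩ :=
    hg'.exists_periodic_solution hr hT hε₀ (hDU hys) h0 hA
  choose! γ hγ using H
  refine ⟨C, hC, ε₁, hε₁, hle, γ, hγ, fun hre => ?_⟩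
  obtain ⟨ε₂, hε₂, H₂⟩ := hg'.exists_sameStabilityType hr hT hε₀ (hDU hys) h0 hre hC.le
  refine ⟨min ε₁ ε₂, lt_min hε₁ hε₂, min_le_left _ _, fun ε hε => ?_⟩
  obtain ⟨hsol, -, hclose⟩ := hγ ε ⟨hε.1, hε.2.trans (min_le_left _ _)⟩
  exact H₂ ε ⟨hε.1, hε.2.trans (min_le_right _ _)⟩ _ hsol hclose
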